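/- Consider the Congested Clique with $n$ nodes: computation proceeds in synchronous rounds, in each round every node sends to every node a (possibly different) message of $O(\log n)$ bits, and local computation is free. A word has $O(\log n)$ bits, and an object is a finite sequence of words; its size is its number of words. Let $\varepsilon>0$ be a constant. The objects of a sequence $\mathcal B=(B_1,\dots,B_k)$, each of size $O(n^{1-\varepsilon})$ words, are distributed among the nodes so that each object is stored at one node and each node stores objects of total size $O(n)$ words (so that the total size of $\mathcal B$ is $O(n^2)$ words). Objects are compared by an arbitrary fixed total order known to all nodes, and $\mathrm{rank}_{\mathcal B}(B_j)$ is the number of distinct objects of $\mathcal B$ that are smaller than $B_j$. Then there is a deterministic algorithm that, after $O(1)$ rounds, lets each node know $\mathrm{rank}_{\mathcal B}(B_j)$ for every object $B_j$ that it stores. Here the number of rounds depends only on $\varepsilon$ and on the constants hidden in the $O(\cdot)$ bounds on the sizes of messages, words, objects and local inputs, and not on $n$, on the order or on the input. -/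

import Mathlib

namespace CongestedClique

/-- The number of bits of a word of `O(log n)` bits in a network of `n` nodes, where `c` is the
constant hidden in the `O`: `c * (⌊log₂ n⌋ + 1)`. -/
def wordBits (c n : ℕ) : ℕ := c * (Nat.log 2 n + 1)

/-- A word: a bit string of length `wordBits c n`. -/
abbrev Word (c n : ℕ) : Type := Fin (wordBits c n) → Bool

/-- An object is a finite sequence of words. (A structure of its own, so that it carries no
order: in particular, not the lexicographic order of lists.) -/
@[ext]
structure Obj (c n : ℕ) where
  /-- the words that represent the object -/
  words : List (Word c n)

/-- The size of an object, in words. -/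
def Obj.size {c n : ℕ} (B : Obj c n) : ℕ := B.words.length

/-- A deterministic algorithm for the Congested Clique with `n` nodes, messages in `Msg`, an input
in `In` and an output in `Out` at each node. Local computation is free: all the maps are arbitrary,
and they depend on the identifier of the node. The only information that a node has is its
identifier, its own input and the messages that it has received. -/
structure Algorithm (n : ℕ) (Msg In Out : Type) where
  /-- the local states of a node -/
  State : Type
  /-- the initial state of a node, computed from its own input -/
  start : Fin n → In → State
  /-- `send v s u` is the message that node `v` in state `s` sends to node `u` -/
  send : Fin n → State → Fin n → Msg
  /-- `receive v s m` is the new state of node `v`, when its state was `s` and `m u` is the message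
  that it has received from node `u` -/
  receive : Fin n → State → (Fin n → Msg) → State
  /-- what a node outputs, computed from its own state -/
  output : Fin n → State → Out

namespace Algorithm

variable {n : ℕ} {Msg In Out : Type}

/-- The states of all nodes after `t` synchronous communication rounds; in each round every node
sends one message to every node. -/
def stateAfter (P : Algorithm n Msg In Out) (x : Fin n → In) : ℕ → Fin n → P.State
  | 0 => fun v => P.start v (x v)
  | t + 1 => fun v =>
      P.receive v (P.stateAfter x t v) (fun u => P.send u (P.stateAfter x t u) v)

/-- The output of node `v` after `t` communication rounds on the input `x`. -/
def outputAfter (P : Algorithm n Msg In Out) (x : Fin n → In) (t : ℕ) (v : Fin n) : Out :=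
  P.output v (P.stateAfter x t v)

end Algorithm

/-- An input of the large object sorting problem: node `v` holds the objects of the list `x v`.
It is admissible if every object has at most `C * n ^ (1 - ε)` words and every node holds at most
`D * n` words (so the total size is at most `D * n ^ 2` words). -/
def Admissible {c n : ℕ} (ε C D : ℝ) (x : Fin n → List (Obj c n)) : Prop :=
  (∀ v, ∀ B ∈ x v, (B.size : ℝ) ≤ C * (n : ℝ) ^ (1 - ε)) ∧
    ∀ v, (((x v).map Obj.size).sum : ℝ) ≤ D * (n : ℝ)

/-- The rank of an object `B` among all the objects of the input: the number of distinct objects of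
the input that are smaller than `B`. -/
noncomputable def rank {c n : ℕ} (ord : LinearOrder (Obj c n)) (x : Fin n → List (Obj c n))
    (B : Obj c n) : ℕ :=
  Set.ncard {A : Obj c n | (∃ v, A ∈ x v) ∧ ord.lt A B}

/-- Within `R` rounds of the Congested Clique with messages of `wordBits b n` bits, the algorithm `P`
solves the large object sorting problem for the total order `ord` on objects: on every admissible
input, every node outputs the list of the ranks of its objects. -/
def SortsWithin {b c n : ℕ} (ε C D : ℝ) (ord : LinearOrder (Obj c n))
    (P : Algorithm n (Word b n) (List (Obj c n)) (List ℕ)) (R : ℕ) : Prop :=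
  ∀ x : Fin n → List (Obj c n), Admissible ε C D x →
    ∀ v, P.outputAfter x R v = (x v).map (rank ord x)

end CongestedClique

/-! Local computation is free, so an algorithm matters only through the inputs that a node can tell
apart. Each stage of the proof says that after some further rounds a node knows a certain function
of the input (`Knows`, `Within`); `Attains.succ` turns messages that their senders know into an
actual round.

Routing. With q about √n, the places of a q × q grid are hosted by the nodes. Packets, O(n) from and
to each node, travel in O(1) rounds by round-robin dealing: they are spread so that every row holds
a fair share of the packets for each destination row, levelled inside the rows, sent to their
destination rows, levelled there by destination and delivered. Rounding costs only an additive
constant per link (`card_localDeal_le`, `card_relay_le`, `within_grid_route`). Objects travel as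
words labelled by their positions (`within_route_objects`).

Sorting. Take H ≥ 2/ε and m about n^(1/H), so that m² objects have total size O(n). Ties between
equal objects are broken by the items that carry them. After step l the items lie in m^l buckets,
ordered like the keys, each of load O(n) · m^(H - l). To refine a bucket, its items are spread over
the leaves of an m-ary tree. Every leaf picks fewer than m splitters such that intervals avoiding
them are light, and every inner node thins the union of its children's splitters to fewer than m
again (`treeNet_spec`). Besides the unavoidable factor m, a level of the tree costs a factor 3,
which is harmless at height at most H. The splitters of the root are sent back down the tree and cut
the bucket into at most m parts (`sum_refineBucket_le`, `exists_within_buckets`).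

Ranks. After H steps a bucket fits into one node. The rank of an object is one less than the number
of first occurrences up to it (`ncard_lt_add_one`). Copies of an object may span several buckets,
but then the last item of the preceding nonempty bucket is such a copy; passing this one object on
suffices to recognise first occurrences (`exists_isLink`). Their numbers in the m^H = O(n) buckets
are broadcast to all nodes (`within_ranks`). -/

namespace CongestedClique

/-! ### Algorithms as indistinguishability relations on inputs. -/

variable {n b : ℕ} {In Ω : Type}

/-- `Attains b X R κ`: some algorithm with messages of `wordBits b n` bits has, after `R` rounds on
the inputs `X ω`, states that are so fine that a node `v` is in equal states on `X ω` and `X ω'` only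
if `κ v ω ω'`. -/
def Attains (b : ℕ) (X : Ω → Fin n → In) (R : ℕ) (κ : Fin n → Ω → Ω → Prop) : Prop :=
  ∃ P : Algorithm n (Word b n) In Unit, ∀ v ω ω',
    P.stateAfter (X ω) R v = P.stateAfter (X ω') R v → κ v ω ω'

/-- Under the indistinguishability relations `κ`, node `v` knows the value of `f`. -/
def Knows (κ : Fin n → Ω → Ω → Prop) (v : Fin n) {β : Sort*} (f : Ω → β) : Prop :=
  ∀ ⦃ω ω'⦄, κ v ω ω' → f ω = f ω'

/-- Whatever algorithm has attained `κ` can be continued by `T` rounds to attain a refinement of `κ`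
that has the property `Q`. -/
def Within (b : ℕ) (X : Ω → Fin n → In) (T : ℕ) (κ : Fin n → Ω → Ω → Prop)
    (Q : (Fin n → Ω → Ω → Prop) → Prop) : Prop :=
  ∀ R, Attains b X R κ → ∃ κ', Attains b X (R + T) κ' ∧ κ' ≤ κ ∧ Q κ'

theorem Knows.mono {κ κ' : Fin n → Ω → Ω → Prop} {v : Fin n} {β : Sort*} {f : Ω → β}
    (h : Knows κ v f) (hle : κ' ≤ κ) : Knows κ' v f :=
  fun _ _ hω => h (hle _ _ _ hω)

theorem Knows.congr {κ : Fin n → Ω → Ω → Prop} {v : Fin n} {β γ : Sort*} {f : Ω → β} {g : Ω → γ}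
    (h : Knows κ v f) (hfg : ∀ ω ω', f ω = f ω' → g ω = g ω') : Knows κ v g :=
  fun _ _ hω => hfg _ _ (h hω)

theorem Within.zero {X : Ω → Fin n → In} {κ : Fin n → Ω → Ω → Prop}
    {Q : (Fin n → Ω → Ω → Prop) → Prop} (h : Q κ) : Within b X 0 κ Q :=
  fun _ hR => ⟨κ, hR, le_rfl, h⟩

theorem Within.bind {X : Ω → Fin n → In} {κ : Fin n → Ω → Ω → Prop} {T₁ T₂ : ℕ}
    {Q₁ Q₂ : (Fin n → Ω → Ω → Prop) → Prop} (h₁ : Within b X T₁ κ Q₁)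
    (h₂ : ∀ κ' ≤ κ, Q₁ κ' → Within b X T₂ κ' Q₂) : Within b X (T₁ + T₂) κ Q₂ := by
  intro R hR
  obtain ⟨κ₁, hA₁, hle₁, hQ₁⟩ := h₁ R hR
  obtain ⟨κ₂, hA₂, hle₂, hQ₂⟩ := h₂ κ₁ hle₁ hQ₁ _ hA₁
  exact ⟨κ₂, by rwa [← add_assoc], hle₂.trans hle₁, hQ₂⟩

theorem Within.mono {X : Ω → Fin n → In} {κ : Fin n → Ω → Ω → Prop} {T : ℕ}
    {Q₁ Q₂ : (Fin n → Ω → Ω → Prop) → Prop} (h₁ : Within b X T κ Q₁)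
    (h₂ : ∀ κ' ≤ κ, Q₁ κ' → Q₂ κ') : Within b X T κ Q₂ := by
  intro R hR
  obtain ⟨κ₁, hA₁, hle₁, hQ₁⟩ := h₁ R hR
  exact ⟨κ₁, hA₁, hle₁, h₂ _ hle₁ hQ₁⟩

theorem attains_zero (b : ℕ) (X : Ω → Fin n → In) :
    Attains b X 0 (fun v ω ω' => X ω v = X ω' v) :=
  ⟨{ State := In
     start := fun _ x => x
     send := fun _ _ _ => default
     receive := fun _ s _ => s
     output := fun _ _ => () }, fun _ _ _ h => h⟩

/-- The sender decodes its state by choosing any input compatible with it; since the message is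
known to the sender, the choice does not affect the message. -/
theorem Attains.succ {X : Ω → Fin n → In} {κ : Fin n → Ω → Ω → Prop} {R : ℕ}
    (h : Attains b X R κ) (msg : Fin n → Fin n → Ω → Word b n)
    (hmsg : ∀ u v, Knows κ u (msg u v)) :
    Attains b X (R + 1) (fun v ω ω' => κ v ω ω' ∧ ∀ u, msg u v ω = msg u v ω') := by
  classical
  obtain ⟨P, hP⟩ := h
  let dec : Fin n → Fin n → P.State → Word b n := fun u v s =>
    if h : ∃ ω, P.stateAfter (X ω) R u = s then msg u v h.choose else default
  have hdec : ∀ u v ω, dec u v (P.stateAfter (X ω) R u) = msg u v ω := by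
    intro u v ω
    have h : ∃ ω', P.stateAfter (X ω') R u = P.stateAfter (X ω) R u := ⟨ω, rfl⟩
    simp only [dec, dif_pos h]
    exact hmsg u v (hP _ _ _ h.choose_spec)
  -- The counter makes the first `R` rounds imitate `P`; the last component keeps the messages of
  -- the additional round.
  let A : Algorithm n (Word b n) In Unit :=
    { State := ℕ × P.State × (Fin n → Word b n)
      start := fun v x => (0, P.start v x, default)
      send := fun v s u => if s.1 < R then P.send v s.2.1 u else dec v u s.2.1
      receive := fun v s m =>
        if s.1 < R then (s.1 + 1, P.receive v s.2.1 m, default) else (s.1 + 1, s.2.1, m)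
      output := fun _ _ => () }
  have hA : ∀ ω t, t ≤ R → ∀ v, A.stateAfter (X ω) t v = (t, P.stateAfter (X ω) t v, default) := by
    intro ω t
    induction t with
    | zero => intro _ v; rfl
    | succ t ih =>
      intro ht v
      have ht' : t < R := ht
      simp only [Algorithm.stateAfter, ih ht'.le]
      simp [A, ht']
  have hA' : ∀ ω v, A.stateAfter (X ω) (R + 1) v
      = (R + 1, P.stateAfter (X ω) R v, fun u => msg u v ω) := by
    intro ω v
    simp only [Algorithm.stateAfter, hA ω R le_rfl]
    simp [A, hdec]
  refine ⟨A, fun v ω ω' hs => ?_⟩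
  rw [hA', hA'] at hs
  have hs' := congrArg Prod.snd hs
  exact ⟨hP _ _ _ (congrArg Prod.fst hs'), fun u => congrFun (congrArg Prod.snd hs') u⟩

theorem Attains.exists_output {X : Ω → Fin n → In} {κ : Fin n → Ω → Ω → Prop} {R : ℕ}
    (h : Attains b X R κ) {Out : Type} [Inhabited Out] (out : Fin n → Ω → Out)
    (hout : ∀ v, Knows κ v (out v)) :
    ∃ P : Algorithm n (Word b n) In Out, ∀ ω v, P.outputAfter (X ω) R v = out v ω := by
  classical
  obtain ⟨P, hP⟩ := h
  let A : Algorithm n (Word b n) In Out :=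
    { State := P.State
      start := P.start
      send := P.send
      receive := P.receive
      output := fun v s =>
        if h : ∃ ω, P.stateAfter (X ω) R v = s then out v h.choose else default }
  have hA : ∀ ω t, A.stateAfter (X ω) t = P.stateAfter (X ω) t := by
    intro ω t
    induction t with
    | zero => rfl
    | succ t ih => funext v; simp only [Algorithm.stateAfter, ih]; rfl
  refine ⟨A, fun ω v => ?_⟩
  have h : ∃ ω', P.stateAfter (X ω') R v = P.stateAfter (X ω) R v := ⟨ω, rfl⟩
  simp only [Algorithm.outputAfter, hA]
  simp only [A, dif_pos h]
  exact hout v (hP _ _ _ h.choose_spec)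

theorem within_sequence (X : Ω → Fin n → In) (κ : Fin n → Ω → Ω → Prop) (K : ℕ)
    (msg : Fin n → Fin n → Ω → Fin K → Word b n) (hmsg : ∀ u v, Knows κ u (msg u v)) :
    Within b X K κ (fun κ' => ∀ u v, Knows κ' v (msg u v)) := by
  induction K with
  | zero => exact Within.zero fun u v ω ω' _ => Subsingleton.elim _ _
  | succ K ih =>
    refine Within.bind (ih (fun u v ω k => msg u v ω k.castSucc)
      fun u v => (hmsg u v).congr fun ω ω' h => by rw [h]) fun κ' hle hκ' R hR => ?_
    refine ⟨_, hR.succ (fun u v ω => msg u v ω (Fin.last K))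
      (fun u v => ((hmsg u v).mono hle).congr fun ω ω' h => by rw [h]), fun v ω ω' h => h.1, ?_⟩
    intro u v ω ω' h
    funext k
    refine Fin.lastCases ?_ (fun k => ?_) k
    · exact h.2 u
    · exact congrFun (hκ' u v h.1) k

theorem succ_le_card_word (hb : 1 ≤ b) (n : ℕ) : n + 1 ≤ Fintype.card (Word b n) := by
  rw [Fintype.card_fun, Fintype.card_bool, Fintype.card_fin]
  calc n + 1 ≤ 2 ^ (Nat.log 2 n + 1) := Nat.lt_pow_succ_log_self (by norm_num) n
    _ ≤ 2 ^ wordBits b n := Nat.pow_le_pow_right (by norm_num) (Nat.le_mul_of_pos_left _ hb)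

/-- Since n < 2 ^ (⌊log₂ n⌋ + 1), one word distinguishes at least n + 1 values, and `K` words encode
all of `M`. -/
theorem within_message (hb : 1 ≤ b) (X : Ω → Fin n → In) (κ : Fin n → Ω → Ω → Prop) (K : ℕ)
    {M : Type} [Fintype M] (hM : Fintype.card M ≤ (n + 1) ^ K)
    (msg : Fin n → Fin n → Ω → M) (hmsg : ∀ u v, Knows κ u (msg u v)) :
    Within b X K κ (fun κ' => ∀ u v, Knows κ' v (msg u v)) := by
  have hcard : Fintype.card M ≤ Fintype.card (Fin K → Word b n) := by
    rw [Fintype.card_fun, Fintype.card_fin]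
    exact hM.trans (Nat.pow_le_pow_left (succ_le_card_word hb n) K)
  obtain ⟨e⟩ := Function.Embedding.nonempty_of_card_le hcard
  refine (within_sequence X κ K (fun u v ω => e (msg u v ω))
    fun u v => (hmsg u v).congr fun ω ω' h => by rw [h]).mono fun κ' _ h u v => ?_
  exact (h u v).congr fun ω ω' h => e.injective h

theorem card_finset_card_le (ι : Type) [Fintype ι] (K : ℕ) :
    Fintype.card {S : Finset ι // S.card ≤ K} ≤ (Fintype.card ι + 1) ^ K := by
  classical
  have h : Function.Injective
      (fun (S : {S : Finset ι // S.card ≤ K}) (k : Fin K) => S.1.toList[(k : ℕ)]?) := by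
    intro S S' h
    have : S.1.toList = S'.1.toList := by
      apply List.ext_getElem?
      intro k
      by_cases hk : k < K
      · exact congrFun h ⟨k, hk⟩
      · rw [List.getElem?_eq_none, List.getElem?_eq_none]
        · rw [Finset.length_toList]; exact S'.2.trans (not_lt.1 hk)
        · rw [Finset.length_toList]; exact S.2.trans (not_lt.1 hk)
    apply Subtype.ext
    rw [← Finset.toList_toFinset S.1, this, Finset.toList_toFinset]
  have := Fintype.card_le_of_injective _ h
  simpa [Fintype.card_option] using this

/-- Packets, of which at most `K` are to go from any node to any other one, are delivered in
`(a + 1) * K` rounds. -/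
theorem within_exchange (hb : 1 ≤ b) (hn : 0 < n) (X : Ω → Fin n → In)
    (κ : Fin n → Ω → Ω → Prop) (a K : ℕ) {ι : Type} [Fintype ι]
    (hι : Fintype.card ι ≤ (n + 1) ^ a) (src dst : ι → Fin n) (p : ι → Ω → Prop)
    (hp : ∀ i, Knows κ (src i) (p i))
    (hload : ∀ ω u v, Set.ncard {i | src i = u ∧ dst i = v ∧ p i ω} ≤ K) :
    Within b X ((a + 1) * K) κ (fun κ' => ∀ i, Knows κ' (dst i) (p i)) := by
  classical
  -- A node sends to another one the set of all packets that are to go there. There are at most (|ι|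
  -- + 1) ^ K such sets, hence (a + 1) * K words suffice.
  have hcard : Fintype.card {S : Finset ι // S.card ≤ K} ≤ (n + 1) ^ ((a + 1) * K) := by
    refine (card_finset_card_le ι K).trans ?_
    rw [pow_mul]
    refine Nat.pow_le_pow_left ?_ K
    have : 1 ≤ (n + 1) ^ a := Nat.one_le_pow _ _ (by omega)
    rw [pow_succ]
    nlinarith
  let msg : Fin n → Fin n → Ω → {S : Finset ι // S.card ≤ K} := fun u v ω =>
    ⟨Finset.univ.filter fun i => src i = u ∧ dst i = v ∧ p i ω, by
      have := hload ω u v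
      rwa [Set.ncard_eq_toFinset_card', Set.toFinset_ofPred] at this⟩
  refine (within_message hb X κ _ hcard msg ?_).mono fun κ' _ h i ω ω' hω => ?_
  · intro u v ω ω' hω
    apply Subtype.ext
    apply Finset.filter_congr
    intro i _
    constructor <;> rintro ⟨h₁, h₂, h₃⟩ <;> refine ⟨h₁, h₂, ?_⟩ <;> subst h₁
    · rwa [← hp i hω]
    · rwa [hp i hω]
  · have := congrArg (fun S => i ∈ S.1) (h (src i) (dst i) hω)
    simpa [msg] using this

end CongestedClique

namespace CongestedClique

/-! ### Round-robin dealing. -/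

section Deal

variable {ι G γ : Type} [LinearOrder ι] [DecidableEq G] [DecidableEq γ]

/-- The position of `i` among the members of `A` that are in its class. -/
def dealRank (cls : ι → γ) (A : Finset ι) (i : ι) : ℕ :=
  (A.filter fun j => cls j = cls i ∧ j < i).card

theorem dealRank_lt_dealRank {cls : ι → γ} {A : Finset ι} {i j : ι} (hi : i ∈ A)
    (hc : cls i = cls j) (hij : i < j) : dealRank cls A i < dealRank cls A j := by
  refine Finset.card_lt_card (Finset.ssubset_iff_of_subset ?_ |>.2 ⟨i, ?_, ?_⟩)
  · intro k hk
    simp only [Finset.mem_filter] at hk ⊢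
    exact ⟨hk.1, hk.2.1.trans hc, hk.2.2.trans hij⟩
  · simp [hi, hc, hij]
  · simp

theorem dealRank_lt_card {cls : ι → γ} {A : Finset ι} {i : ι} (hi : i ∈ A) :
    dealRank cls A i < (A.filter fun j => cls j = cls i).card := by
  refine Finset.card_lt_card (Finset.ssubset_iff_of_subset ?_ |>.2 ⟨i, ?_, ?_⟩)
  · intro k hk
    simp only [Finset.mem_filter] at hk ⊢
    exact ⟨hk.1, hk.2.1⟩
  · simp [hi]
  · simp

theorem card_range_filter_mod_le (N q y : ℕ) :
    ((Finset.range N).filter fun k => k % q = y).card ≤ N / q + 1 := by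
  have : ((Finset.range N).filter fun k => k % q = y).card ≤ (Finset.range (N / q + 1)).card := by
    refine Finset.card_le_card_of_injOn (fun k => k / q) ?_ ?_
    · intro k hk
      simp only [Finset.coe_filter, Finset.mem_range, Set.mem_ofPred_eq] at hk
      simp only [Finset.coe_range, Set.mem_Iio]
      exact Nat.lt_succ_of_le (Nat.div_le_div_right hk.1.le)
    · intro k hk k' hk' h
      simp only [Finset.coe_filter, Finset.mem_range, Set.mem_ofPred_eq] at hk hk'
      have h₁ := Nat.div_add_mod k q
      have h₂ := Nat.div_add_mod k' q
      simp only at h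
      rw [← h₁, ← h₂, h, hk.2, hk'.2]
  simpa using this

/-- `dealRank` is injective on a class, so a recipient gets at most one packet for each rank in its
residue class. -/
theorem card_deal_le (cls : ι → γ) (A : Finset ι) (c : γ) (q y : ℕ) :
    (A.filter fun i => cls i = c ∧ dealRank cls A i % q = y).card
      ≤ (A.filter fun i => cls i = c).card / q + 1 := by
  refine le_trans ?_ (card_range_filter_mod_le (A.filter fun i => cls i = c).card q y)
  refine Finset.card_le_card_of_injOn (dealRank cls A) ?_ ?_
  · intro i hi
    simp only [Finset.coe_filter, Set.mem_ofPred_eq] at hi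
    simp only [Finset.coe_filter, Finset.mem_range, Set.mem_ofPred_eq]
    refine ⟨?_, hi.2.2⟩
    have := dealRank_lt_card (cls := cls) hi.1
    rwa [hi.2.1] at this
  · intro i hi j hj h
    simp only [Finset.coe_filter, Set.mem_ofPred_eq] at hi hj
    rcases lt_trichotomy i j with hij | hij | hij
    · exact absurd h (dealRank_lt_dealRank hi.1 (hi.2.1.trans hj.2.1.symm) hij).ne
    · exact hij
    · exact absurd h (dealRank_lt_dealRank hj.1 (hj.2.1.trans hi.2.1.symm) hij).ne'

/-- Each class loses at most one packet to rounding, whence the summand `C.card`. -/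
theorem card_deal_union_le (cls : ι → γ) (A : Finset ι) (C : Finset γ) (q y : ℕ) (hq : 0 < q) :
    (A.filter fun i => cls i ∈ C ∧ dealRank cls A i % q = y).card
      ≤ (A.filter fun i => cls i ∈ C).card / q + C.card := by
  have h₁ : (A.filter fun i => cls i ∈ C ∧ dealRank cls A i % q = y).card
      = ∑ c ∈ C, (A.filter fun i => cls i = c ∧ dealRank cls A i % q = y).card := by
    rw [Finset.card_eq_sum_card_fiberwise (f := cls) (t := C)]
    · refine Finset.sum_congr rfl fun c hc => congrArg _ ?_
      ext i
      simp only [Finset.mem_filter]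
      constructor
      · rintro ⟨⟨h₁, _, h₂⟩, h₃⟩; exact ⟨h₁, h₃, h₂⟩
      · rintro ⟨h₁, h₂, h₃⟩; exact ⟨⟨h₁, h₂ ▸ hc, h₃⟩, h₂⟩
    · intro i hi
      simp only [Finset.coe_filter, Set.mem_ofPred_eq] at hi
      exact hi.2.1
  have h₂ : (A.filter fun i => cls i ∈ C).card
      = ∑ c ∈ C, (A.filter fun i => cls i = c).card := by
    rw [Finset.card_eq_sum_card_fiberwise (f := cls) (t := C)]
    · refine Finset.sum_congr rfl fun c hc => congrArg _ ?_
      ext i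
      simp only [Finset.mem_filter]
      constructor
      · rintro ⟨⟨h₁, _⟩, h₃⟩; exact ⟨h₁, h₃⟩
      · rintro ⟨h₁, h₂⟩; exact ⟨⟨h₁, h₂ ▸ hc⟩, h₂⟩
    · intro i hi
      simp only [Finset.coe_filter, Set.mem_ofPred_eq] at hi
      exact hi.2
  rw [h₁, h₂]
  calc _ ≤ ∑ c ∈ C, ((A.filter fun i => cls i = c).card / q + 1) :=
        Finset.sum_le_sum fun c _ => card_deal_le cls A c q y
    _ = ∑ c ∈ C, (A.filter fun i => cls i = c).card / q + C.card := by
        rw [Finset.sum_add_distrib]; simp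
    _ ≤ _ := by
        gcongr
        rw [Nat.le_div_iff_mul_le hq, Finset.sum_mul]
        exact Finset.sum_le_sum fun c _ => Nat.div_mul_le_self _ _

/-- The new place of `i`, when a node at place `g` that holds the packets `L` sends its packet `i` to
the place `D g L i`. -/
def relocate (D : G → Finset ι → ι → G) (A : Finset ι) (loc : ι → G) (i : ι) : G :=
  D (loc i) (A.filter fun j => loc j = loc i) i

/-- If every node deals its packets of each class round-robin to `q` recipients, then a recipient gets
from the nodes in `V` and the classes in `C` at most its share, up to rounding. -/
theorem card_localDeal_le (A : Finset ι) (loc : ι → G) (f : G → Finset ι → ι → γ)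
    (q : ℕ) [NeZero q] (V : Finset G) (C : Finset γ) (y : Fin q) :
    (A.filter fun i => loc i ∈ V ∧ f (loc i) (A.filter fun j => loc j = loc i) i ∈ C ∧
      Fin.ofNat q (dealRank (f (loc i) (A.filter fun j => loc j = loc i))
        (A.filter fun j => loc j = loc i) i) = y).card
      ≤ (A.filter fun i => loc i ∈ V ∧ f (loc i) (A.filter fun j => loc j = loc i) i ∈ C).card / q
        + V.card * C.card := by
  -- The separate deals of all nodes form one deal whose classes are the pairs of a place and a
  -- local class.
  have h := card_deal_union_le (fun i => (loc i, f (loc i) (A.filter fun j => loc j = loc i) i)) A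
    (V ×ˢ C) q y (NeZero.pos q)
  rw [Finset.card_product] at h
  simp only [Finset.mem_product] at h
  refine le_trans (Finset.card_le_card ?_) h
  intro i hi
  simp only [Finset.mem_filter] at hi ⊢
  refine ⟨hi.1, ⟨hi.2.1, hi.2.2.1⟩, ?_⟩
  have h₁ := congrArg Fin.val hi.2.2.2
  simp only [Fin.val_ofNat] at h₁
  rw [← h₁]
  congr 1
  unfold dealRank
  congr 1
  ext j
  simp only [Finset.mem_filter, Prod.mk.injEq]
  constructor
  · rintro ⟨h₁, ⟨h₂, h₃⟩, h₄⟩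
    rw [h₂] at h₃
    exact ⟨⟨h₁, h₂⟩, h₃, h₄⟩
  · rintro ⟨⟨h₁, h₂⟩, h₃, h₄⟩
    refine ⟨h₁, ⟨h₂, ?_⟩, h₄⟩
    rw [h₂]
    exact h₃

end Deal

/-! ### Moving packets by locally computed rules. -/

section Move

variable {n b : ℕ} {In Ω : Type} {ι G : Type} [DecidableEq G]

/-- Every packet of `A ω` is known to the host of the place `loc ω i` where it is. -/
def Holds (κ : Fin n → Ω → Ω → Prop) (φ : G → Fin n) (A : Ω → Finset ι) (loc : Ω → ι → G) : Prop :=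
  ∀ g i, Knows κ (φ g) (fun ω => i ∈ A ω ∧ loc ω i = g)

theorem Holds.local_eq {κ : Fin n → Ω → Ω → Prop} {φ : G → Fin n} {A : Ω → Finset ι}
    {loc : Ω → ι → G} (h : Holds κ φ A loc) (g : G) :
    Knows κ (φ g) (fun ω => (A ω).filter fun j => loc ω j = g) := by
  intro ω ω' hω
  ext i
  simp only [Finset.mem_filter]
  exact iff_of_eq (h g i hω)

/-- A rule looks only at the packets at its own place, all of which the host of that place knows. -/
theorem Holds.relocate {κ : Fin n → Ω → Ω → Prop} {φ : G → Fin n} {A : Ω → Finset ι}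
    {loc : Ω → ι → G} (h : Holds κ φ A loc) (g : G) (i : ι) (D : G → Finset ι → ι → G) (P : G → Prop) :
    Knows κ (φ g) (fun ω => i ∈ A ω ∧ loc ω i = g ∧ P (relocate D (A ω) (loc ω) i)) := by
  intro ω ω' hω
  have h₁ := h.local_eq g hω
  have h₂ := h g i hω
  simp only at h₁ h₂
  have key : ∀ ω, (i ∈ A ω ∧ loc ω i = g ∧ P (CongestedClique.relocate D (A ω) (loc ω) i)) ↔
      ((i ∈ A ω ∧ loc ω i = g) ∧ P (D g ((A ω).filter fun j => loc ω j = g) i)) := by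
    intro ω
    unfold CongestedClique.relocate
    constructor
    · rintro ⟨h₁, h₂, h₃⟩; rw [h₂] at h₃; exact ⟨⟨h₁, h₂⟩, h₃⟩
    · rintro ⟨⟨h₁, h₂⟩, h₃⟩; refine ⟨h₁, h₂, ?_⟩; rwa [h₂]
  simp only [key, h₁, h₂]

theorem ncard_host_le [Fintype G] [Fintype ι] (φ : G → Fin n) (B K : ℕ)
    (hφ : ∀ v, (Finset.univ.filter fun g => φ g = v).card ≤ B) (A : Finset ι) (l l' : ι → G)
    (hl : ∀ g g', (A.filter fun i => l i = g ∧ l' i = g').card ≤ K) (u v : Fin n) :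
    (A.filter fun i => φ (l i) = u ∧ φ (l' i) = v).card ≤ B * B * K := by
  have h := Finset.card_le_mul_card_image_of_maps_to
    (s := A.filter fun i => φ (l i) = u ∧ φ (l' i) = v)
    (t := (Finset.univ.filter fun g => φ g = u) ×ˢ (Finset.univ.filter fun g => φ g = v))
    (f := fun i => (l i, l' i)) (by intro i hi; simpa using (Finset.mem_filter.1 hi).2) K (by
      rintro ⟨g, g'⟩ _
      refine le_trans (Finset.card_le_card ?_) (hl g g')
      intro i hi
      simp only [Finset.mem_filter, Prod.mk.injEq] at hi ⊢
      exact ⟨hi.1.1, hi.2⟩)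
  rw [Finset.card_product] at h
  calc _ ≤ _ := h
    _ ≤ K * (B * B) := Nat.mul_le_mul le_rfl (Nat.mul_le_mul (hφ u) (hφ v))
    _ = _ := by ring

variable [Fintype G] [Fintype ι]

/-- Packets move directly to the places computed by the rule `D`. -/
theorem within_move (hb : 1 ≤ b) (hn : 0 < n) (X : Ω → Fin n → In) (κ : Fin n → Ω → Ω → Prop)
    (a K B : ℕ) (hcard : Fintype.card (ι × G × G × G) ≤ (n + 1) ^ a) (φ : G → Fin n)
    (hφ : ∀ v, (Finset.univ.filter fun g => φ g = v).card ≤ B) (A : Ω → Finset ι) (loc : Ω → ι → G)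
    (h : Holds κ φ A loc) (D : G → Finset ι → ι → G)
    (hl : ∀ ω g g', ((A ω).filter fun i =>
      loc ω i = g ∧ relocate D (A ω) (loc ω) i = g').card ≤ K) :
    Within b X ((a + 1) * (B * B * K)) κ
      (fun κ' => Holds κ' φ A (fun ω => relocate D (A ω) (loc ω))) := by
  classical
  -- The fourth coordinate is idle here and pinned to the source; thus direct moves and relayed
  -- moves share one type of packets and one bound on its size.
  refine (within_exchange hb hn X κ a (B * B * K) (ι := ι × G × G × G) hcard
    (fun j => φ j.2.1) (fun j => φ j.2.2.1)
    (fun j ω => j.2.2.2 = j.2.1 ∧ j.1 ∈ A ω ∧ loc ω j.1 = j.2.1 ∧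
      relocate D (A ω) (loc ω) j.1 = j.2.2.1)
    ?_ ?_).mono fun κ' _ hκ' g' i ω ω' hω => ?_
  · rintro ⟨i, g, g', g''⟩ ω ω' hω
    have := h.relocate g i D (· = g') hω
    simp only at this ⊢
    rw [this]
  · intro ω u v
    refine le_trans ?_ (ncard_host_le φ B K hφ (A ω) (loc ω) (relocate D (A ω) (loc ω)) (hl ω) u v)
    rw [← Set.ncard_coe_finset]
    refine Set.ncard_le_ncard_of_injOn (fun j => j.1) ?_ ?_ (Finset.finite_toSet _)
    · rintro ⟨i, g, g', g''⟩ ⟨h₁, h₂, _, h₃, h₄, h₅⟩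
      simp only at h₁ h₂ h₃ h₄ h₅
      simp [h₃, h₄, h₅, h₁, h₂]
    · rintro ⟨i, g, g', g''⟩ ⟨_, _, h₁, h₂, h₃, h₄⟩ ⟨i', k, k', k''⟩ ⟨_, _, h₁', h₂', h₃', h₄'⟩ hj
      simp only at h₁ h₂ h₃ h₄ h₁' h₂' h₃' h₄' hj
      subst hj
      rw [h₃] at h₃'; rw [h₄] at h₄'
      subst h₁ h₁' h₃' h₄'
      rfl
  · have h₁ : ∀ ω, (i ∈ A ω ∧ relocate D (A ω) (loc ω) i = g') ↔
        ∃ g, (g = g ∧ i ∈ A ω ∧ loc ω i = g ∧ relocate D (A ω) (loc ω) i = g') := by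
      intro ω; simp
    simp only [h₁]
    have h₂ : ∀ g, _ := fun g => hκ' (i, g, g', g) hω
    simp only at h₂
    simp only [h₂]

/-- Packets move to the places computed by the rule `D` via relays computed by the rule `M`. -/
theorem within_relay (hb : 1 ≤ b) (hn : 0 < n) (X : Ω → Fin n → In) (κ : Fin n → Ω → Ω → Prop)
    (a K B : ℕ) (hcard : Fintype.card (ι × G × G × G) ≤ (n + 1) ^ a) (φ : G → Fin n)
    (hφ : ∀ v, (Finset.univ.filter fun g => φ g = v).card ≤ B) (A : Ω → Finset ι) (loc : Ω → ι → G)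
    (h : Holds κ φ A loc) (M D : G → Finset ι → ι → G)
    (hl : ∀ ω g g', ((A ω).filter fun i =>
      loc ω i = g ∧ relocate M (A ω) (loc ω) i = g').card ≤ K)
    (hl' : ∀ ω g g', ((A ω).filter fun i =>
      relocate M (A ω) (loc ω) i = g ∧ relocate D (A ω) (loc ω) i = g').card ≤ K) :
    Within b X ((a + 1) * (B * B * K) + (a + 1) * (B * B * K)) κ
      (fun κ' => Holds κ' φ A (fun ω => relocate D (A ω) (loc ω))) := by
  classical
  -- The header lists source, relay and target. The target must travel along, because the rule `D`
  -- can be evaluated only at the source.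
  let p : ι × G × G × G → Ω → Prop := fun j ω => j.1 ∈ A ω ∧ loc ω j.1 = j.2.1 ∧
      relocate M (A ω) (loc ω) j.1 = j.2.2.1 ∧ relocate D (A ω) (loc ω) j.1 = j.2.2.2
  have hinj : ∀ ω, Set.InjOn (fun j : ι × G × G × G => j.1) {j | p j ω} := by
    rintro ω ⟨i, g, g', g''⟩ ⟨h₁, h₂, h₃, h₄⟩ ⟨i', k, k', k''⟩ ⟨h₁', h₂', h₃', h₄'⟩ hj
    simp only at h₁ h₂ h₃ h₄ h₁' h₂' h₃' h₄' hj
    subst hj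
    subst h₂ h₃ h₄ h₂' h₃' h₄'
    rfl
  refine (within_exchange hb hn X κ a (B * B * K) (ι := ι × G × G × G) hcard
    (fun j => φ j.2.1) (fun j => φ j.2.2.1) p ?_ ?_).bind fun κ₁ _ hκ₁ =>
    (within_exchange hb hn X κ₁ a (B * B * K) (ι := ι × G × G × G) hcard
    (fun j => φ j.2.2.1) (fun j => φ j.2.2.2) p hκ₁ ?_).mono fun κ' _ hκ' g'' i ω ω' hω => ?_
  · rintro ⟨i, g, g', g''⟩ ω ω' hω
    have h₁ := h.relocate g i M (· = g') hω
    have h₂ := h.relocate g i D (· = g'') hω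
    simp only [p] at h₁ h₂ ⊢
    apply propext
    constructor
    · rintro ⟨e₁, e₂, e₃, e₄⟩
      have k₁ := h₁.mp ⟨e₁, e₂, e₃⟩
      have k₂ := h₂.mp ⟨e₁, e₂, e₄⟩
      exact ⟨k₁.1, k₁.2.1, k₁.2.2, k₂.2.2⟩
    · rintro ⟨e₁, e₂, e₃, e₄⟩
      have k₁ := h₁.mpr ⟨e₁, e₂, e₃⟩
      have k₂ := h₂.mpr ⟨e₁, e₂, e₄⟩
      exact ⟨k₁.1, k₁.2.1, k₁.2.2, k₂.2.2⟩
  · intro ω u v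
    refine le_trans ?_ (ncard_host_le φ B K hφ (A ω) (loc ω) (relocate M (A ω) (loc ω)) (hl ω) u v)
    rw [← Set.ncard_coe_finset]
    refine Set.ncard_le_ncard_of_injOn (fun j => j.1) ?_ ((hinj ω).mono fun j hj => hj.2.2)
      (Finset.finite_toSet _)
    rintro ⟨i, g, g', g''⟩ ⟨h₁, h₂, h₃, h₄, h₅, h₆⟩
    simp only at h₁ h₂ h₃ h₄ h₅
    simp [h₃, h₄, h₅, h₁, h₂]
  · intro ω u v
    refine le_trans ?_ (ncard_host_le φ B K hφ (A ω) (relocate M (A ω) (loc ω))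
      (relocate D (A ω) (loc ω)) (hl' ω) u v)
    rw [← Set.ncard_coe_finset]
    refine Set.ncard_le_ncard_of_injOn (fun j => j.1) ?_ ((hinj ω).mono fun j hj => hj.2.2)
      (Finset.finite_toSet _)
    rintro ⟨i, g, g', g''⟩ ⟨h₁, h₂, h₃, h₄, h₅, h₆⟩
    simp only at h₁ h₂ h₃ h₄ h₅ h₆
    simp [h₃, h₅, h₁, h₂, h₆]
  · have h₁ : ∀ ω, (i ∈ A ω ∧ relocate D (A ω) (loc ω) i = g'') ↔ ∃ g g', p (i, g, g', g'') ω := by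
      intro ω; simp [p]
    simp only [h₁]
    have h₂ : ∀ g g', _ := fun g g' => hκ' (i, g, g', g'') hω
    simp only [h₂]

end Move

end CongestedClique

/-! ### Deterministic routing on a grid. -/

namespace CongestedClique

theorem card_place_le {ι : Type} {q : ℕ} (A : Finset ι) (l l' : ι → Fin q × Fin q) (K : ℕ)
    (h : ∀ g g', (A.filter fun i => l i = g ∧ l' i = g').card ≤ K) (g' : Fin q × Fin q) :
    (A.filter fun i => l' i = g').card ≤ K * q * q := by
  have := Finset.card_le_mul_card_image_of_maps_to (s := A.filter fun i => l' i = g')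
    (t := Finset.univ) (f := l) (by simp) K (by
      intro g _
      refine le_trans (Finset.card_le_card ?_) (h g g')
      intro i
      simp only [Finset.mem_filter]
      tauto)
  simpa [mul_assoc] using this

theorem card_row_filter {q : ℕ} (d : Fin q) :
    (Finset.univ.filter fun g : Fin q × Fin q => g.1 = d).card = q := by
  have : (Finset.univ.filter fun g : Fin q × Fin q => g.1 = d)
      = ({d} : Finset (Fin q)) ×ˢ (Finset.univ : Finset (Fin q)) := by
    ext ⟨x, y⟩; simp [eq_comm]
  rw [this, Finset.card_product]; simp

theorem card_row_le {ι : Type} {q : ℕ} (A : Finset ι) (l : ι → Fin q × Fin q) (K : ℕ)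
    (h : ∀ g, (A.filter fun i => l i = g).card ≤ K) (d : Fin q) :
    (A.filter fun i => (l i).1 = d).card ≤ K * q := by
  have := Finset.card_le_mul_card_image_of_maps_to (s := A.filter fun i => (l i).1 = d)
    (t := Finset.univ.filter fun g : Fin q × Fin q => g.1 = d) (f := l) (by
      intro i hi; simpa using (Finset.mem_filter.1 hi).2) K (by
      intro g _
      refine le_trans (Finset.card_le_card ?_) (h g)
      intro i
      simp only [Finset.mem_filter]
      tauto)
  rwa [card_row_filter] at this

section Grid

variable {ι : Type} [LinearOrder ι] {q : ℕ} [NeZero q]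

/-- Every node deals its packets for each destination row to the rows, and the packets for each of
these to the nodes of that row. -/
def spreadRule (dst : ι → Fin q × Fin q) (_g : Fin q × Fin q) (L : Finset ι) (i : ι) :
    Fin q × Fin q :=
  (Fin.ofNat q (dealRank (fun j => (dst j).1) L i),
    Fin.ofNat q (dealRank (fun j => Fin.ofNat q (dealRank (fun j => (dst j).1) L j)) L i))

/-- Every node deals its packets of each class to the nodes of its own row. -/
def levelRule {γ : Type} [DecidableEq γ] (cls : ι → γ) (g : Fin q × Fin q) (L : Finset ι) (i : ι) :
    Fin q × Fin q :=
  (g.1, Fin.ofNat q (dealRank cls L i))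

/-- Every node deals its packets for each destination row to the nodes of that row. -/
def rowRule (dst : ι → Fin q × Fin q) (_g : Fin q × Fin q) (L : Finset ι) (i : ι) :
    Fin q × Fin q :=
  ((dst i).1, Fin.ofNat q (dealRank (fun j => (dst j).1) L i))

/-- The relays over which packets move within the rows. -/
def relayRule (D : Fin q × Fin q → Finset ι → ι → Fin q × Fin q) (g : Fin q × Fin q)
    (L : Finset ι) (i : ι) : Fin q × Fin q :=
  (g.2 + (D g L i).2, Fin.ofNat q (dealRank (fun j => D g L j) L i))

theorem div_bound {x q K r : ℕ} (h : x ≤ K * q) : x / q + r ≤ K + r := by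
  gcongr
  exact Nat.div_le_of_le_mul (by rwa [mul_comm])

variable (A : Finset ι) (loc dst : ι → Fin q × Fin q)

/-- Packets from column y to column y' of a row are relayed through the row y + y'. One end and the
relay row determine the other end, so on each link there is only one pair of places to account for,
whose at most K * q packets were dealt to the q relays of that row. -/
theorem card_relay_le (D : Fin q × Fin q → Finset ι → ι → Fin q × Fin q) (K : ℕ)
    (hrow : ∀ i ∈ A, (relocate D A loc i).1 = (loc i).1)
    (hl : ∀ g g', (A.filter fun i => loc i = g ∧ relocate D A loc i = g').card ≤ K * q)
    (g g' : Fin q × Fin q) :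
    (A.filter fun i => loc i = g ∧ relocate (relayRule D) A loc i = g').card ≤ K + 1 ∧
    (A.filter fun i => relocate (relayRule D) A loc i = g ∧ relocate D A loc i = g').card
      ≤ K + 1 := by
  have key : ∀ (h h' : Fin q × Fin q) (y : Fin q),
      (A.filter fun i => loc i = h ∧ relocate D A loc i = h' ∧
        (relocate (relayRule D) A loc i).2 = y).card ≤ K + 1 := by
    intro h h' y
    have := card_localDeal_le A loc D q {h} {h'} y
    simp only [Finset.mem_singleton, Finset.card_singleton] at this
    exact this.trans (div_bound (hl h h'))
  constructor
  · refine le_trans (Finset.card_le_card ?_) (key g (g.1, g'.1 - g.2) g'.2)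
    intro i hi
    simp only [Finset.mem_filter] at hi ⊢
    obtain ⟨hA, h₁, h₂⟩ := hi
    refine ⟨hA, h₁, Prod.ext ?_ ?_, by rw [h₂]⟩
    · rw [hrow i hA, h₁]
    · have h₃ : (loc i).2 + (relocate D A loc i).2 = g'.1 := congrArg Prod.fst h₂
      rw [← h₃, h₁, add_sub_cancel_left]
  · refine le_trans (Finset.card_le_card ?_) (key (g'.1, g.1 - g'.2) g' g.2)
    intro i hi
    simp only [Finset.mem_filter] at hi ⊢
    obtain ⟨hA, h₁, h₂⟩ := hi
    refine ⟨hA, Prod.ext ?_ ?_, h₂, by rw [h₁]⟩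
    · rw [← hrow i hA, h₂]
    · have h₃ : (loc i).2 + (relocate D A loc i).2 = g.1 := congrArg Prod.fst h₁
      rw [← h₃, h₂, add_sub_cancel_right]

/-- Two deals in succession: at most K * q + q packets of a place are assigned to a row, and at most
K + 2 of these to one node there. -/
theorem card_spread_edge_le (K : ℕ) (h : ∀ g, (A.filter fun i => loc i = g).card ≤ K * q * q)
    (g g' : Fin q × Fin q) :
    (A.filter fun i => loc i = g ∧ relocate (spreadRule dst) A loc i = g').card ≤ K + 2 := by
  have h₁ := card_localDeal_le A loc (fun _ _ j => (dst j).1) q {g} Finset.univ g'.1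
  have h₂ := card_localDeal_le A loc
    (fun _ L j => Fin.ofNat q (dealRank (fun j => (dst j).1) L j)) q {g} {g'.1} g'.2
  simp only [Finset.mem_singleton, Finset.card_singleton, Finset.mem_univ, true_and, and_true,
    Finset.card_univ, Fintype.card_fin, one_mul] at h₁ h₂
  have h₃ := h₁.trans (div_bound (r := q) (h g))
  have h₄ : K * q + q = (K + 1) * q := by ring
  rw [h₄] at h₃
  refine le_trans (Finset.card_le_card ?_) (h₂.trans (div_bound (r := 1) h₃))
  intro i hi
  simp only [Finset.mem_filter] at hi ⊢
  exact ⟨hi.1, hi.2.1, congrArg Prod.fst hi.2.2, congrArg Prod.snd hi.2.2⟩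

/-- At most K * q³ packets are for row d, and q² places deal them to q rows, with a rounding loss of
one per place. -/
theorem card_spread_row_le (K : ℕ) (h : ∀ d, (A.filter fun i => (dst i).1 = d).card ≤ K * q * q * q)
    (x d : Fin q) :
    (A.filter fun i => (relocate (spreadRule dst) A loc i).1 = x ∧ (dst i).1 = d).card
      ≤ (K + 1) * q * q := by
  have h₁ := card_localDeal_le A loc (fun _ _ j => (dst j).1) q Finset.univ {d} x
  simp only [Finset.mem_singleton, Finset.card_singleton, Finset.mem_univ, true_and,
    Finset.card_univ, Fintype.card_prod, Fintype.card_fin, mul_one] at h₁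
  have h₃ := h₁.trans (div_bound (r := q * q) (h d))
  have h₄ : K * q * q + q * q = (K + 1) * q * q := by ring
  rw [h₄] at h₃
  refine le_trans (Finset.card_le_card ?_) h₃
  intro i hi
  simp only [Finset.mem_filter] at hi ⊢
  exact ⟨hi.1, hi.2.2, hi.2.1⟩

theorem card_level_pair_le (cls : ι → Fin q × Fin q) (K : ℕ)
    (h : ∀ g, (A.filter fun i => loc i = g).card ≤ K * q * q)
    (hcls : ∀ i ∈ A, (cls i).1 = (loc i).1) (g g' : Fin q × Fin q) :
    (A.filter fun i => loc i = g ∧ relocate (levelRule cls) A loc i = g').card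
      ≤ (K + 1) * q := by
  have h₁ := card_localDeal_le A loc (fun _ _ j => cls j) q {g}
    (Finset.univ.filter fun d => d.1 = g.1) g'.2
  simp only [Finset.mem_singleton, Finset.card_singleton, one_mul, card_row_filter] at h₁
  have h₂ : (A.filter fun i => loc i = g ∧ cls i ∈ Finset.univ.filter fun d => d.1 = g.1).card
      ≤ K * q * q := le_trans (Finset.card_le_card (by
    intro i
    simp only [Finset.mem_filter]
    tauto)) (h g)
  have h₃ := h₁.trans (div_bound (r := q) h₂)
  have h₄ : K * q + q = (K + 1) * q := by ring
  rw [h₄] at h₃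
  refine le_trans (Finset.card_le_card ?_) h₃
  intro i hi
  simp only [Finset.mem_filter] at hi ⊢
  refine ⟨hi.1, hi.2.1, ?_, congrArg Prod.snd hi.2.2⟩
  simp [hcls i hi.1, hi.2.1]

theorem card_level_pair_le' (cls : ι → Fin q) (K : ℕ)
    (h : ∀ g, (A.filter fun i => loc i = g).card ≤ K * q * q) (g g' : Fin q × Fin q) :
    (A.filter fun i => loc i = g ∧ relocate (levelRule cls) A loc i = g').card
      ≤ (K + 1) * q := by
  have h₁ := card_localDeal_le A loc (fun _ _ j => cls j) q {g} Finset.univ g'.2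
  simp only [Finset.mem_singleton, Finset.card_singleton, Finset.mem_univ, true_and, and_true,
    Finset.card_univ, Fintype.card_fin, one_mul] at h₁
  have h₃ := h₁.trans (div_bound (r := q) (h g))
  have h₄ : K * q + q = (K + 1) * q := by ring
  rw [h₄] at h₃
  refine le_trans (Finset.card_le_card ?_) h₃
  intro i hi
  simp only [Finset.mem_filter] at hi ⊢
  exact ⟨hi.1, hi.2.1, congrArg Prod.snd hi.2.2⟩

/-- The q places of a row deal the at most K * q² packets of a class that are in this row to its q
columns. -/
theorem card_level_class_le {γ : Type} [DecidableEq γ] (cls : ι → γ) (K : ℕ) (c : γ)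
    (x y : Fin q) (h : (A.filter fun i => (loc i).1 = x ∧ cls i = c).card ≤ K * q * q) :
    (A.filter fun i => relocate (levelRule cls) A loc i = (x, y) ∧ cls i = c).card
      ≤ (K + 1) * q := by
  have h₁ := card_localDeal_le A loc (fun _ _ j => cls j) q
    (Finset.univ.filter fun g => g.1 = x) {c} y
  simp only [Finset.mem_singleton, Finset.card_singleton, card_row_filter, mul_one,
    Finset.mem_filter, Finset.mem_univ, true_and] at h₁
  have h₃ := h₁.trans (div_bound (r := q) h)
  have h₄ : K * q + q = (K + 1) * q := by ring
  rw [h₄] at h₃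
  refine le_trans (Finset.card_le_card ?_) h₃
  intro i hi
  simp only [Finset.mem_filter] at hi ⊢
  exact ⟨hi.1, congrArg Prod.fst hi.2.1, hi.2.2, congrArg Prod.snd hi.2.1⟩

theorem card_row_edge_le (K : ℕ)
    (h : ∀ g d, (A.filter fun i => loc i = g ∧ (dst i).1 = d).card ≤ K * q)
    (g g' : Fin q × Fin q) :
    (A.filter fun i => loc i = g ∧ relocate (rowRule dst) A loc i = g').card ≤ K + 1 := by
  have h₁ := card_localDeal_le A loc (fun _ _ j => (dst j).1) q {g} {g'.1} g'.2
  simp only [Finset.mem_singleton, Finset.card_singleton, mul_one] at h₁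
  refine le_trans (Finset.card_le_card ?_)
    (h₁.trans (div_bound (r := 1) (h g g'.1)))
  intro i hi
  simp only [Finset.mem_filter] at hi ⊢
  exact ⟨hi.1, hi.2.1, (congrArg Prod.fst hi.2.2 :), congrArg Prod.snd hi.2.2⟩

end Grid

/-- Routing on a grid, whose places are hosted by the nodes. -/
theorem within_grid_route {n b : ℕ} {In Ω ι : Type} [Fintype ι] [LinearOrder ι] (hb : 1 ≤ b)
    (hn : 0 < n) (X : Ω → Fin n → In) (κ : Fin n → Ω → Ω → Prop) (a K B q : ℕ) [NeZero q]
    (hcard : Fintype.card (ι × (Fin q × Fin q) × (Fin q × Fin q) × (Fin q × Fin q)) ≤ (n + 1) ^ a)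
    (φ : Fin q × Fin q → Fin n) (hφ : ∀ v, (Finset.univ.filter fun g => φ g = v).card ≤ B)
    (A : Ω → Finset ι) (src dst : ι → Fin q × Fin q) (h : Holds κ φ A (fun _ => src))
    (hsrc : ∀ ω g, ((A ω).filter fun i => src i = g).card ≤ K * q * q)
    (hdst : ∀ ω g, ((A ω).filter fun i => dst i = g).card ≤ K * q * q) :
    Within b X (8 * ((a + 1) * (B * B * (K + 5)))) κ
      (fun κ' => Holds κ' φ A (fun _ => dst)) := by
  -- Five phases, of which the second, the fourth and the fifth are relayed: 1 + 2 + 1 + 2 + 2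
  -- exchanges. No link carries more than K + 5 packets in any of them.
  have e : 8 * ((a + 1) * (B * B * (K + 5))) =
    (a + 1) * (B * B * (K + 5)) + (((a + 1) * (B * B * (K + 5)) + (a + 1) * (B * B * (K + 5))) +
    ((a + 1) * (B * B * (K + 5)) + (((a + 1) * (B * B * (K + 5)) + (a + 1) * (B * B * (K + 5))) +
    ((a + 1) * (B * B * (K + 5)) + (a + 1) * (B * B * (K + 5)))))) := by ring
  rw [e]
  have s₁ := fun ω => card_spread_edge_le (A ω) src dst K (hsrc ω)
  refine (within_move hb hn X κ a (K + 5) B hcard φ hφ A _ h (spreadRule dst)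
    (fun ω g g' => (s₁ ω g g').trans (by omega))).bind fun κ₁ _ h₁ => ?_
  generalize hl₁ : (fun ω => relocate (spreadRule dst) (A ω) src) = loc₁ at h₁
  have r₁ : ∀ ω x d, ((A ω).filter fun i => (loc₁ ω i).1 = x ∧ (dst i).1 = d).card
      ≤ (K + 1) * q * q := by
    intro ω
    subst hl₁
    refine card_spread_row_le (A ω) src dst K fun d => ?_
    exact card_row_le (A ω) dst _ (hdst ω) d
  have s₁' : ∀ ω g, ((A ω).filter fun i => loc₁ ω i = g).card ≤ (K + 2) * q * q := by
    intro ω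
    subst hl₁
    exact card_place_le (A ω) src _ _ (s₁ ω)
  -- Levelling inside the rows: afterwards every place holds at most (K + 2) * q packets for each
  -- destination row.
  have s₂ := fun ω => card_relay_le (A ω) (loc₁ ω) (levelRule fun i => (dst i).1)
    (K + 3) (fun _ _ => rfl) (card_level_pair_le' (A ω) (loc₁ ω) (fun i => (dst i).1) (K + 2) (s₁' ω))
  refine (within_relay hb hn X κ₁ a (K + 5) B hcard φ hφ A loc₁ h₁ _ (levelRule fun i => (dst i).1)
    (fun ω g g' => (s₂ ω g g').1.trans (by omega))
    (fun ω g g' => (s₂ ω g g').2.trans (by omega))).bind fun κ₂ _ h₂ => ?_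
  generalize hl₂ : (fun ω => relocate (levelRule fun i => (dst i).1) (A ω) (loc₁ ω)) = loc₂ at h₂
  have r₂ : ∀ ω g d, ((A ω).filter fun i => loc₂ ω i = g ∧ (dst i).1 = d).card
      ≤ (K + 2) * q := by
    intro ω g d
    subst hl₂
    exact card_level_class_le (A ω) (loc₁ ω) (fun i => (dst i).1) (K + 1) d g.1 g.2 (r₁ ω g.1 d)
  -- Hence the packets can go to their destination rows directly.
  have s₃ := fun ω => card_row_edge_le (A ω) (loc₂ ω) dst (K + 2) (r₂ ω)
  refine (within_move hb hn X κ₂ a (K + 5) B hcard φ hφ A loc₂ h₂ (rowRule dst)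
    (fun ω g g' => (s₃ ω g g').trans (by omega))).bind fun κ₃ _ h₃ => ?_
  generalize hl₃ : (fun ω => relocate (rowRule dst) (A ω) (loc₂ ω)) = loc₃ at h₃
  have s₃' : ∀ ω g, ((A ω).filter fun i => loc₃ ω i = g).card ≤ (K + 3) * q * q := by
    intro ω
    subst hl₃
    exact card_place_le (A ω) (loc₂ ω) _ _ (s₃ ω)
  have e₃ : ∀ ω i, (dst i).1 = (loc₃ ω i).1 := by
    intro ω i
    subst hl₃
    rfl
  -- Levelling by destination inside the destination rows: afterwards every place holds at most (K +
  -- 1) * q packets for each destination.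
  have s₄ := fun ω => card_relay_le (A ω) (loc₃ ω) (levelRule dst)
    (K + 4) (fun _ _ => rfl)
    (card_level_pair_le (A ω) (loc₃ ω) dst (K + 3) (s₃' ω) fun i _ => e₃ ω i)
  refine (within_relay hb hn X κ₃ a (K + 5) B hcard φ hφ A loc₃ h₃ _ (levelRule dst)
    (fun ω g g' => (s₄ ω g g').1.trans (by omega))
    (fun ω g g' => (s₄ ω g g').2.trans (by omega))).bind fun κ₄ _ h₄ => ?_
  generalize hl₄ : (fun ω => relocate (levelRule dst) (A ω) (loc₃ ω)) = loc₄ at h₄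
  have r₄ : ∀ ω g d, ((A ω).filter fun i => loc₄ ω i = g ∧ dst i = d).card ≤ (K + 1) * q := by
    intro ω g d
    subst hl₄
    refine card_level_class_le (A ω) (loc₃ ω) dst K d g.1 g.2 (le_trans (Finset.card_le_card ?_)
      (hdst ω d))
    intro i
    simp only [Finset.mem_filter]
    tauto
  have e₄ : ∀ ω i, (dst i).1 = (loc₄ ω i).1 := by
    intro ω i
    subst hl₄
    exact e₃ ω i
  -- The remaining demand between two places of a row is small enough for relayed delivery.
  have s₅ := fun ω => card_relay_le (A ω) (loc₄ ω) (fun _ _ i => dst i)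
    (K + 1) (fun i _ => e₄ ω i) (r₄ ω)
  exact within_relay hb hn X κ₄ a (K + 5) B hcard φ hφ A loc₄ h₄ _ (fun _ _ i => dst i)
    (fun ω g g' => (s₅ ω g g').1.trans (by omega))
    (fun ω g g' => (s₅ ω g g').2.trans (by omega))

end CongestedClique

/-! ### Routing between nodes: packets, values and objects. -/

namespace CongestedClique

variable {n b c : ℕ} {In Ω : Type}

/-- The number of rounds in which packets that are tagged by at most `(n + 1) ^ a` tags are routed, at
most `K * n` from each node and at most `K * n` to each node. -/
def routeRounds (a K : ℕ) : ℕ := 8 * ((a + 9 + 1) * (5 * 5 * (K + 5)))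

theorem le_succ_pow (hn : 0 < n) (K : ℕ) : K ≤ (n + 1) ^ K :=
  (Nat.lt_pow_self (by omega : 1 < n + 1)).le

theorem within_route (hb : 1 ≤ b) (hn : 0 < n) (X : Ω → Fin n → In) (κ : Fin n → Ω → Ω → Prop)
    (a K : ℕ) {ι : Type} [Fintype ι] (hι : Fintype.card ι ≤ (n + 1) ^ a) (src dst : ι → Fin n)
    (p : ι → Ω → Prop) (hp : ∀ i, Knows κ (src i) (p i))
    (hsrc : ∀ ω v, Set.ncard {i | src i = v ∧ p i ω} ≤ K * n)
    (hdst : ∀ ω v, Set.ncard {i | dst i = v ∧ p i ω} ≤ K * n) :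
    Within b X (routeRounds a K) κ (fun κ' => ∀ i, Knows κ' (dst i) (p i)) := by
  classical
  let _ : LinearOrder ι := LinearOrder.lift' (Fintype.equivFin ι) (Fintype.equivFin ι).injective
  -- From n < q² ≤ 4n, every node has a place of its own in the grid and hosts at most 5 places.
  obtain ⟨q, hq⟩ : ∃ q, q = Nat.sqrt n + 1 := ⟨_, rfl⟩
  have : NeZero q := ⟨by omega⟩
  have hq₁ : n < q * q := by rw [hq]; exact Nat.lt_succ_sqrt n
  have hq₂ : q * q ≤ 4 * n := by
    have h₁ := Nat.sqrt_le n
    have h₂ := Nat.sqrt_le_self n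
    rw [hq]
    nlinarith
  let φ : Fin q × Fin q → Fin n := fun g => ⟨(g.1 * q + g.2) % n, Nat.mod_lt _ hn⟩
  let pl : Fin n → Fin q × Fin q := fun v => (Fin.ofNat q (v / q), Fin.ofNat q (v % q))
  have hφpl : ∀ v, φ (pl v) = v := by
    intro v
    apply Fin.ext
    have h₁ : (v : ℕ) / q < q := Nat.div_lt_of_lt_mul (v.2.trans hq₁)
    have h₂ : (v : ℕ) % q < q := Nat.mod_lt _ (NeZero.pos q)
    simp only [φ, pl, Fin.val_ofNat]
    rw [Nat.mod_eq_of_lt h₁, Nat.mod_eq_of_lt h₂, Nat.div_add_mod', Nat.mod_eq_of_lt v.2]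
  have hφ : ∀ v, (Finset.univ.filter fun g => φ g = v).card ≤ 5 := by
    intro v
    have h₁ := card_range_filter_mod_le (q * q) n v
    have h₂ : q * q / n ≤ 4 := Nat.div_le_of_le_mul (by linarith)
    refine le_trans (Finset.card_le_card_of_injOn (fun g => (g.1 : ℕ) * q + g.2) ?_ ?_)
      (h₁.trans (by omega))
    · intro g hg
      simp only [Finset.coe_filter, Finset.mem_univ, true_and, Set.mem_ofPred_eq,
        Finset.mem_range] at hg ⊢
      refine ⟨?_, congrArg Fin.val hg⟩
      have := g.1.2
      have := g.2.2
      nlinarith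
    · rintro ⟨x, y⟩ _ ⟨x', y'⟩ _ hxy
      simp only at hxy
      have h₁ := congrArg (· / q) hxy
      have h₂ := congrArg (· % q) hxy
      simp only [Nat.mul_add_mod', Nat.mod_eq_of_lt y.2,
        Nat.mod_eq_of_lt y'.2] at h₂
      have h₃ : ∀ (x y : Fin q), ((x : ℕ) * q + y) / q = x := by
        intro x y
        rw [mul_comm, Nat.mul_add_div (NeZero.pos q), Nat.div_eq_of_lt y.2, add_zero]
      simp only [h₃] at h₁
      exact Prod.ext (Fin.ext h₁) (Fin.ext h₂)
  have hcard : Fintype.card (ι × (Fin q × Fin q) × (Fin q × Fin q) × (Fin q × Fin q))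
      ≤ (n + 1) ^ (a + 9) := by
    simp only [Fintype.card_prod, Fintype.card_fin]
    have h₁ : q * q ≤ (n + 1) ^ 3 := hq₂.trans (by nlinarith [Nat.zero_le (n ^ 3)])
    calc _ ≤ (n + 1) ^ a * ((n + 1) ^ 3 * ((n + 1) ^ 3 * (n + 1) ^ 3)) := by gcongr
      _ = _ := by ring
  let A : Ω → Finset ι := fun ω => Finset.univ.filter fun i => p i ω
  have hload : ∀ (l : ι → Fin n), (∀ ω v, Set.ncard {i | l i = v ∧ p i ω} ≤ K * n) →
      ∀ ω g, ((A ω).filter fun i => pl (l i) = g).card ≤ K * q * q := by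
    intro l hl ω g
    have h₁ : K * n ≤ K * q * q := by rw [mul_assoc]; exact Nat.mul_le_mul_left _ hq₁.le
    refine le_trans ?_ ((hl ω (φ g)).trans h₁)
    rw [← Set.ncard_coe_finset]
    refine Set.ncard_le_ncard ?_ (Set.toFinite _)
    intro i hi
    simp only [A, Finset.coe_filter, Finset.mem_filter, Finset.mem_univ, true_and,
      Set.mem_ofPred_eq] at hi ⊢
    exact ⟨by rw [← hi.2, hφpl], hi.1⟩
  refine (within_grid_route hb hn X κ (a + 9) K 5 q hcard φ hφ A (fun i => pl (src i))
    (fun i => pl (dst i)) ?_ (hload src hsrc) (hload dst hdst)).mono fun κ' _ h i => ?_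
  · intro g i ω ω' hω
    by_cases hg : pl (src i) = g
    · subst hg
      rw [hφpl] at hω
      have := hp i hω
      simp [A, this]
    · simp [hg]
  · have := h (pl (dst i)) i
    rw [hφpl] at this
    simpa [A] using this

/-- Routing of optional values that are tagged by `τ : T`. -/
theorem within_route_values (hb : 1 ≤ b) (hn : 0 < n) (X : Ω → Fin n → In)
    (κ : Fin n → Ω → Ω → Prop) (a K : ℕ) {T β : Type} [Fintype T] [Fintype β]
    (hT : Fintype.card T * Fintype.card β ≤ (n + 1) ^ a)
    (src dst : T → Fin n) (val : T → Ω → Option β) (hval : ∀ τ, Knows κ (src τ) (val τ))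
    (hsrc : ∀ ω v, Set.ncard {τ | src τ = v ∧ val τ ω ≠ none} ≤ K * n)
    (hdst : ∀ ω v, Set.ncard {τ | dst τ = v ∧ val τ ω ≠ none} ≤ K * n) :
    Within b X (routeRounds a K) κ (fun κ' => ∀ τ, Knows κ' (dst τ) (val τ)) := by
  have hload : ∀ (l : T → Fin n), (∀ ω v, Set.ncard {τ | l τ = v ∧ val τ ω ≠ none} ≤ K * n) →
      ∀ ω v, Set.ncard {i : T × β | l i.1 = v ∧ val i.1 ω = some i.2} ≤ K * n := by
    intro l hl ω v
    refine le_trans (Set.ncard_le_ncard_of_injOn Prod.fst ?_ ?_ (Set.toFinite _)) (hl ω v)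
    · rintro ⟨τ, x⟩ ⟨h₁, h₂⟩
      exact ⟨h₁, by rw [h₂]; simp⟩
    · rintro ⟨τ, x⟩ ⟨_, h₁⟩ ⟨τ', x'⟩ ⟨_, h₂⟩ h
      simp only at h h₁ h₂
      subst h
      rw [h₁] at h₂
      rw [Option.some.inj h₂]
  refine (within_route hb hn X κ a K (ι := T × β) (by rwa [Fintype.card_prod])
    (fun i => src i.1) (fun i => dst i.1) (fun i ω => val i.1 ω = some i.2) ?_
    (hload src hsrc) (hload dst hdst)).mono fun κ' _ h τ ω ω' hω => ?_
  · rintro ⟨τ, x⟩ ω ω' hω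
    simp only [hval τ hω]
  · apply Option.ext
    intro x
    exact iff_of_eq (h (τ, x) hω)

/-- The number of packets for the transmission of an optional object. -/
def cost : Option (Obj c n) → ℕ
  | none => 0
  | some B => B.size + 1

theorem one_le_cost {o : Option (Obj c n)} (h : o ≠ none) : 1 ≤ cost o := by
  cases o with
  | none => exact absurd rfl h
  | some B => exact Nat.le_add_left 1 _

/-- The number of rounds in which tagged objects of total cost at most `K * n` from each node and at
most `K * n` to each node are routed. -/
def objectRounds (a c K : ℕ) : ℕ := routeRounds (a + (K + 2 * c + 2)) K

theorem card_word_le (hn : 0 < n) (c : ℕ) : Fintype.card (Word c n) ≤ (n + 1) ^ (2 * c) := by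
  rw [Fintype.card_fun, Fintype.card_bool, Fintype.card_fin, wordBits, mul_comm, pow_mul, pow_mul]
  refine Nat.pow_le_pow_left ?_ c
  have := Nat.pow_log_le_self 2 hn.ne'
  rw [pow_succ]
  nlinarith

theorem within_route_objects (hb : 1 ≤ b) (hn : 0 < n) (X : Ω → Fin n → In)
    (κ : Fin n → Ω → Ω → Prop) (a K : ℕ) {T : Type} [Fintype T]
    (hT : Fintype.card T ≤ (n + 1) ^ a)
    (src dst : T → Fin n) (o : T → Ω → Option (Obj c n)) (ho : ∀ τ, Knows κ (src τ) (o τ))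
    (hsrc : ∀ ω v, ∑ τ ∈ Finset.univ.filter (fun τ => src τ = v), cost (o τ ω) ≤ K * n)
    (hdst : ∀ ω v, ∑ τ ∈ Finset.univ.filter (fun τ => dst τ = v), cost (o τ ω) ≤ K * n) :
    Within b X (objectRounds a c K) κ (fun κ' => ∀ τ, Knows κ' (dst τ) (o τ)) := by
  classical
  -- The packet `none` announces that the object is present, which distinguishes the empty object
  -- from an absent one; `(j, w)` says that word number j is w.
  let p : T × Option (Fin (K * n) × Word c n) → Ω → Prop := fun i ω =>
    match i.2 with
    | none => o i.1 ω ≠ none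
    | some (j, w) => ∃ B, o i.1 ω = some B ∧ B.words[(j : ℕ)]? = some w
  have hone : ∀ ω τ, (Finset.univ.filter fun y => p (τ, y) ω).card ≤ cost (o τ ω) := by
    intro ω τ
    rcases h : o τ ω with _ | B
    · rw [Finset.card_eq_zero.2]
      · exact Nat.zero_le _
      · refine Finset.filter_eq_empty_iff.2 ?_
        rintro (_ | ⟨j, w⟩) _ <;> simp [p, h]
    · rw [cost, ← Finset.card_range (B.size + 1)]
      refine Finset.card_le_card_of_injOn
        (fun y => match y with | none => 0 | some (j, w) => (j : ℕ) + 1) ?_ ?_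
      · rintro (_ | ⟨j, w⟩) hy
        · simp
        · simp only [Finset.coe_filter, Finset.mem_univ, true_and, Set.mem_ofPred_eq, p, h,
            Option.some.injEq, exists_eq_left'] at hy
          obtain ⟨hj, _⟩ := List.getElem?_eq_some_iff.1 hy
          simpa [Obj.size] using hj
      · rintro (_ | ⟨j, w⟩) hy (_ | ⟨j', w'⟩) hy' hyy
        · rfl
        · simp at hyy
        · simp at hyy
        · simp only [Finset.coe_filter, Finset.mem_univ, true_and, Set.mem_ofPred_eq, p, h,
            Option.some.injEq, exists_eq_left'] at hy hy'
          have hj : j = j' := Fin.ext (Nat.succ_injective hyy)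
          subst hj
          rw [hy] at hy'
          rw [Option.some.inj hy']
  have hload : ∀ (l : T → Fin n), (∀ ω v, ∑ τ ∈ Finset.univ.filter (fun τ => l τ = v),
      cost (o τ ω) ≤ K * n) → ∀ ω v, Set.ncard {i : T × Option (Fin (K * n) × Word c n) |
        l i.1 = v ∧ p i ω} ≤ K * n := by
    intro l hl ω v
    refine le_trans ?_ (hl ω v)
    rw [Set.ncard_eq_toFinset_card', Set.toFinset_ofPred,
      Finset.card_eq_sum_card_fiberwise (f := Prod.fst)
        (t := Finset.univ.filter fun τ => l τ = v)]
    · refine Finset.sum_le_sum fun τ _ => le_trans ?_ (hone ω τ)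
      refine Finset.card_le_card_of_injOn Prod.snd ?_ ?_
      · rintro ⟨τ', y⟩ hi
        simp only [Finset.coe_filter, Finset.mem_filter, Finset.mem_univ, true_and,
          Set.mem_ofPred_eq] at hi ⊢
        rw [← hi.2]; exact hi.1.2
      · rintro ⟨τ', y⟩ hi ⟨τ'', y'⟩ hi' hy
        simp only [Finset.coe_filter, Finset.mem_filter, Finset.mem_univ, true_and,
          Set.mem_ofPred_eq] at hi hi' hy
        rw [hi.2, hi'.2, hy]
    · intro i hi
      simp only [Finset.coe_filter, Finset.mem_univ, true_and, Set.mem_ofPred_eq] at hi ⊢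
      exact hi.1
  have hcard : Fintype.card (T × Option (Fin (K * n) × Word c n))
      ≤ (n + 1) ^ (a + (K + 2 * c + 2)) := by
    simp only [Fintype.card_prod, Fintype.card_option, Fintype.card_fin]
    rw [pow_add]
    refine Nat.mul_le_mul hT ?_
    have h₁ : K * n * Fintype.card (Word c n) ≤ (n + 1) ^ K * (n + 1) * (n + 1) ^ (2 * c) := by
      gcongr
      · exact le_succ_pow hn K
      · omega
      · exact card_word_le hn c
    have h₂ : 1 ≤ (n + 1) ^ K * (n + 1) * (n + 1) ^ (2 * c) := by
      have := Nat.pos_of_ne_zero (pow_ne_zero K (by omega : n + 1 ≠ 0))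
      have := Nat.pos_of_ne_zero (pow_ne_zero (2 * c) (by omega : n + 1 ≠ 0))
      exact Nat.succ_le_of_lt (by positivity)
    calc _ ≤ (n + 1) ^ K * (n + 1) * (n + 1) ^ (2 * c) * (n + 1) := by nlinarith
      _ = _ := by ring
  refine (within_route hb hn X κ _ K (ι := T × Option (Fin (K * n) × Word c n)) hcard
    (fun i => src i.1) (fun i => dst i.1) p ?_ (hload src hsrc) (hload dst hdst)).mono
    fun κ' _ h τ ω ω' hω => ?_
  · rintro ⟨τ, y⟩ ω ω' hω
    have := ho τ hω
    rcases y with _ | ⟨j, w⟩ <;> simp only [p, this]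
  · have h₀ : (o τ ω ≠ none) = (o τ ω' ≠ none) := h (τ, none) hω
    -- A single object already obeys the bound on the load of its source, so positions below K * n
    -- reach all of its words.
    have hsize : ∀ ω B, o τ ω = some B → B.size < K * n := by
      intro ω B hB
      have h₁ := hsrc ω (src τ)
      have h₂ := Finset.single_le_sum (f := fun τ => cost (o τ ω)) (fun _ _ => Nat.zero_le _)
        (show τ ∈ Finset.univ.filter fun τ' => src τ' = src τ by simp)
      have h₃ : cost (o τ ω) = B.size + 1 := by rw [hB]; rfl
      simp only [h₃] at h₂
      omega
    rcases h₁ : o τ ω with _ | B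
    · rcases h₂ : o τ ω' with _ | B'
      · rfl
      · simp [h₁, h₂] at h₀
    · rcases h₂ : o τ ω' with _ | B'
      · simp [h₁, h₂] at h₀
      · congr 1
        apply Obj.ext
        apply List.ext_getElem?
        intro j
        by_cases hj : j < K * n
        · apply Option.ext
          intro w
          have := h (τ, some (⟨j, hj⟩, w)) hω
          simpa [p, h₁, h₂] using this
        · rw [List.getElem?_eq_none, List.getElem?_eq_none]
          · exact (hsize ω' B' h₂).le.trans (not_lt.1 hj)
          · exact (hsize ω B h₁).le.trans (not_lt.1 hj)

end CongestedClique

/-! ### Weighted nets and their thinning along a tree. -/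

namespace CongestedClique

/-- The elements of `Y` that satisfy `P`. -/
noncomputable def sel {ι : Type} (Y : Finset ι) (P : ι → Prop) : Finset ι :=
  @Finset.filter ι P (fun _ => Classical.propDecidable _) Y

@[simp]
theorem mem_sel {ι : Type} {Y : Finset ι} {P : ι → Prop} {i : ι} : i ∈ sel Y P ↔ i ∈ Y ∧ P i := by
  simp [sel]

theorem sel_subset {ι : Type} (Y : Finset ι) (P : ι → Prop) : sel Y P ⊆ Y :=
  fun _ h => (mem_sel.1 h).1

theorem sum_sel_add_sum_sel_not {ι : Type} (Y : Finset ι) (P : ι → Prop) (w : ι → ℕ) :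
    ∑ i ∈ sel Y P, w i + ∑ i ∈ sel Y fun i => ¬ P i, w i = ∑ i ∈ Y, w i := by
  classical
  rw [← Finset.sum_filter_add_sum_filter_not Y P w]
  congr! 2 <;> (ext; simp)

theorem sum_union_le {ι : Type} [DecidableEq ι] (s t : Finset ι) (w : ι → ℕ) :
    ∑ i ∈ s ∪ t, w i ≤ ∑ i ∈ s, w i + ∑ i ∈ t, w i := by
  rw [← Finset.sum_union_inter]
  exact Nat.le_add_right _ _

theorem sum_biUnion_le {ι κ : Type} [DecidableEq ι] (s : Finset κ) (f : κ → Finset ι)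
    (w : ι → ℕ) : ∑ i ∈ s.biUnion f, w i ≤ ∑ j ∈ s, ∑ i ∈ f j, w i := by
  classical
  induction s using Finset.induction_on with
  | empty => simp
  | insert a s ha ih =>
    rw [Finset.biUnion_insert, Finset.sum_insert ha]
    exact (sum_union_le _ _ w).trans (Nat.add_le_add_left ih _)

section Net

variable {ι Λ : Type} [LinearOrder Λ]

/-- `S` is an `e`-net of the weighted set `Y` for the order given by `key`: every interval that misses
`S` has weight at most `e`. -/
def IsNet (key : ι → Λ) (w : ι → ℕ) (S Y : Finset ι) (e : ℕ) : Prop :=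
  ∀ U : Set Λ, U.OrdConnected → (∀ s ∈ S, key s ∉ U) → ∑ i ∈ sel Y fun i => key i ∈ U, w i ≤ e

/-- Greedy choice: take the smallest t such that the elements up to t weigh more than q, and
continue above t. Each choice uses up weight at least q + 1. An interval that misses t lies either
above t, where induction applies, or below t, where minimality bounds it by q. -/
theorem exists_isNet (key : ι → Λ) (w : ι → ℕ) (q : ℕ) (T : Finset ι) :
    ∃ S ⊆ T, S.card * (q + 1) ≤ ∑ i ∈ T, w i ∧ IsNet key w S T q := by
  classical
  induction T using Finset.strongInduction with
  | H T ih =>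
  by_cases hT : ∑ i ∈ T, w i ≤ q
  · refine ⟨∅, by simp, by simp, fun U _ _ => le_trans ?_ hT⟩
    exact Finset.sum_le_sum_of_subset (sel_subset _ _)
  · obtain ⟨t, ht, hmin⟩ := (sel T fun t => q < ∑ i ∈ sel T fun i => key i ≤ key t, w i).exists_min_image
      key (by
        have hne : T.Nonempty := by
          rw [Finset.nonempty_iff_ne_empty]; rintro rfl; simp at hT
        obtain ⟨t, ht, hmax⟩ := T.exists_max_image key hne
        refine ⟨t, mem_sel.2 ⟨ht, ?_⟩⟩
        rw [show (sel T fun i => key i ≤ key t) = T by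
          ext i; simpa using fun hi => hmax i hi]
        exact not_le.1 hT)
    rw [mem_sel] at ht
    obtain ⟨S, hS, hcard, hnet⟩ := ih (sel T fun i => key t < key i)
      (Finset.ssubset_iff_of_subset (sel_subset _ _) |>.2 ⟨t, ht.1, by simp⟩)
    have hsplit : ∑ i ∈ T, w i = ∑ i ∈ sel T fun i => key i ≤ key t, w i + ∑ i ∈ sel T fun i => key t < key i, w i := by
      rw [← sum_sel_add_sum_sel_not T (fun i => key i ≤ key t)]
      simp only [not_le]
    refine ⟨insert t S, ?_, ?_, ?_⟩
    · exact Finset.insert_subset ht.1 (hS.trans (sel_subset _ _))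
    · have := Finset.card_insert_le t S
      rw [hsplit]
      nlinarith
    · intro U hU hmiss
      have htU : key t ∉ U := hmiss t (Finset.mem_insert_self _ _)
      by_cases hlow : ∃ i ∈ T, key i ∈ U ∧ key i < key t
      · obtain ⟨i, hi, hiU, hit⟩ := hlow
        have hall : ∀ j ∈ T, key j ∈ U → key j < key t := by
          intro j _ hjU
          by_contra hj
          exact htU (hU.out hiU hjU ⟨hit.le, not_lt.1 hj⟩)
        obtain ⟨k, hk, hkmax⟩ := (sel T fun i => key i ∈ U).exists_max_image key
          ⟨i, mem_sel.2 ⟨hi, hiU⟩⟩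
        rw [mem_sel] at hk
        have hkq : ∑ i ∈ sel T fun i => key i ≤ key k, w i ≤ q := by
          by_contra hcon
          have := hmin k (mem_sel.2 ⟨hk.1, not_le.1 hcon⟩)
          exact absurd (hall k hk.1 hk.2) (not_lt.2 this)
        refine le_trans (Finset.sum_le_sum_of_subset ?_) hkq
        intro j hj
        have := hkmax j hj
        rw [mem_sel] at hj ⊢
        exact ⟨hj.1, this⟩
      · push Not at hlow
        refine le_trans (Finset.sum_le_sum_of_subset ?_)
          (hnet U hU fun s hs => hmiss s (Finset.mem_insert_of_mem hs))
        intro j hj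
        rw [mem_sel] at hj
        rw [mem_sel, mem_sel]
        refine ⟨⟨hj.1, lt_of_le_of_ne (hlow j hj.1 hj.2) ?_⟩, hj.2⟩
        intro h
        exact htU (h ▸ hj.2)

/-- An interval that is hit by few elements of a net has small weight. -/
theorem IsNet.sum_le {key : ι → Λ} (hkey : Function.Injective key) {w : ι → ℕ} {S Y : Finset ι}
    {e L : ℕ} (h : IsNet key w S Y e) (hL : ∀ i, w i ≤ L) (U : Set Λ) (hU : U.OrdConnected) :
    ∑ i ∈ sel Y fun i => key i ∈ U, w i
      ≤ ((sel S fun s => key s ∈ U).card + 1) * e + (sel S fun s => key s ∈ U).card * L := by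
  classical
  obtain ⟨k, hk⟩ : ∃ k, (sel S fun s => key s ∈ U).card = k := ⟨_, rfl⟩
  rw [hk]
  induction k generalizing U with
  | zero =>
    rw [Finset.card_eq_zero] at hk
    refine (h U hU fun s hs hsU => ?_).trans (by simp)
    have := (mem_sel (P := fun s => key s ∈ U)).2 ⟨hs, hsU⟩
    simp [hk] at this
  | succ k ih =>
    -- Cutting at the lowest hit s leaves a piece that misses the net, the element s of weight at
    -- most L, and a piece with one hit less.
    obtain ⟨s, hs, hmin⟩ := (sel S fun s => key s ∈ U).exists_min_image key
      (Finset.card_pos.1 (by omega))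
    have hsU := mem_sel.1 hs
    have h₁ := h (U ∩ Set.Iio (key s)) (hU.inter Set.ordConnected_Iio) (by
      rintro s' hs' ⟨h₁, h₂⟩
      exact absurd (hmin s' (mem_sel.2 ⟨hs', h₁⟩)) (not_le.2 h₂))
    have h₂ := ih (U ∩ Set.Ioi (key s)) (hU.inter Set.ordConnected_Ioi) (by
      have : (sel S fun s' => key s' ∈ U ∩ Set.Ioi (key s))
          = (sel S fun s => key s ∈ U).erase s := by
        ext s'
        simp only [mem_sel, Set.mem_inter_iff, Set.mem_Ioi, Finset.mem_erase]
        constructor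
        · rintro ⟨h₁, h₂, h₃⟩
          exact ⟨fun h => h₃.ne (by rw [h]), h₁, h₂⟩
        · rintro ⟨h₁, h₂, h₃⟩
          exact ⟨h₂, h₃, lt_of_le_of_ne (hmin s' (mem_sel.2 ⟨h₂, h₃⟩))
            fun h => h₁ (hkey h.symm)⟩
      rw [this, Finset.card_erase_of_mem hs, hk, Nat.add_sub_cancel])
    have h₃ : ∑ i ∈ sel Y fun i => key i ∈ U, w i ≤ ∑ i ∈ sel Y fun i => key i ∈ U ∩ Set.Iio (key s), w i +
        (w s + ∑ i ∈ sel Y fun i => key i ∈ U ∩ Set.Ioi (key s), w i) := by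
      rw [← Finset.sum_singleton w s]
      refine le_trans ?_ (Nat.add_le_add_left (sum_union_le _ _ w) _)
      refine le_trans ?_ (sum_union_le _ _ w)
      refine Finset.sum_le_sum_of_subset fun i hi => ?_
      rw [mem_sel] at hi
      simp only [Finset.mem_union, mem_sel, Set.mem_inter_iff, Set.mem_Iio, Set.mem_Ioi,
        Finset.mem_singleton]
      rcases lt_trichotomy (key i) (key s) with h | h | h
      · exact Or.inl ⟨hi.1, hi.2, h⟩
      · exact Or.inr (Or.inl (hkey h))
      · exact Or.inr (Or.inr ⟨hi.1, hi.2, h⟩)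
    have h₄ := hL s
    calc _ ≤ _ := h₃
      _ ≤ e + (L + ((k + 1) * e + k * L)) := by gcongr
      _ = _ := by ring

end Net

/-- An optional object, where the absent one is below all others. -/
def asBot {O : Type} (x : Option O) : WithBot O := x

/-- The sort key of an item: its object, with ties broken by the item itself. -/
def sortKey {I O : Type} (o : I → Option O) (i : I) : WithBot O ×ₗ I := toLex (asBot (o i), i)

theorem sortKey_injective {I O : Type} (o : I → Option O) : Function.Injective (sortKey o) :=
  fun _ _ h => congrArg (fun x => (ofLex x).2) h

section Items

variable {I O : Type} [Fintype I] [LinearOrder I] [LinearOrder O]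

open Classical in
/-- The objects of the items in `U`. -/
noncomputable def restrict (o : I → Option O) (U : I → Prop) (i : I) : Option O :=
  if U i then o i else none

theorem exists_pick (w : Option O → ℕ) (q : ℕ) (g : I → Option O) :
    ∃ S ⊆ sel Finset.univ (fun i => g i ≠ none),
      S.card * (q + 1) ≤ ∑ i ∈ sel Finset.univ fun i => g i ≠ none, w (g i) ∧
      IsNet (sortKey g) (fun i => w (g i)) S (sel Finset.univ fun i => g i ≠ none) q :=
  exists_isNet _ _ _ _

/-- A net of the items whose objects are given by `g`. -/
noncomputable def pick (w : Option O → ℕ) (q : ℕ) (g : I → Option O) : Finset I :=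
  (exists_pick w q g).choose

/-- The net is a function of the restricted objects alone, so whoever knows these can compute it.
Inside `U` restriction changes neither objects nor keys, and outside `U` nothing is eligible. -/
theorem pick_spec (w : Option O → ℕ) (q : ℕ) (o : I → Option O) (U : I → Prop) :
    (∀ s ∈ pick w q (restrict o U), U s ∧ o s ≠ none) ∧
    (pick w q (restrict o U)).card * (q + 1) ≤ ∑ i ∈ sel Finset.univ fun i => U i ∧ o i ≠ none, w (o i) ∧
    IsNet (sortKey o) (fun i => w (o i)) (pick w q (restrict o U))
      (sel Finset.univ fun i => U i ∧ o i ≠ none) q := by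
  obtain ⟨h₁, h₂, h₃⟩ := (exists_pick w q (restrict o U)).choose_spec
  have hU : ∀ i, restrict o U i ≠ none ↔ U i ∧ o i ≠ none := by
    intro i
    by_cases h : U i <;> simp [restrict, h]
  have hval : ∀ i, U i → restrict o U i = o i := fun i h => by simp [restrict, h]
  have hsub : ∀ s ∈ pick w q (restrict o U), U s ∧ o s ≠ none := fun s hs =>
    (hU s).1 (mem_sel.1 (h₁ hs)).2
  refine ⟨hsub, ?_, ?_⟩
  · refine h₂.trans (le_of_eq ?_)
    simp only [hU]
    exact Finset.sum_congr rfl fun i hi => by rw [hval i (mem_sel.1 hi).2.1]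
  · intro V hV hmiss
    have hk : ∀ i, U i → sortKey (restrict o U) i = sortKey o i := fun i hi => by
      simp only [sortKey, hval i hi]
    refine le_trans (le_of_eq ?_) (h₃ V hV fun s hs => ?_)
    · simp only [hU]
      have : (sel (sel Finset.univ fun i => U i ∧ o i ≠ none) fun i => sortKey o i ∈ V)
          = (sel (sel Finset.univ fun i => U i ∧ o i ≠ none)
            fun i => sortKey (restrict o U) i ∈ V) := by
        ext i
        simp only [mem_sel]
        refine and_congr_right fun hi => ?_
        rw [hk i hi.2.1]
      rw [this]
      refine Finset.sum_congr rfl fun i hi => ?_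
      rw [hval i (mem_sel.1 (mem_sel.1 hi).1).2.1]
    · rw [hk s (hsub s hs).1]
      exact hmiss s hs

/-- The nets in the tree of arity `m`, whose leaves are the places to which `loc` assigns the items:
`treeNet w m E o loc k r` is a net of the items in the subtree of the node `r` of height `k`. -/
noncomputable def treeNet (w : Option O → ℕ) (m E : ℕ) (o : I → Option O) (loc : I → ℕ) :
    ℕ → ℕ → Finset I
  | 0, z => pick w E (restrict o fun i => loc i = z)
  | k + 1, r => pick (fun _ => 1) (m - 1)
      (restrict o fun i => ∃ j < m, i ∈ treeNet w m E o loc k (r * m + j))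

/-- A leaf net has fewer than m elements because the load is below m * (E + 1); at an inner node at
most m * (m - 1) elements are thinned with threshold m - 1. An interval missing the thinned net thus
hits the children's nets at most m - 1 times. With e the error of a child, each hit costs at most e
+ L ≤ 2 * e beyond the basic m * e, so the error grows by a factor 3 * m. -/
theorem treeNet_spec {w : Option O → ℕ} {m E L : ℕ} {o : I → Option O} {loc : I → ℕ} (hm : 0 < m)
    (hLE : L ≤ E) (hL : ∀ i, w (o i) ≤ L)
    (hload : ∀ z, ∑ i ∈ sel Finset.univ fun i => loc i = z ∧ o i ≠ none, w (o i) < m * (E + 1)) (k r : ℕ) :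
    (∀ s ∈ treeNet w m E o loc k r, loc s / m ^ k = r ∧ o s ≠ none) ∧
    (treeNet w m E o loc k r).card < m ∧
    IsNet (sortKey o) (fun i => w (o i)) (treeNet w m E o loc k r)
      (sel Finset.univ fun i => loc i / m ^ k = r ∧ o i ≠ none) ((3 * m) ^ k * E) := by
  induction k generalizing r with
  | zero =>
    obtain ⟨h₁, h₂, h₃⟩ := pick_spec w E o (fun i => loc i = r)
    simp only [treeNet, pow_zero, Nat.div_one, one_mul]
    refine ⟨h₁, ?_, h₃⟩
    exact lt_of_mul_lt_mul_right (h₂.trans_lt (hload r)) (Nat.zero_le _)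
  | succ k ih =>
    obtain ⟨h₁, h₂, h₃⟩ := pick_spec (fun _ => 1) (m - 1) o
      (fun i => ∃ j < m, i ∈ treeNet w m E o loc k (r * m + j))
    rw [Nat.sub_add_cancel hm] at h₂
    simp only [treeNet]
    have hdiv : ∀ x j, j < m → x / m ^ k = r * m + j → x / m ^ (k + 1) = r := by
      intro x j hj hx
      rw [pow_succ, ← Nat.div_div_eq_div_mul, hx, mul_comm, Nat.mul_add_div hm,
        Nat.div_eq_of_lt hj, add_zero]
    have hT : ∀ i, ((∃ j < m, i ∈ treeNet w m E o loc k (r * m + j)) ∧ o i ≠ none) ↔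
        i ∈ (Finset.range m).biUnion fun j => treeNet w m E o loc k (r * m + j) := by
      intro i
      simp only [Finset.mem_biUnion, Finset.mem_range]
      exact ⟨fun h => h.1, fun h => ⟨h, by obtain ⟨j, _, hj⟩ := h; exact ((ih _).1 i hj).2⟩⟩
    have hTs : (sel Finset.univ fun i =>
        (∃ j < m, i ∈ treeNet w m E o loc k (r * m + j)) ∧ o i ≠ none) =
        (Finset.range m).biUnion fun j => treeNet w m E o loc k (r * m + j) := by
      ext i
      rw [mem_sel, hT]
      simp
    rw [hTs] at h₂ h₃
    refine ⟨fun s hs => ?_, ?_, ?_⟩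
    · obtain ⟨⟨j, hj, hjs⟩, hs'⟩ := h₁ s hs
      exact ⟨hdiv _ j hj ((ih _).1 s hjs).1, hs'⟩
    · have h₄ : ∑ i ∈ (Finset.range m).biUnion fun j => treeNet w m E o loc k (r * m + j), 1
          ≤ m * (m - 1) := by
        rw [← Finset.card_eq_sum_ones]
        refine Finset.card_biUnion_le.trans ?_
        refine (Finset.sum_le_sum fun j _ => Nat.le_sub_one_of_lt (ih (r * m + j)).2.1).trans ?_
        simp
      have h₅ := h₂.trans h₄
      rw [mul_comm] at h₅
      have := Nat.le_of_mul_le_mul_left h₅ hm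
      omega
    · intro U hU hmiss
      have hc := h₃ U hU hmiss
      obtain ⟨κ, hκ⟩ : ∃ κ : ℕ → ℕ, κ = fun j => (sel (treeNet w m E o loc k (r * m + j))
          fun s => sortKey o s ∈ U).card := ⟨_, rfl⟩
      -- Nets of different children lie in different subtrees, hence are disjoint, and the hits add
      -- up to the hits of the union.
      have hκsum : ∑ j ∈ Finset.range m, κ j ≤ m - 1 := by
        refine le_trans (le_of_eq ?_) hc
        rw [← Finset.card_eq_sum_ones, show (sel ((Finset.range m).biUnion fun j =>
          treeNet w m E o loc k (r * m + j)) fun i => sortKey o i ∈ U) = (Finset.range m).biUnion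
          fun j => sel (treeNet w m E o loc k (r * m + j)) fun i => sortKey o i ∈ U by
            ext i; simp only [mem_sel, Finset.mem_biUnion]; tauto, Finset.card_biUnion, hκ]
        intro j _ j' _ hjj
        rw [Function.onFun, Finset.disjoint_left]
        intro s hs hs'
        have e₁ := ((ih _).1 s (mem_sel.1 hs).1).1
        have e₂ := ((ih _).1 s (mem_sel.1 hs').1).1
        exact hjj (Nat.add_left_cancel (e₁.symm.trans e₂))
      have hsub : (sel (sel Finset.univ fun i => loc i / m ^ (k + 1) = r ∧ o i ≠ none)
          fun i => sortKey o i ∈ U) ⊆ (Finset.range m).biUnion fun j =>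
          sel (sel Finset.univ fun i => loc i / m ^ k = r * m + j ∧ o i ≠ none)
            fun i => sortKey o i ∈ U := by
        intro i hi
        simp only [mem_sel, Finset.mem_univ, true_and, Finset.mem_biUnion,
          Finset.mem_range] at hi ⊢
        refine ⟨loc i / m ^ k % m, Nat.mod_lt _ hm, ⟨?_, hi.1.2⟩, hi.2⟩
        rw [← hi.1.1, pow_succ, ← Nat.div_div_eq_div_mul, Nat.div_add_mod']
      obtain ⟨e, he⟩ : ∃ e, e = (3 * m) ^ k * E := ⟨_, rfl⟩
      have hLe : L ≤ e := by
        rw [he]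
        exact hLE.trans (Nat.le_mul_of_pos_left _ (by positivity))
      calc _ ≤ _ := Finset.sum_le_sum_of_subset hsub
        _ ≤ ∑ j ∈ Finset.range m, ∑ i ∈ sel (sel Finset.univ fun i =>
            loc i / m ^ k = r * m + j ∧ o i ≠ none) fun i => sortKey o i ∈ U, w (o i) :=
          sum_biUnion_le _ _ _
        _ ≤ ∑ j ∈ Finset.range m, ((κ j + 1) * e + κ j * L) := by
          refine Finset.sum_le_sum fun j _ => ?_
          rw [hκ, he]
          exact (ih (r * m + j)).2.2.sum_le (sortKey_injective o) hL U hU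
        _ ≤ ∑ j ∈ Finset.range m, (κ j * (2 * e) + e) := by
          refine Finset.sum_le_sum fun j _ => ?_
          nlinarith [Nat.mul_le_mul_left (κ j) hLe]
        _ = (∑ j ∈ Finset.range m, κ j) * (2 * e) + m * e := by
          rw [Finset.sum_add_distrib, Finset.sum_mul]; simp
        _ ≤ m * (2 * e) + m * e := by
          gcongr
          omega
        _ = (3 * m) ^ (k + 1) * E := by rw [he]; ring

end Items

end CongestedClique

/-! ### Splitters, buckets and their placement. -/

namespace CongestedClique

section Child

variable {I O : Type} [LinearOrder I] [LinearOrder O]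

/-- The number of splitters that are not above the item. -/
noncomputable def child (o : I → Option O) (S : Finset I) (i : I) : ℕ :=
  (sel S fun s => sortKey o s ≤ sortKey o i).card

theorem child_le_card (o : I → Option O) (S : Finset I) (i : I) : child o S i ≤ S.card :=
  Finset.card_le_card (sel_subset _ _)

theorem child_mono {o : I → Option O} {S : Finset I} {i j : I} (h : sortKey o i ≤ sortKey o j) :
    child o S i ≤ child o S j := by
  refine Finset.card_le_card fun s hs => ?_
  rw [mem_sel] at hs ⊢
  exact ⟨hs.1, hs.2.trans h⟩

/-- The items with k splitters up to them form an interval that contains at most one splitter,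
namely its lower end. Its weight is at most 2 * e + L. -/
theorem sum_child_le {o : I → Option O} {w : I → ℕ} {S Y : Finset I} {e L : ℕ}
    (h : IsNet (sortKey o) w S Y e) (hL : ∀ i, w i ≤ L) (hLe : L ≤ e) (k : ℕ) :
    ∑ i ∈ sel Y fun i => child o S i = k, w i ≤ 3 * e := by
  let f : WithBot O ×ₗ I → ℕ := fun x => (sel S fun s => sortKey o s ≤ x).card
  have hf : Monotone f := fun x y hxy => Finset.card_le_card fun s hs => by
    rw [mem_sel] at hs ⊢
    exact ⟨hs.1, hs.2.trans hxy⟩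
  have hU : (f ⁻¹' {k}).OrdConnected := Set.ordConnected_singleton.preimage_mono hf
  have h₁ := h.sum_le (sortKey_injective o) hL _ hU
  have h₂ : (sel S fun s => sortKey o s ∈ f ⁻¹' {k}).card ≤ 1 := by
    have key : ∀ s ∈ S, ∀ s' ∈ S, f (sortKey o s) = k → f (sortKey o s') = k →
        ¬ sortKey o s < sortKey o s' := by
      intro s hs s' hs' e₁ e₂ hlt
      have : f (sortKey o s) < f (sortKey o s') := by
        refine Finset.card_lt_card (Finset.ssubset_iff_of_subset ?_ |>.2 ⟨s', ?_, ?_⟩)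
        · intro x hx
          rw [mem_sel] at hx ⊢
          exact ⟨hx.1, hx.2.trans hlt.le⟩
        · exact mem_sel.2 ⟨hs', le_rfl⟩
        · exact fun hx => absurd (mem_sel.1 hx).2 (not_le.2 hlt)
      omega
    rw [Finset.card_le_one]
    intro s hs s' hs'
    rw [mem_sel] at hs hs'
    refine sortKey_injective o (le_antisymm ?_ ?_)
    · exact not_lt.1 (key s' hs'.1 s hs.1 hs'.2 hs.2)
    · exact not_lt.1 (key s hs.1 s' hs'.1 hs.2 hs'.2)
  refine le_trans (le_of_eq ?_) (h₁.trans ?_)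
  · rfl
  · calc _ ≤ (1 + 1) * e + 1 * L := by gcongr
      _ ≤ _ := by omega

end Child

section Bucket

variable {I O : Type} [Fintype I] [LinearOrder I] [LinearOrder O]

/-- The weight of the items of the same bucket that precede `i`. -/
noncomputable def prefixWeight {I : Type} [Fintype I] [LinearOrder I] (w β : I → ℕ) (i : I) : ℕ :=
  ∑ j ∈ sel Finset.univ fun j => j < i ∧ β j = β i, w j

/-- The items of the bucket `p` are assigned to the places `p * S + y`, `y < S`, in consecutive
portions of weight about `Q`. -/
noncomputable def place {I : Type} [Fintype I] [LinearOrder I] (w β : I → ℕ) (S Q : ℕ) (i : I) : ℕ :=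
  β i * S + prefixWeight w β i / Q

/-- An item of positive weight begins strictly before the end of its bucket. An absent item has
weight 0 and may fall beyond the last portion, hence the hypothesis `hi`. -/
theorem prefixWeight_div_lt {I : Type} [Fintype I] [LinearOrder I] {w β : I → ℕ} {S Q : ℕ}
    (hβ : ∀ p, ∑ i ∈ sel Finset.univ fun i => β i = p, w i ≤ Q * S) {i : I} (hi : 1 ≤ w i) :
    prefixWeight w β i / Q < S := by
  refine Nat.div_lt_of_lt_mul ?_
  refine lt_of_lt_of_le ?_ (hβ (β i))
  have h : insert i (sel Finset.univ fun j => j < i ∧ β j = β i)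
      ⊆ sel Finset.univ fun j => β j = β i := by
    intro j
    simp only [Finset.mem_insert, mem_sel, Finset.mem_univ, true_and]
    rintro (h | h)
    · rw [h]
    · exact h.2
  have h' := Finset.sum_le_sum_of_subset (f := w) h
  rw [Finset.sum_insert (by simp)] at h'
  have h'' : prefixWeight w β i = ∑ j ∈ sel Finset.univ fun j => j < i ∧ β j = β i, w j := rfl
  omega

theorem place_div {I : Type} [Fintype I] [LinearOrder I] {w β : I → ℕ} {S Q : ℕ}
    (hβ : ∀ p, ∑ i ∈ sel Finset.univ fun i => β i = p, w i ≤ Q * S) {i : I} (hi : 1 ≤ w i) :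
    place w β S Q i / S = β i := by
  have h := prefixWeight_div_lt hβ hi
  rw [place, mul_comm, Nat.mul_add_div (Nat.zero_lt_of_lt h), Nat.div_eq_of_lt h, add_zero]

theorem place_mod {I : Type} [Fintype I] [LinearOrder I] {w β : I → ℕ} {S Q : ℕ}
    (hβ : ∀ p, ∑ i ∈ sel Finset.univ fun i => β i = p, w i ≤ Q * S) {i : I} (hi : 1 ≤ w i) :
    place w β S Q i % S = prefixWeight w β i / Q := by
  have h := prefixWeight_div_lt hβ hi
  rw [place, Nat.mul_add_mod', Nat.mod_eq_of_lt h]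

/-- The prefix weights of the first and the last item at a place have the same quotient by Q, so
they differ by less than Q; the last item adds at most L. -/
theorem sum_place_le {I : Type} [Fintype I] [LinearOrder I] {w β : I → ℕ} {S Q L : ℕ} (hQ : 0 < Q)
    (hβ : ∀ p, ∑ i ∈ sel Finset.univ fun i => β i = p, w i ≤ Q * S) (hL : ∀ i, w i ≤ L)
    {P : I → Prop} (hP : ∀ i, P i → 1 ≤ w i) (z : ℕ) :
    ∑ i ∈ sel Finset.univ fun i => place w β S Q i = z ∧ P i, w i ≤ Q + L := by
  obtain ⟨F, hF⟩ : ∃ F, F = sel Finset.univ fun i => place w β S Q i = z ∧ P i := ⟨_, rfl⟩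
  rw [← hF]
  rcases F.eq_empty_or_nonempty with rfl | hne
  · simp
  have hmem : ∀ i ∈ F, β i = z / S ∧ prefixWeight w β i / Q = z % S := by
    intro i hi
    rw [hF, mem_sel] at hi
    have := hP i hi.2.2
    rw [← hi.2.1, place_div hβ this, place_mod hβ this]
    exact ⟨rfl, rfl⟩
  obtain ⟨a, ha⟩ : ∃ a, a = F.min' hne := ⟨_, rfl⟩
  obtain ⟨d, hd⟩ : ∃ d, d = F.max' hne := ⟨_, rfl⟩
  have haF : a ∈ F := ha ▸ F.min'_mem hne
  have hdF : d ∈ F := hd ▸ F.max'_mem hne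
  have h₁ : ∑ i ∈ F.erase d, w i + prefixWeight w β a ≤ prefixWeight w β d := by
    rw [prefixWeight, prefixWeight, ← Finset.sum_union]
    · refine Finset.sum_le_sum_of_subset fun i hi => ?_
      rw [Finset.mem_union, Finset.mem_erase, mem_sel] at hi
      simp only [mem_sel, Finset.mem_univ, true_and]
      rcases hi with ⟨hne', hi⟩ | ⟨_, hia, hi⟩
      · exact ⟨lt_of_le_of_ne (hd ▸ F.le_max' i hi) hne',
          by rw [(hmem i hi).1, (hmem d hdF).1]⟩
      · refine ⟨lt_of_lt_of_le hia (hd ▸ F.le_max' a haF), ?_⟩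
        rw [hi, (hmem a haF).1, (hmem d hdF).1]
    · rw [Finset.disjoint_left]
      intro i hi hi'
      have h₂ : a ≤ i := ha ▸ F.min'_le i (Finset.mem_of_mem_erase hi)
      exact absurd (mem_sel.1 hi').2.1 (not_lt.2 h₂)
  have h₂ : prefixWeight w β d < prefixWeight w β a + Q := by
    have e₁ := Nat.div_add_mod (prefixWeight w β d) Q
    have e₂ := Nat.div_add_mod (prefixWeight w β a) Q
    rw [(hmem d hdF).2] at e₁
    rw [(hmem a haF).2] at e₂
    have := Nat.mod_lt (prefixWeight w β d) hQ
    omega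
  have h₃ := Finset.sum_erase_add F w hdF
  have h₄ := hL d
  omega

/-- The refinement of the buckets `β` by the splitters at the roots of the trees of height `t`. -/
noncomputable def refineBucket (w : Option O → ℕ) (m t E Q : ℕ) (o : I → Option O) (β : I → ℕ)
    (i : I) : ℕ :=
  β i * m + child o (treeNet w m E o (place (fun i => w (o i)) β (m ^ t) Q) t (β i)) i

variable {w : Option O → ℕ} {m t E Q L : ℕ} {o : I → Option O} {β : I → ℕ}

theorem treeNet_place_spec (hm : 0 < m) (hw : ∀ x, x ≠ none → 1 ≤ w x) (hL : ∀ i, w (o i) ≤ L)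
    (hLE : L ≤ E) (hQ : 0 < Q) (hE : Q + L < m * (E + 1))
    (hβ : ∀ p, ∑ i ∈ sel Finset.univ fun i => β i = p, w (o i) ≤ Q * m ^ t) (k r : ℕ) :
    (∀ s ∈ treeNet w m E o (place (fun i => w (o i)) β (m ^ t) Q) k r,
      place (fun i => w (o i)) β (m ^ t) Q s / m ^ k = r ∧ o s ≠ none) ∧
    (treeNet w m E o (place (fun i => w (o i)) β (m ^ t) Q) k r).card < m ∧
    IsNet (sortKey o) (fun i => w (o i))
      (treeNet w m E o (place (fun i => w (o i)) β (m ^ t) Q) k r)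
      (sel Finset.univ fun i => place (fun i => w (o i)) β (m ^ t) Q i / m ^ k = r ∧ o i ≠ none)
      ((3 * m) ^ k * E) :=
  treeNet_spec hm hLE hL (fun z => lt_of_le_of_lt (sum_place_le hQ hβ hL
    (fun _ h => hw _ h) z) hE) k r

theorem sum_refineBucket_le (hm : 0 < m) (hw₀ : w none = 0) (hw : ∀ x, x ≠ none → 1 ≤ w x)
    (hL : ∀ i, w (o i) ≤ L) (hLE : L ≤ E) (hQ : 0 < Q) (hE : Q + L < m * (E + 1))
    (hβ : ∀ p, ∑ i ∈ sel Finset.univ fun i => β i = p, w (o i) ≤ Q * m ^ t) (p : ℕ) :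
    ∑ i ∈ sel Finset.univ fun i => refineBucket w m t E Q o β i = p, w (o i)
      ≤ 3 * ((3 * m) ^ t * E) := by
  obtain ⟨h₁, h₂, h₃⟩ := treeNet_place_spec (t := t) hm hw hL hLE hQ hE hβ t (p / m)
  have hLe : L ≤ (3 * m) ^ t * E := hLE.trans (Nat.le_mul_of_pos_left _ (by positivity))
  refine le_trans ?_ (sum_child_le h₃ hL hLe (p % m))
  -- Absent items weigh 0 and are dropped, as only present items are sure to lie in the tree of
  -- their bucket.
  rw [← Finset.sum_filter_ne_zero]
  refine Finset.sum_le_sum_of_subset fun i hi => ?_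
  rw [Finset.mem_filter, mem_sel] at hi
  obtain ⟨⟨_, hi⟩, hi₀⟩ := hi
  have hne : o i ≠ none := fun h => hi₀ (by rw [h, hw₀])
  have hc := (child_le_card o _ i).trans_lt (treeNet_place_spec (t := t) hm hw hL hLE hQ hE hβ t
    (β i)).2.1
  have e₁ : p / m = β i := by
    rw [← hi, refineBucket, mul_comm, Nat.mul_add_div hm, Nat.div_eq_of_lt hc, add_zero]
  have e₂ : p % m = child o (treeNet w m E o (place (fun i => w (o i)) β (m ^ t) Q) t (β i)) i := by
    rw [← hi, refineBucket, Nat.mul_add_mod', Nat.mod_eq_of_lt hc]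
  simp only [mem_sel, Finset.mem_univ, true_and]
  refine ⟨⟨?_, hne⟩, ?_⟩
  · rw [e₁]
    exact place_div hβ (hw _ hne)
  · rw [e₁, e₂]

theorem refineBucket_lt (hm : 0 < m) (hw : ∀ x, x ≠ none → 1 ≤ w x) (hL : ∀ i, w (o i) ≤ L)
    (hLE : L ≤ E) (hQ : 0 < Q) (hE : Q + L < m * (E + 1))
    (hβ : ∀ p, ∑ i ∈ sel Finset.univ fun i => β i = p, w (o i) ≤ Q * m ^ t) {M : ℕ} {i : I}
    (hi : β i < M) : refineBucket w m t E Q o β i < M * m := by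
  have hc := (child_le_card o _ i).trans_lt (treeNet_place_spec (t := t) hm hw hL hLE hQ hE hβ t
    (β i)).2.1
  rw [refineBucket]
  nlinarith

theorem sortKey_lt_of_refineBucket_lt (hm : 0 < m) (hw : ∀ x, x ≠ none → 1 ≤ w x)
    (hL : ∀ i, w (o i) ≤ L) (hLE : L ≤ E) (hQ : 0 < Q) (hE : Q + L < m * (E + 1))
    (hβ : ∀ p, ∑ i ∈ sel Finset.univ fun i => β i = p, w (o i) ≤ Q * m ^ t) {i j : I}
    (h : β i < β j → sortKey o i < sortKey o j)
    (hij : refineBucket w m t E Q o β i < refineBucket w m t E Q o β j) :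
    sortKey o i < sortKey o j := by
  have hj := (child_le_card o _ j).trans_lt (treeNet_place_spec (t := t) hm hw hL hLE hQ hE hβ t
    (β j)).2.1
  unfold refineBucket at hij
  rcases lt_trichotomy (β i) (β j) with hlt | heq | hgt
  · exact h hlt
  · rw [heq] at hij
    by_contra hcon
    have := child_mono (S := treeNet w m E o (place (fun i => w (o i)) β (m ^ t) Q) t (β j))
      (not_lt.1 hcon)
    omega
  · exfalso
    nlinarith

end Bucket

/-! ### First occurrences and ranks in sorted buckets. -/

/-- The item `i` is the first of those that carry its object. -/
def IsFirst {I O : Type} [LinearOrder I] (o : I → Option O) (i : I) : Prop :=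
  o i ≠ none ∧ ∀ j, o j = o i → i ≤ j

theorem exists_isFirst {I O : Type} [Fintype I] [LinearOrder I] {o : I → Option O} {A : O} (h : ∃ i, o i = some A) :
    ∃ i, o i = some A ∧ IsFirst o i := by
  obtain ⟨i, hi⟩ := h
  have hne : (sel Finset.univ fun j => o j = some A).Nonempty := ⟨i, by simpa using hi⟩
  refine ⟨_, (mem_sel.1 ((sel Finset.univ fun j => o j = some A).min'_mem hne)).2, ?_, ?_⟩
  · rw [(mem_sel.1 ((sel Finset.univ fun j => o j = some A).min'_mem hne)).2]; simp
  · intro j hj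
    rw [(mem_sel.1 ((sel Finset.univ fun j => o j = some A).min'_mem hne)).2] at hj
    exact Finset.min'_le _ _ (by simpa using hj)

section Link

variable {I O : Type} [LinearOrder I] [LinearOrder O]

theorem sortKey_le_iff {o : I → Option O} {i j : I} :
    sortKey o i ≤ sortKey o j ↔ asBot (o i) < asBot (o j) ∨ o i = o j ∧ i ≤ j :=
  Prod.Lex.toLex_le_toLex

theorem sortKey_lt_iff {o : I → Option O} {i j : I} :
    sortKey o i < sortKey o j ↔ asBot (o i) < asBot (o j) ∨ o i = o j ∧ i < j :=
  Prod.Lex.toLex_lt_toLex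

variable {o : I → Option O} {β : I → ℕ}

/-- The item `j` is the last one of its bucket, and `p` is the next nonempty bucket. -/
def IsLink (o : I → Option O) (β : I → ℕ) (j : I) (p : ℕ) : Prop :=
  o j ≠ none ∧ (∀ k, o k ≠ none → β k = β j → sortKey o k ≤ sortKey o j) ∧
    β j < p ∧ (∃ k, o k ≠ none ∧ β k = p) ∧ ∀ k, o k ≠ none → β k ≤ β j ∨ p ≤ β k

/-- Together with `IsLink.right_unique`, this bounds the traffic of links: a bucket receives at most
one object and sends at most one. -/
theorem IsLink.left_unique {j j' : I} {p : ℕ} (h : IsLink o β j p) (h' : IsLink o β j' p) :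
    j = j' := by
  obtain ⟨h₁, h₂, h₃, h₄, h₅⟩ := h
  obtain ⟨h₁', h₂', h₃', h₄', h₅'⟩ := h'
  have e : β j = β j' := by
    have := h₅ j' h₁'
    have := h₅' j h₁
    omega
  exact sortKey_injective o (le_antisymm (h₂' j h₁ e) (h₂ j' h₁' e.symm))

theorem IsLink.right_unique {j j' : I} {p p' : ℕ} (h : IsLink o β j p) (h' : IsLink o β j' p')
    (e : β j = β j') : j = j' ∧ p = p' := by
  obtain ⟨h₁, h₂, h₃, ⟨k, hk₁, hk₂⟩, h₅⟩ := h
  obtain ⟨h₁', h₂', h₃', ⟨k', hk₁', hk₂'⟩, h₅'⟩ := h'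
  refine ⟨sortKey_injective o (le_antisymm (h₂' j h₁ e) (h₂ j' h₁' e.symm)), ?_⟩
  have := h₅ k' hk₁'
  have := h₅' k hk₁
  omega

end Link

section Rank

variable {I O : Type} [Fintype I] [LinearOrder I] [LinearOrder O]

/-- Every distinct object has exactly one first item. Among those with key up to that of i are the
first items of the smaller objects and, since ties favour it, the first item of B itself, which
accounts for the 1. -/
theorem ncard_lt_add_one {o : I → Option O} {i : I} {B : O} (hi : o i = some B) :
    Set.ncard {A : O | (∃ j, o j = some A) ∧ A < B} + 1
      = (sel Finset.univ fun j => IsFirst o j ∧ sortKey o j ≤ sortKey o i).card := by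
  obtain ⟨f, hf, hfirst⟩ := exists_isFirst ⟨i, hi⟩
  have hmem : f ∈ sel Finset.univ fun j => IsFirst o j ∧ sortKey o j ≤ sortKey o i := by
    simp only [mem_sel, Finset.mem_univ, true_and]
    exact ⟨hfirst, sortKey_le_iff.2 (Or.inr ⟨hf.trans hi.symm, hfirst.2 i (hi.trans hf.symm)⟩)⟩
  rw [← Finset.card_erase_add_one hmem]
  congr 1
  have himg : (fun j => o j) '' ((sel Finset.univ fun j => IsFirst o j ∧
      sortKey o j ≤ sortKey o i).erase f : Finset I) =
      some '' {A : O | (∃ j, o j = some A) ∧ A < B} := by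
    ext x
    simp only [Set.mem_image, Finset.mem_coe, Finset.mem_erase, mem_sel, Finset.mem_univ, true_and,
      Set.mem_ofPred_eq]
    constructor
    · rintro ⟨j, ⟨hjf, hj, hle⟩, rfl⟩
      rcases hx : o j with _ | A
      · exact absurd hx hj.1
      · refine ⟨A, ⟨⟨j, hx⟩, ?_⟩, rfl⟩
        rcases sortKey_le_iff.1 hle with h | h
        · rw [hx, hi] at h
          exact WithBot.coe_lt_coe.1 h
        · exfalso
          have e : o j = o f := h.1.trans (hi.trans hf.symm)
          exact hjf (le_antisymm (hj.2 f e.symm) (hfirst.2 j e))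
    · rintro ⟨A, ⟨hA, hlt⟩, rfl⟩
      obtain ⟨j, hj, hjf⟩ := exists_isFirst hA
      refine ⟨j, ⟨?_, hjf, sortKey_le_iff.2 (Or.inl ?_)⟩, hj⟩
      · rintro rfl
        rw [hj] at hf
        exact hlt.ne (Option.some.inj hf)
      · rw [hj, hi]
        exact WithBot.coe_lt_coe.2 hlt
  have h₁ := Set.ncard_image_of_injective {A : O | (∃ j, o j = some A) ∧ A < B}
    (Option.some_injective O)
  rw [← h₁, ← himg, Set.InjOn.ncard_image, Set.ncard_coe_finset]
  intro j hj j' hj' h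
  simp only [Finset.mem_coe, Finset.mem_erase, mem_sel, Finset.mem_univ, true_and] at hj hj'
  exact le_antisymm (hj.2.1.2 j' h.symm) (hj'.2.1.2 j h)

variable {o : I → Option O} {β : I → ℕ}

/-- Counting first items bucket by bucket. -/
theorem card_isFirst_le (hs : ∀ i j, o i ≠ none → o j ≠ none → β i < β j →
    sortKey o i < sortKey o j) {i : I} (hi : o i ≠ none) :
    (sel Finset.univ fun j => IsFirst o j ∧ sortKey o j ≤ sortKey o i).card
      = ∑ p ∈ Finset.range (β i), (sel Finset.univ fun j => IsFirst o j ∧ β j = p).card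
        + (sel Finset.univ fun j => IsFirst o j ∧ β j = β i ∧ sortKey o j ≤ sortKey o i).card := by
  classical
  rw [← Finset.card_biUnion, ← Finset.card_union_of_disjoint]
  · congr 1
    ext j
    simp only [mem_sel, Finset.mem_univ, true_and, Finset.mem_union, Finset.mem_biUnion,
      Finset.mem_range]
    constructor
    · rintro ⟨h₁, h₂⟩
      rcases lt_trichotomy (β j) (β i) with h | h | h
      · exact Or.inl ⟨_, h, h₁, rfl⟩
      · exact Or.inr ⟨h₁, h, h₂⟩
      · exact absurd h₂ (not_le.2 (hs i j hi h₁.1 h))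
    · rintro (⟨p, hp, h₁, rfl⟩ | ⟨h₁, h₂, h₃⟩)
      · exact ⟨h₁, (hs j i h₁.1 hi hp).le⟩
      · exact ⟨h₁, h₃⟩
  · rw [Finset.disjoint_left]
    intro j hj hj'
    simp only [mem_sel, Finset.mem_univ, true_and, Finset.mem_biUnion, Finset.mem_range] at hj hj'
    obtain ⟨p, hp, _, rfl⟩ := hj
    exact hp.ne hj'.2.1
  · intro p _ p' _ hne
    rw [Function.onFun, Finset.disjoint_left]
    intro j hj hj'
    exact hne ((mem_sel.1 hj).2.2.symm.trans (mem_sel.1 hj').2.2)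

/-- The largest item x in the buckets below that of i lies, in the order of keys, between the copy j
and i. Both carry the same object, hence so does x, which is the link. -/
theorem exists_isLink (hs : ∀ i j, o i ≠ none → o j ≠ none → β i < β j →
    sortKey o i < sortKey o j) {i : I} (hi : o i ≠ none) :
    (∃ j, o j = o i ∧ β j < β i) ↔ ∃ j, IsLink o β j (β i) ∧ o j = o i := by
  constructor
  · rintro ⟨j, hj, hlt⟩
    obtain ⟨x, hx, hmax⟩ := (sel Finset.univ fun k => o k ≠ none ∧ β k < β i).exists_max_image
      (sortKey o) ⟨j, by simp [hj, hi, hlt]⟩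
    simp only [mem_sel, Finset.mem_univ, true_and] at hx hmax
    refine ⟨x, ⟨hx.1, fun k hk e => hmax k ⟨hk, by omega⟩, hx.2, ⟨i, hi, rfl⟩, fun k hk => ?_⟩, ?_⟩
    · by_contra hcon
      push Not at hcon
      exact absurd (hmax k ⟨hk, hcon.2⟩) (not_le.2 (hs x k hx.1 hk hcon.1))
    · have h₁ := hmax j ⟨by rw [hj]; exact hi, hlt⟩
      have h₂ := hs x i hx.1 hi hx.2
      have h₃ := sortKey_le_iff.1 h₁
      have h₄ := sortKey_lt_iff.1 h₂
      rw [hj] at h₃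
      rcases h₄ with h₄ | h₄
      · rcases h₃ with h₃ | h₃
        · exact absurd h₃ (not_lt.2 h₄.le)
        · exact h₃.1.symm
      · exact h₄.1
  · rintro ⟨j, hj, e⟩
    exact ⟨j, e, hj.2.2.1⟩

theorem isFirst_iff (hs : ∀ i j, o i ≠ none → o j ≠ none → β i < β j →
    sortKey o i < sortKey o j) {i : I} (hi : o i ≠ none) :
    IsFirst o i ↔ (∀ j, β j = β i → o j = o i → i ≤ j) ∧ ∀ j, IsLink o β j (β i) → o j ≠ o i := by
  have key : (∀ j, IsLink o β j (β i) → o j ≠ o i) ↔ ∀ j, o j = o i → ¬ β j < β i := by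
    have := not_congr (exists_isLink hs hi)
    push Not at this
    rw [← this]
    simp only [not_lt]
  rw [key]
  constructor
  · rintro ⟨_, h⟩
    refine ⟨fun j _ e => h j e, fun j e hlt => ?_⟩
    have h₁ := hs j i (by rwa [e]) hi hlt
    rcases sortKey_lt_iff.1 h₁ with h₂ | h₂
    · rw [e] at h₂; exact lt_irrefl _ h₂
    · exact absurd (h j e) (not_le.2 h₂.2)
  · rintro ⟨h₁, h₂⟩
    refine ⟨hi, fun j e => ?_⟩
    rcases lt_trichotomy (β j) (β i) with h | h | h
    · exact absurd h (h₂ j e)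
    · exact h₁ j h e
    · have h₃ := hs i j hi (by rwa [e]) h
      rcases sortKey_lt_iff.1 h₃ with h₄ | h₄
      · rw [e] at h₄; exact absurd h₄ (lt_irrefl _)
      · exact h₄.2.le

end Rank

end CongestedClique

/-! ### Items on a network: routing of numbers, bucket positions, delivery. -/

namespace CongestedClique

/-- The node that hosts the place `z`. -/
def host {n : ℕ} (hn : 0 < n) (z : ℕ) : Fin n := ⟨z % n, Nat.mod_lt z hn⟩

/-- A network of items, distributed over `N` places hosted by the `n` nodes, where `F * n` bounds the
load that is allowed for each node. -/
structure Sortable {n c : ℕ} {I Ω : Type} [Fintype I] [LinearOrder I] (hn : 0 < n)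
    (own : I → Fin n) (o : Ω → I → Option (Obj c n)) (a F G N m L : ℕ) : Prop where
  card_le : Fintype.card I ≤ (n + 1) ^ a
  own_mono : Monotone own
  arity_pos : 0 < m
  arity_le : m ≤ F * n
  cost_le : ∀ ω i, cost (o ω i) ≤ L
  owner_load : ∀ ω v, ∑ i ∈ sel Finset.univ fun i => own i = v, cost (o ω i) ≤ F * n
  places_le : N ≤ F * n
  places_card : N ≤ (n + 1) ^ a
  fiber_le : ∀ v, (sel Finset.univ fun z : Fin N => host hn z = v).card ≤ G
  fiber_bound : G ≤ F
  tree_load : G * m * (m * L) ≤ F * n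

section Numbers

variable {n b : ℕ} {In Ω : Type}

/-- The number of packets for the transmission of an optional number. -/
def numCost (x : Option ℕ) : ℕ := x.elim 0 fun _ => 1

theorem within_route_numbers (hb : 1 ≤ b) (hn : 0 < n) (X : Ω → Fin n → In)
    (κ : Fin n → Ω → Ω → Prop) (a d K : ℕ) {T : Type} [Fintype T]
    (hT : Fintype.card T ≤ (n + 1) ^ a)
    (src dst : T → Fin n) (val : T → Ω → Option ℕ) (hval : ∀ τ, Knows κ (src τ) (val τ))
    (hlt : ∀ τ ω, ∀ x ∈ val τ ω, x < (n + 1) ^ d)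
    (hsrc : ∀ ω v, ∑ τ ∈ sel Finset.univ (fun τ => src τ = v), numCost (val τ ω) ≤ K * n)
    (hdst : ∀ ω v, ∑ τ ∈ sel Finset.univ (fun τ => dst τ = v), numCost (val τ ω) ≤ K * n) :
    Within b X (routeRounds (a + d) K) κ (fun κ' => ∀ τ, Knows κ' (dst τ) (val τ)) := by
  classical
  have hpos : (n + 1) ^ d ≠ 0 := pow_ne_zero _ (by omega)
  have : NeZero ((n + 1) ^ d) := ⟨hpos⟩
  have hload : ∀ (l : T → Fin n), (∀ ω v, ∑ τ ∈ sel Finset.univ (fun τ => l τ = v),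
      numCost (val τ ω) ≤ K * n) → ∀ ω v, Set.ncard {τ | l τ = v ∧
        (val τ ω).map (Fin.ofNat ((n + 1) ^ d)) ≠ none} ≤ K * n := by
    intro l hl ω v
    refine le_trans ?_ (hl ω v)
    have h₁ : {τ | l τ = v ∧ (val τ ω).map (Fin.ofNat ((n + 1) ^ d)) ≠ none}
        = (sel Finset.univ fun τ => l τ = v ∧ val τ ω ≠ none : Finset T) := by
      ext τ; simp
    rw [h₁, Set.ncard_coe_finset, Finset.card_eq_sum_ones]
    refine le_trans (Finset.sum_le_sum (g := fun τ => numCost (val τ ω)) fun τ hτ => ?_)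
      (Finset.sum_le_sum_of_subset fun τ hτ => ?_)
    · obtain ⟨_, _, h⟩ := mem_sel.1 hτ
      rcases hv : val τ ω with _ | x
      · exact absurd hv h
      · exact le_rfl
    · rw [mem_sel] at hτ ⊢
      exact ⟨hτ.1, hτ.2.1⟩
  refine (within_route_values hb hn X κ (a + d) K (T := T) (β := Fin ((n + 1) ^ d)) ?_ src dst
    (fun τ ω => (val τ ω).map (Fin.ofNat ((n + 1) ^ d)))
    (fun τ => (hval τ).congr fun ω ω' h => by rw [h]) (hload src hsrc) (hload dst hdst)).mono
    fun κ' _ h τ => (h τ).congr fun ω ω' hω => ?_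
  · rw [Fintype.card_fin, pow_add]
    exact Nat.mul_le_mul_right _ hT
  · rcases h₁ : val τ ω with _ | x <;> rcases h₂ : val τ ω' with _ | y <;>
      simp only [h₁, h₂, Option.map_none, Option.map_some, reduceCtorEq, Option.some.injEq] at hω ⊢
    have := congrArg Fin.val hω
    simpa [Nat.mod_eq_of_lt (hlt τ ω x h₁), Nat.mod_eq_of_lt (hlt τ ω' y h₂)] using this

theorem sum_pairs_le {A : Type} [Fintype A] {N G Y : ℕ} (x : A × Fin N → ℕ) (P : Fin N → Prop)
    (hP : (sel Finset.univ P).card ≤ G) (hx : ∀ z, ∑ i, x (i, z) ≤ Y) :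
    ∑ τ ∈ sel Finset.univ fun τ : A × Fin N => P τ.2, x τ ≤ G * Y := by
  have h : (sel Finset.univ fun τ : A × Fin N => P τ.2) = Finset.univ ×ˢ sel Finset.univ P := by
    ext τ; simp
  rw [h, Finset.sum_product_right]
  calc _ ≤ ∑ z ∈ sel Finset.univ P, Y := Finset.sum_le_sum fun z _ => hx z
    _ = (sel Finset.univ P).card * Y := by simp
    _ ≤ _ := Nat.mul_le_mul_right _ hP

theorem sum_pairs_left_le {A : Type} [Fintype A] {N Y : ℕ} (x : A × Fin N → ℕ) (P : A → Prop)
    (w : A → ℕ) (hw : ∑ i ∈ sel Finset.univ P, w i ≤ Y) (hx : ∀ i, ∑ z, x (i, z) ≤ w i) :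
    ∑ τ ∈ sel Finset.univ fun τ : A × Fin N => P τ.1, x τ ≤ Y := by
  have h : (sel Finset.univ fun τ : A × Fin N => P τ.1) = sel Finset.univ P ×ˢ Finset.univ := by
    ext τ; simp
  rw [h, Finset.sum_product]
  exact (Finset.sum_le_sum fun i _ => hx i).trans hw

theorem filter_eq_sel {ι : Type} (Y : Finset ι) (P : ι → Prop) [DecidablePred P] :
    Y.filter P = sel Y P := by
  ext; simp

end Numbers

section Restrict

variable {I O : Type}

theorem restrict_of_imp {o : I → Option O} {U V : I → Prop} (h : ∀ i, U i → V i) :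
    restrict (restrict o V) U = restrict o U := by
  funext i
  by_cases hU : U i
  · simp [restrict, hU, h i hU]
  · simp [restrict, hU]

theorem restrict_eq_some {o : I → Option O} {U : I → Prop} {i : I} {A : O} :
    restrict o U i = some A ↔ U i ∧ o i = some A := by
  by_cases hU : U i <;> simp [restrict, hU]

theorem restrict_ne_none {o : I → Option O} {U : I → Prop} {i : I} :
    restrict o U i ≠ none ↔ U i ∧ o i ≠ none := by
  by_cases hU : U i <;> simp [restrict, hU]

theorem restrict_of_pos {o : I → Option O} {U : I → Prop} {i : I} (h : U i) :
    restrict o U i = o i := by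
  simp [restrict, h]

theorem restrict_of_neg {o : I → Option O} {U : I → Prop} {i : I} (h : ¬ U i) :
    restrict o U i = none := by
  simp [restrict, h]

theorem sum_cost_restrict {n c : ℕ} [Fintype I] (o : I → Option (Obj c n)) (U : I → Prop) :
    ∑ i, cost (restrict o U i) = ∑ i ∈ sel Finset.univ fun i => U i ∧ o i ≠ none, cost (o i) := by
  classical
  rw [← Finset.sum_subset (Finset.subset_univ (sel Finset.univ fun i => U i ∧ o i ≠ none))]
  · refine Finset.sum_congr rfl fun i hi => ?_
    rw [restrict_of_pos (mem_sel.1 hi).2.1]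
  · intro i _ hi
    have : restrict o U i = none := by
      by_contra h
      exact hi (mem_sel.2 ⟨Finset.mem_univ _, restrict_ne_none.1 h⟩)
    rw [this]; rfl

theorem sum_cost_restrict_mem_le {n c L : ℕ} [Fintype I] (o : I → Option (Obj c n)) (S : Finset I)
    (hL : ∀ i, cost (o i) ≤ L) : ∑ i, cost (restrict o (· ∈ S) i) ≤ S.card * L := by
  rw [sum_cost_restrict]
  calc _ ≤ ∑ i ∈ S, cost (o i) :=
        Finset.sum_le_sum_of_subset fun i hi => (mem_sel.1 hi).2.1
    _ ≤ ∑ i ∈ S, L := Finset.sum_le_sum fun i _ => hL i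
    _ = _ := by simp

/-- A value at the only place where it is not absent. -/
theorem sum_cost_restrict_place_le {n c N : ℕ} (o : I → Option (Obj c n)) (loc : I → ℕ) (i : I) :
    ∑ z : Fin N, cost (restrict o (fun i => loc i = z) i) ≤ cost (o i) := by
  classical
  by_cases h : loc i < N
  · rw [Finset.sum_eq_single (⟨loc i, h⟩ : Fin N)]
    · exact (congrArg cost (restrict_of_pos (U := fun j => loc j = loc i) rfl)).le
    · intro z _ hz
      rw [restrict_of_neg fun e => hz (Fin.ext e.symm)]; rfl
    · simp
  · rw [Finset.sum_eq_zero]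
    · exact Nat.zero_le _
    · intro z _
      rw [restrict_of_neg fun e => h (by rw [e]; exact z.2)]; rfl

end Restrict

section Level

variable {n b c : ℕ} {In Ω I : Type} [Fintype I] [LinearOrder I]
  {hn : 0 < n} {own : I → Fin n} {o : Ω → I → Option (Obj c n)} {a F G N m L : ℕ}

theorem Sortable.fiber_div_le (h : Sortable hn own o a F G N m L) (v : Fin n) :
    (sel Finset.univ fun z : Fin N => host hn (z / m) = v).card ≤ G * m := by
  have hN : ∀ z : Fin N, (z : ℕ) / m < N := fun z => (Nat.div_le_self _ _).trans_lt z.2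
  have h₁ := Finset.card_le_mul_card_image_of_maps_to
    (s := sel Finset.univ fun z : Fin N => host hn (z / m) = v)
    (t := sel Finset.univ fun z : Fin N => host hn z = v)
    (f := fun z => ⟨z / m, hN z⟩) (by
      intro z hz
      rw [mem_sel] at hz ⊢
      exact ⟨Finset.mem_univ _, hz.2⟩) m (by
      intro z _
      rw [filter_eq_sel]
      refine le_trans (Finset.card_le_card_of_injOn (fun x => (x : ℕ) % m)
        (t := Finset.range m) ?_ ?_) (by simp)
      · intro x _
        simpa using Nat.mod_lt _ h.arity_pos
      · intro x hx y hy hxy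
        have e₁ := congrArg Fin.val (mem_sel.1 hx).2
        have e₂ := congrArg Fin.val (mem_sel.1 hy).2
        simp only at e₁ e₂ hxy
        apply Fin.ext
        rw [← Nat.div_add_mod (x : ℕ) m, ← Nat.div_add_mod (y : ℕ) m, hxy, e₁, e₂])
  rw [mul_comm G]
  exact h₁.trans (Nat.mul_le_mul_left _ (h.fiber_le v))

theorem Sortable.card_tags_le (h : Sortable hn own o a F G N m L) :
    Fintype.card (I × Fin N) ≤ (n + 1) ^ (2 * a + 1) := by
  rw [Fintype.card_prod, Fintype.card_fin, pow_succ, two_mul, pow_add]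
  calc _ ≤ (n + 1) ^ a * (n + 1) ^ a := Nat.mul_le_mul h.card_le h.places_card
    _ ≤ _ := Nat.le_mul_of_pos_right _ (by omega)

theorem Sortable.card_node_tags_le (h : Sortable hn own o a F G N m L) :
    Fintype.card (Fin n × Fin N) ≤ (n + 1) ^ (2 * a + 1) := by
  rw [Fintype.card_prod, Fintype.card_fin, Fintype.card_fin, pow_succ, two_mul, pow_add]
  have h₁ := h.places_card
  have h₂ : 1 ≤ (n + 1) ^ a := Nat.one_le_pow _ _ (by omega)
  calc n * N ≤ (n + 1) * (1 * (n + 1) ^ a) := by gcongr <;> omega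
    _ ≤ (n + 1) * ((n + 1) ^ a * (n + 1) ^ a) := by gcongr
    _ = _ := by ring

theorem Sortable.node_tags_load (h : Sortable hn own o a F G N m L)
    (val : Fin n × Fin N → Option ℕ) (v : Fin n) :
    ∑ τ ∈ sel Finset.univ fun τ : Fin n × Fin N => τ.1 = v, numCost (val τ) ≤ F * n ∧
    ∑ τ ∈ sel Finset.univ fun τ : Fin n × Fin N => host hn τ.2 = v, numCost (val τ) ≤ F * n := by
  have h₁ : ∀ x, numCost x ≤ 1 := by rintro (_ | x) <;> simp [numCost]
  constructor
  · refine sum_pairs_left_le _ (fun u => u = v) (fun _ => N) ?_ fun u => ?_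
    · have : (sel Finset.univ fun u : Fin n => u = v) = {v} := by ext; simp
      rw [this]
      simpa using h.places_le
    · refine (Finset.sum_le_sum fun z _ => h₁ _).trans ?_
      simp
  · refine (sum_pairs_le _ (fun z => host hn z = v) (h.fiber_le v) (Y := n) fun z => ?_).trans
      (Nat.mul_le_mul_right _ h.fiber_bound)
    refine (Finset.sum_le_sum fun u _ => h₁ _).trans ?_
    simp

theorem Sortable.mul_lt (_ : Sortable hn own o a F G N m L) : n * (F * n) < (n + 1) ^ (F + 2) := by
  have h₁ := le_succ_pow hn F
  have h₂ : 0 < (n + 1) ^ F := Nat.pos_of_ne_zero (pow_ne_zero _ (by omega))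
  calc n * (F * n) ≤ n * ((n + 1) ^ F * n) := by gcongr
    _ = (n + 1) ^ F * (n * n) := by ring
    _ < (n + 1) ^ F * ((n + 1) * (n + 1)) := by
        apply Nat.mul_lt_mul_of_pos_left _ h₂
        nlinarith
    _ = _ := by ring

theorem Sortable.le_lt (h : Sortable hn own o a F G N m L) {x : ℕ} (hx : x ≤ F * n) :
    x < (n + 1) ^ (F + 2) := by
  refine lt_of_le_of_lt ?_ h.mul_lt
  nlinarith

/-- The load of the items at node `v` in bucket `p`. -/
noncomputable def bucketLoad (own : I → Fin n) (w β : I → ℕ) (v : Fin n) (p : ℕ) : ℕ :=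
  ∑ j ∈ sel Finset.univ fun j => own j = v ∧ β j = p, w j

/-- Owners are monotone in the items, so the items preceding i are those of earlier owners and the
earlier ones of the same owner. A node thus needs only the sum of the bucket loads of earlier nodes.
-/
theorem prefixWeight_eq (hown : Monotone own) (w β : I → ℕ) (i : I) :
    prefixWeight w β i
      = ∑ v ∈ sel Finset.univ fun v => v < own i, bucketLoad own w β v (β i)
        + ∑ j ∈ sel Finset.univ fun j => own j = own i ∧ j < i ∧ β j = β i, w j := by
  classical
  rw [prefixWeight, ← sum_sel_add_sum_sel_not _ (fun j => own j < own i)]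
  congr 1
  · rw [← Finset.sum_fiberwise_of_maps_to (t := sel Finset.univ fun v => v < own i) (g := own)]
    · refine Finset.sum_congr rfl fun v hv => ?_
      rw [bucketLoad]
      refine Finset.sum_congr ?_ fun _ _ => rfl
      ext j
      rw [mem_sel] at hv
      simp only [Finset.mem_filter, mem_sel, Finset.mem_univ, true_and]
      constructor
      · rintro ⟨⟨⟨_, h₁⟩, h₂⟩, h₃⟩; exact ⟨h₃, h₁⟩
      · rintro ⟨rfl, h₁⟩
        refine ⟨⟨⟨?_, h₁⟩, hv.2⟩, rfl⟩
        by_contra hji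
        exact absurd (hown (not_lt.1 hji)) (not_le.2 hv.2)
    · intro j hj
      rw [mem_sel] at hj
      simpa using hj.2
  · refine Finset.sum_congr ?_ fun _ _ => rfl
    ext j
    simp only [mem_sel, Finset.mem_univ, true_and]
    constructor
    · rintro ⟨⟨h₁, h₂⟩, h₃⟩
      exact ⟨le_antisymm (hown h₁.le) (not_lt.1 h₃), h₁, h₂⟩
    · rintro ⟨h₁, h₂, h₃⟩
      exact ⟨⟨h₂, h₃⟩, by rw [h₁]; exact lt_irrefl _⟩

theorem bucketLoad_le (h : Sortable hn own o a F G N m L) (ω : Ω) (β : I → ℕ) (v : Fin n) (p : ℕ) :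
    bucketLoad own (fun i => cost (o ω i)) β v p ≤ F * n := by
  refine le_trans (Finset.sum_le_sum_of_subset fun i hi => ?_) (h.owner_load ω v)
  rw [mem_sel] at hi ⊢
  exact ⟨hi.1, hi.2.1⟩

/-- The nodes learn the positions of their items in the buckets. -/
theorem within_prefixWeight (hb : 1 ≤ b) (h : Sortable hn own o a F G N m L) (X : Ω → Fin n → In)
    (κ : Fin n → Ω → Ω → Prop) (ho : ∀ i, Knows κ (own i) fun ω => o ω i) (β : Ω → I → ℕ)
    (hβ : ∀ i, Knows κ (own i) fun ω => β ω i) (hlt : ∀ ω i, β ω i < N) :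
    Within b X (2 * routeRounds (2 * a + 1 + (F + 2)) F) κ (fun κ' =>
      ∀ i, Knows κ' (own i) fun ω => prefixWeight (fun i => cost (o ω i)) (β ω) i) := by
  rw [two_mul]
  have hW : ∀ v p, Knows κ v (fun ω => bucketLoad own (fun i => cost (o ω i)) (β ω) v p) := by
    intro v p ω ω' hω
    refine Finset.sum_congr ?_ fun j hj => ?_
    · ext j
      simp only [mem_sel, Finset.mem_univ, true_and]
      refine and_congr_right fun hj => ?_
      subst hj
      have := hβ j hω
      simp only at this
      rw [this]
    · obtain ⟨_, rfl, _⟩ := mem_sel.1 hj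
      exact congrArg cost (ho j hω)
  -- Every node reports its load in bucket p to the host of place p.
  refine (within_route_numbers hb hn X κ (2 * a + 1) (F + 2) F (T := Fin n × Fin N)
    h.card_node_tags_le (fun τ => τ.1) (fun τ => host hn τ.2)
    (fun τ ω => some (bucketLoad own (fun i => cost (o ω i)) (β ω) τ.1 τ.2)) ?_ ?_
    (fun ω v => (h.node_tags_load _ v).1) (fun ω v => (h.node_tags_load _ v).2)).bind
    fun κ₁ hκ₁ h₁ => ?_
  · exact fun τ => (hW τ.1 τ.2).congr fun ω ω' h => by rw [h]
  · rintro τ ω x ⟨⟩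
    exact h.le_lt (bucketLoad_le h ω _ _ _)
  -- The hosts answer every node with the total load of the nodes before it.
  refine (within_route_numbers hb hn X κ₁ (2 * a + 1) (F + 2) F (T := Fin n × Fin N)
    h.card_node_tags_le (fun τ => host hn τ.2) (fun τ => τ.1)
    (fun τ ω => some (∑ v ∈ sel Finset.univ fun v => v < τ.1,
      bucketLoad own (fun i => cost (o ω i)) (β ω) v τ.2)) ?_ ?_
    (fun ω v => (h.node_tags_load _ v).2) (fun ω v => (h.node_tags_load _ v).1)).mono
    fun κ₂ hκ₂ h₂ i ω ω' hω => ?_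
  · rintro ⟨v, p⟩ ω ω' hω
    simp only [Option.some.injEq]
    refine Finset.sum_congr rfl fun u _ => ?_
    exact Option.some.inj (h₁ (u, p) hω)
  · rintro τ ω x ⟨⟩
    refine lt_of_le_of_lt ?_ h.mul_lt
    refine (Finset.sum_le_sum fun v _ => bucketLoad_le h ω _ v _).trans ?_
    rw [Finset.sum_const, smul_eq_mul]
    refine Nat.mul_le_mul_right _ ((Finset.card_le_univ _).trans (by simp))
  · have e := hβ i (hκ₁ _ _ _ (hκ₂ _ _ _ hω))
    simp only at e ⊢
    rw [prefixWeight_eq h.own_mono, prefixWeight_eq h.own_mono]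
    congr 1
    · have := Option.some.inj (h₂ (own i, ⟨β ω i, hlt ω i⟩) hω)
      rw [← e]
      exact this
    · refine Finset.sum_congr ?_ fun j hj => ?_
      · ext j
        simp only [mem_sel, Finset.mem_univ, true_and]
        refine and_congr_right fun hj => ?_
        have hj' := hβ j (by rw [hj]; exact hκ₁ _ _ _ (hκ₂ _ _ _ hω))
        simp only at hj'
        rw [hj', e]
      · obtain ⟨_, hj, _⟩ := mem_sel.1 hj
        exact congrArg cost (ho j (by rw [hj]; exact hκ₁ _ _ _ (hκ₂ _ _ _ hω)))

/-- The items are sent to their places. -/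
theorem within_deliver (hb : 1 ≤ b) (h : Sortable hn own o a F G N m L) (X : Ω → Fin n → In)
    (κ : Fin n → Ω → Ω → Prop) (ho : ∀ i, Knows κ (own i) fun ω => o ω i) (loc : Ω → I → ℕ)
    (hloc : ∀ i, Knows κ (own i) fun ω => loc ω i) (Y : ℕ) (hY : G * Y ≤ F * n)
    (hload : ∀ ω z, ∑ i ∈ sel Finset.univ fun i => loc ω i = z ∧ o ω i ≠ none, cost (o ω i) ≤ Y) :
    Within b X (objectRounds (2 * a + 1) c F) κ (fun κ' =>
      ∀ z < N, Knows κ' (host hn z) fun ω => restrict (o ω) fun i => loc ω i = z) := by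
  -- Sources and destinations of tags must not depend on the input. So there is a tag for every pair
  -- of an item and a place, and its value is absent unless the item goes there.
  refine (within_route_objects hb hn X κ (2 * a + 1) F (T := I × Fin N) h.card_tags_le
    (fun τ => own τ.1) (fun τ => host hn τ.2)
    (fun τ ω => restrict (o ω) (fun i => loc ω i = τ.2) τ.1) ?_ ?_ ?_).mono
    fun κ' _ h₁ z hz ω ω' hω => ?_
  · rintro ⟨i, z⟩ ω ω' hω
    have e₁ := ho i hω
    have e₂ := hloc i hω
    simp only [restrict] at e₁ e₂ ⊢
    rw [e₁, e₂]
  · intro ω v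
    rw [filter_eq_sel]
    exact sum_pairs_left_le (fun τ => cost (restrict (o ω) (fun i => loc ω i = τ.2) τ.1))
      (fun i => own i = v) _ (h.owner_load ω v) (sum_cost_restrict_place_le (o ω) (loc ω))
  · intro ω v
    rw [filter_eq_sel]
    refine (sum_pairs_le (fun τ : I × Fin N => cost (restrict (o ω) (fun i => loc ω i = τ.2) τ.1))
      (fun z => host hn z = v) (h.fiber_le v) (Y := Y) fun z => ?_).trans hY
    exact (sum_cost_restrict (o ω) _).trans_le (hload ω z)
  · funext i
    exact h₁ (i, ⟨z, hz⟩) hω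

end Level

end CongestedClique

/-! ### Nets and splitters moving along trees. -/

namespace CongestedClique

section Tree

variable {n b c : ℕ} {In Ω I : Type} [Fintype I] [LinearOrder I]
  {hn : 0 < n} {own : I → Fin n} {o : Ω → I → Option (Obj c n)} {a F G N m L : ℕ}

theorem Sortable.fiber_id_le (h : Sortable hn own o a F G N m L) (v : Fin n) :
    (sel Finset.univ fun z : Fin N => host hn z = v).card ≤ G * m :=
  (h.fiber_le v).trans (Nat.le_mul_of_pos_right _ h.arity_pos)

/-- Sets of at most `m` items are sent from the places `f z` to the places `g z`. -/
theorem within_send_sets (hb : 1 ≤ b) (h : Sortable hn own o a F G N m L) (X : Ω → Fin n → In)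
    (κ : Fin n → Ω → Ω → Prop) (S : Ω → ℕ → Finset I) (hS : ∀ ω z, (S ω z).card ≤ m) (f g : ℕ → ℕ)
    (hf : ∀ v, (sel Finset.univ fun z : Fin N => host hn (f z) = v).card ≤ G * m)
    (hg : ∀ v, (sel Finset.univ fun z : Fin N => host hn (g z) = v).card ≤ G * m)
    (V : ℕ) (hV : V ≤ N)
    (hknow : ∀ z < V, Knows κ (host hn (f z)) fun ω => restrict (o ω) (· ∈ S ω z)) :
    Within b X (objectRounds (2 * a + 1) c F) κ (fun κ' =>
      ∀ z < V, Knows κ' (host hn (g z)) fun ω => restrict (o ω) (· ∈ S ω z)) := by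
  have hload : ∀ (l : ℕ → ℕ), (∀ v, (sel Finset.univ fun z : Fin N => host hn (l z) = v).card
      ≤ G * m) → ∀ ω v, ∑ τ ∈ Finset.univ.filter (fun τ : I × Fin N => host hn (l τ.2) = v),
        cost (if (τ.2 : ℕ) < V then restrict (o ω) (· ∈ S ω τ.2) τ.1 else none) ≤ F * n := by
    intro l hl ω v
    rw [filter_eq_sel]
    refine (sum_pairs_le (fun τ : I × Fin N =>
      cost (if (τ.2 : ℕ) < V then restrict (o ω) (· ∈ S ω τ.2) τ.1 else none))
      (fun z => host hn (l z) = v) (hl v) (Y := m * L) fun z => ?_).trans h.tree_load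
    by_cases hz : (z : ℕ) < V
    · simp only [hz, if_true]
      exact (sum_cost_restrict_mem_le (o ω) (S ω z) (h.cost_le ω)).trans
        (Nat.mul_le_mul_right _ (hS ω z))
    · simp [hz, cost]
  refine (within_route_objects hb hn X κ (2 * a + 1) F (T := I × Fin N) h.card_tags_le
    (fun τ => host hn (f τ.2)) (fun τ => host hn (g τ.2))
    (fun τ ω => if (τ.2 : ℕ) < V then restrict (o ω) (· ∈ S ω τ.2) τ.1 else none) ?_
    (hload f hf) (hload g hg)).mono fun κ' _ h₁ z hz ω ω' hω => ?_
  · rintro ⟨i, z⟩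
    by_cases hz : (z : ℕ) < V
    · simp only [hz, if_true]
      exact (hknow z hz).congr fun ω ω' h => congrFun h i
    · simp only [hz, if_false]
      exact fun _ _ _ => rfl
  · funext i
    have := h₁ (i, ⟨z, hz.trans_le hV⟩) hω
    simpa only [hz, if_true] using this

variable [LinearOrder (Obj c n)]

theorem Knows.restrict_pick {κ : Fin n → Ω → Ω → Prop} {v : Fin n} {U : Ω → I → Prop}
    (h : Knows κ v fun ω => restrict (o ω) (U ω)) (w : Option (Obj c n) → ℕ) (q : ℕ) :
    Knows κ v fun ω => restrict (o ω) (· ∈ pick w q (restrict (o ω) (U ω))) := by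
  have e : ∀ ω, restrict (o ω) (· ∈ pick w q (restrict (o ω) (U ω))) =
      restrict (restrict (o ω) (U ω)) (· ∈ pick w q (restrict (o ω) (U ω))) := fun ω =>
    (restrict_of_imp fun i hi => ((pick_spec w q (o ω) (U ω)).1 i hi).1).symm
  simp only [e]
  exact h.congr fun ω ω' hω => by rw [hω]

/-- The hosts of the nodes of the trees learn the nets there. -/
theorem within_treeNet (hb : 1 ≤ b) (h : Sortable hn own o a F G N m L) (X : Ω → Fin n → In)
    (κ : Fin n → Ω → Ω → Prop) (loc : Ω → I → ℕ) (E M t : ℕ) (hM : M * m ^ t ≤ N)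
    (hcard : ∀ ω k r, (treeNet cost m E (o ω) (loc ω) k r).card ≤ m)
    (hloc : ∀ z < N, Knows κ (host hn z) fun ω => restrict (o ω) fun i => loc ω i = z)
    (k : ℕ) (hk : k ≤ t) :
    Within b X (k * objectRounds (2 * a + 1) c F) κ (fun κ' => ∀ r < M * m ^ (t - k),
      Knows κ' (host hn r) fun ω => restrict (o ω) (· ∈ treeNet cost m E (o ω) (loc ω) k r)) := by
  induction k with
  | zero =>
    rw [zero_mul]
    exact Within.zero fun r hr => (hloc r (hr.trans_le hM)).restrict_pick cost E
  | succ k ih =>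
    rw [add_mul, one_mul]
    have hle : M * m ^ (t - k) ≤ N := le_trans (Nat.mul_le_mul_left _
      (Nat.pow_le_pow_right h.arity_pos (Nat.sub_le _ _))) hM
    -- Node r of height k, hosted at place r, sends its net to its parent r / m. A parent receives m
    -- sets of at most m objects, of total cost at most m * (m * L).
    refine (ih (by omega)).bind fun κ₁ _ h₁ =>
      (within_send_sets hb h X κ₁ (fun ω r => treeNet cost m E (o ω) (loc ω) k r)
        (fun ω r => hcard ω k r) (fun r => r) (fun r => r / m) h.fiber_id_le h.fiber_div_le
        (M * m ^ (t - k)) hle h₁).mono fun κ₂ _ h₂ r hr => ?_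
    have hr' : ∀ j < m, r * m + j < M * m ^ (t - k) := by
      intro j hj
      have e : t - k = t - (k + 1) + 1 := by omega
      rw [e, pow_succ, ← mul_assoc]
      nlinarith
    refine Knows.restrict_pick (U := fun ω i => ∃ j < m,
      i ∈ treeNet cost m E (o ω) (loc ω) k (r * m + j)) (fun ω ω' hω => ?_) _ _
    funext i
    apply Option.ext
    intro A
    have h₃ : ∀ j < m, restrict (o ω) (· ∈ treeNet cost m E (o ω) (loc ω) k (r * m + j)) i =
        restrict (o ω') (· ∈ treeNet cost m E (o ω') (loc ω') k (r * m + j)) i := by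
      intro j hj
      have := h₂ (r * m + j) (hr' j hj)
      rw [mul_comm r m, Nat.mul_add_div h.arity_pos, Nat.div_eq_of_lt hj, add_zero,
        mul_comm m r] at this
      exact congrFun (this hω) i
    have h₄ : ∀ ω, restrict (o ω) (fun i => ∃ j < m,
        i ∈ treeNet cost m E (o ω) (loc ω) k (r * m + j)) i = some A ↔ ∃ j < m,
        restrict (o ω) (· ∈ treeNet cost m E (o ω) (loc ω) k (r * m + j)) i = some A := by
      intro ω
      simp only [restrict_eq_some]
      exact ⟨fun ⟨⟨j, hj, hi⟩, ho⟩ => ⟨j, hj, hi, ho⟩, fun ⟨j, hj, hi, ho⟩ => ⟨⟨j, hj, hi⟩, ho⟩⟩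
    rw [h₄, h₄]
    exact exists_congr fun j => and_congr_right fun hj => by rw [h₃ j hj]

omit [LinearOrder (Obj c n)] in
/-- The sets at the roots are made known at all the places of the trees. -/
theorem within_broadcast_down (hb : 1 ≤ b) (h : Sortable hn own o a F G N m L)
    (X : Ω → Fin n → In) (κ : Fin n → Ω → Ω → Prop) (S : Ω → ℕ → Finset I)
    (hcard : ∀ ω p, (S ω p).card ≤ m) (M t : ℕ) (hM : M * m ^ t ≤ N)
    (hroot : ∀ p < M, Knows κ (host hn p) fun ω => restrict (o ω) (· ∈ S ω p))
    (k : ℕ) (hk : k ≤ t) :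
    Within b X (k * objectRounds (2 * a + 1) c F) κ (fun κ' => ∀ r < M * m ^ k,
      Knows κ' (host hn r) fun ω => restrict (o ω) (· ∈ S ω (r / m ^ k))) := by
  induction k with
  | zero =>
    rw [zero_mul]
    exact Within.zero fun r hr => by simpa using hroot r (by simpa using hr)
  | succ k ih =>
    rw [add_mul, one_mul]
    have hle : M * m ^ (k + 1) ≤ N := le_trans (Nat.mul_le_mul_left _
      (Nat.pow_le_pow_right h.arity_pos hk)) hM
    -- Sending down level by level keeps the number of recipients of a set at m in each step.
    refine (ih (by omega)).bind fun κ₁ _ h₁ =>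
      within_send_sets hb h X κ₁ (fun ω r => S ω (r / m ^ (k + 1)))
        (fun ω r => hcard ω _) (fun r => r / m) (fun r => r) h.fiber_div_le h.fiber_id_le
        (M * m ^ (k + 1)) hle fun r hr => ?_
    have hr' : r / m < M * m ^ k := Nat.div_lt_of_lt_mul (by rw [pow_succ] at hr; linarith)
    have := h₁ (r / m) hr'
    rwa [Nat.div_div_eq_div_mul, mul_comm m, ← pow_succ] at this

theorem child_restrict (o : I → Option (Obj c n)) {S : Finset I} {i : I} {g g' : I → Option (Obj c n)}
    (hg : g = restrict o (· ∈ S)) (hS : ∀ s ∈ S, o s ≠ none) (hg' : g' i = o i) :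
    child o S i = (sel Finset.univ fun s => g s ≠ none ∧ sortKey g s ≤ sortKey g' i).card := by
  rw [child]
  congr 1
  ext s
  have hi : sortKey g' i = sortKey o i := by rw [sortKey, hg', sortKey]
  rw [hg]
  simp only [mem_sel, Finset.mem_univ, true_and, restrict_ne_none, hi]
  constructor
  · rintro ⟨h₁, h₂⟩
    exact ⟨⟨h₁, hS s h₁⟩, by rwa [sortKey, restrict_of_pos (U := (· ∈ S)) h₁]⟩
  · rintro ⟨⟨h₁, _⟩, h₂⟩
    exact ⟨h₁, by rwa [sortKey, restrict_of_pos (U := (· ∈ S)) h₁] at h₂⟩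

omit [Fintype I] in
-- An absent object is below every splitter. Hence no answer has to be sent for it.
theorem child_eq_zero {o : I → Option (Obj c n)} {S : Finset I} {i : I} (hS : ∀ s ∈ S, o s ≠ none)
    (hi : o i = none) : child o S i = 0 := by
  rw [child, Finset.card_eq_zero, Finset.eq_empty_iff_forall_notMem]
  intro s hs
  obtain ⟨h₁, h₂⟩ := mem_sel.1 hs
  rcases sortKey_le_iff.1 h₂ with h₃ | h₃
  · rw [hi] at h₃
    exact not_lt_bot h₃
  · exact hS s h₁ (h₃.1.trans hi)

/-- The number of rounds of a refinement step over trees of height `t`. -/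
def levelRounds (a c F t : ℕ) : ℕ :=
  2 * routeRounds (2 * a + 1 + (F + 2)) F + (objectRounds (2 * a + 1) c F +
    (t * objectRounds (2 * a + 1) c F + (t * objectRounds (2 * a + 1) c F +
      routeRounds (2 * a + 1 + (F + 2)) F)))

/-- The owners of the items learn the refined buckets. -/
theorem within_refineBucket (hb : 1 ≤ b) (h : Sortable hn own o a F G N m L) (X : Ω → Fin n → In)
    (κ : Fin n → Ω → Ω → Prop) (ho : ∀ i, Knows κ (own i) fun ω => o ω i) (β : Ω → I → ℕ)
    (hβ : ∀ i, Knows κ (own i) fun ω => β ω i) (M t E Q : ℕ) (hM : M * m ^ t ≤ N)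
    (hlt : ∀ ω i, β ω i < M) (hLE : L ≤ E) (hQ : 0 < Q) (hE : Q + L < m * (E + 1))
    (hload : G * (Q + L) ≤ F * n)
    (hbkt : ∀ ω p, ∑ i ∈ sel Finset.univ fun i => β ω i = p, cost (o ω i) ≤ Q * m ^ t) :
    Within b X (levelRounds a c F t) κ (fun κ' => ∀ i, Knows κ' (own i) fun ω =>
      refineBucket cost m t E Q (o ω) (β ω) i) := by
  obtain ⟨loc, hloc⟩ : ∃ loc : Ω → I → ℕ,
    loc = fun ω => place (fun i => cost (o ω i)) (β ω) (m ^ t) Q := ⟨_, rfl⟩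
  have hcost : ∀ x : Option (Obj c n), x ≠ none → 1 ≤ cost x := fun x hx => one_le_cost hx
  have hmt : 0 < m ^ t := pow_pos h.arity_pos t
  have hspec := fun ω k r => treeNet_place_spec (t := t) (k := k) (r := r) h.arity_pos hcost
    (h.cost_le ω) hLE hQ hE (hbkt ω)
  have hlocload : ∀ ω z, ∑ i ∈ sel Finset.univ fun i => loc ω i = z ∧ o ω i ≠ none, cost (o ω i)
      ≤ Q + L := by
    intro ω z
    rw [hloc]
    exact sum_place_le hQ (hbkt ω) (h.cost_le ω) (fun i hi => hcost _ hi) z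
  have hMN : M ≤ N := (Nat.le_mul_of_pos_right _ hmt).trans hM
  refine (within_prefixWeight hb h X κ ho β hβ fun ω i => (hlt ω i).trans_le hMN).bind
    fun κ₁ hκ₁ h₁ => ?_
  have hknowloc : ∀ i, Knows κ₁ (own i) fun ω => loc ω i := by
    intro i ω ω' hω
    have e₁ := h₁ i hω
    have e₂ := hβ i (hκ₁ _ _ _ hω)
    simp only at e₁ e₂
    simp only [hloc, place, e₁, e₂]
  refine (within_deliver hb h X κ₁ (fun i => (ho i).mono hκ₁) loc hknowloc (Q + L) hload
    hlocload).bind fun κ₂ hκ₂ h₂ => ?_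
  refine (within_treeNet hb h X κ₂ loc E M t hM (fun ω k r => by
    rw [hloc]; exact (hspec ω k r).2.1.le) h₂ t le_rfl).bind fun κ₃ hκ₃ h₃ => ?_
  rw [Nat.sub_self, pow_zero, mul_one] at h₃
  refine (within_broadcast_down hb h X κ₃ (fun ω p => treeNet cost m E (o ω) (loc ω) t p)
    (fun ω r => by rw [hloc]; exact (hspec ω t r).2.1.le) M t hM h₃ t le_rfl).bind
    fun κ₄ hκ₄ h₄ => ?_
  have hplace : ∀ ω i, o ω i ≠ none → loc ω i / m ^ t = β ω i := by
    intro ω i hi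
    rw [hloc]
    exact place_div (hbkt ω) (hcost _ hi)
  have hplt : ∀ ω i, o ω i ≠ none → loc ω i < M * m ^ t := by
    intro ω i hi
    have := hplace ω i hi
    have h₅ := hlt ω i
    rw [← this, Nat.div_lt_iff_lt_mul hmt] at h₅
    exact h₅
  have hnone : ∀ ω r, ∀ s ∈ treeNet cost m E (o ω) (loc ω) t r, o ω s ≠ none := by
    intro ω r s hs
    rw [hloc] at hs
    exact ((hspec ω t r).1 s hs).2
  classical
  -- The place of an item, which now knows the splitters of its bucket, returns the child number to
  -- the owner.
  let val : I × Fin N → Ω → Option ℕ := fun τ ω =>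
    if restrict (o ω) (fun i => loc ω i = τ.2) τ.1 ≠ none ∧ (τ.2 : ℕ) < M * m ^ t then
      some (child (o ω) (treeNet cost m E (o ω) (loc ω) t (τ.2 / m ^ t)) τ.1) else none
  have hval : ∀ τ ω, numCost (val τ ω) ≤ cost (restrict (o ω) (fun i => loc ω i = τ.2) τ.1) := by
    intro τ ω
    by_cases hc : restrict (o ω) (fun i => loc ω i = τ.2) τ.1 ≠ none ∧ (τ.2 : ℕ) < M * m ^ t
    · simp only [val, if_pos hc]
      exact hcost _ hc.1
    · simp only [val, if_neg hc]
      exact Nat.zero_le _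
  refine (within_route_numbers hb hn X κ₄ (2 * a + 1) (F + 2) F (T := I × Fin N)
    h.card_tags_le (fun τ => host hn τ.2) (fun τ => own τ.1) val ?_ ?_ ?_ ?_).mono
    fun κ₅ hκ₅ h₅ i ω ω' hω => ?_
  · rintro ⟨i, z⟩ ω ω' hω
    by_cases hz : (z : ℕ) < M * m ^ t
    · have e₁ := h₂ z z.2 (hκ₃ _ _ _ (hκ₄ _ _ _ hω))
      have e₂ := h₄ z hz hω
      simp only at e₁ e₂
      simp only [val, hz, and_true]
      rw [e₁]
      by_cases hne : restrict (o ω') (fun i => loc ω' i = z) i ≠ none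
      · rw [if_pos hne, if_pos hne]
        have hne' : restrict (o ω) (fun i => loc ω i = z) i ≠ none := by rw [e₁]; exact hne
        congr 1
        rw [child_restrict (o ω) (i := i) (g := restrict (o ω)
            (· ∈ treeNet cost m E (o ω) (loc ω) t (z / m ^ t)))
            (g' := restrict (o ω) (fun i => loc ω i = z)) rfl (hnone ω _)
            (restrict_of_pos (restrict_ne_none.1 hne').1),
          child_restrict (o ω') (i := i) (g := restrict (o ω')
            (· ∈ treeNet cost m E (o ω') (loc ω') t (z / m ^ t)))
            (g' := restrict (o ω') (fun i => loc ω' i = z)) rfl (hnone ω' _)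
            (restrict_of_pos (restrict_ne_none.1 hne).1), e₁, e₂]
      · rw [if_neg hne, if_neg hne]
    · simp only [val, hz, and_false, if_false]
  · intro τ ω x hx
    refine h.le_lt (le_trans ?_ h.arity_le)
    simp only [val] at hx
    split_ifs at hx with hc
    · obtain rfl := Option.some.inj hx
      refine (child_le_card _ _ _).trans ?_
      rw [hloc]
      exact (hspec ω t _).2.1.le
    · simp at hx
  · intro ω v
    refine (Finset.sum_le_sum fun τ _ => hval τ ω).trans ?_
    refine (sum_pairs_le (fun τ : I × Fin N => cost (restrict (o ω) (fun i => loc ω i = τ.2) τ.1))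
      (fun z => host hn z = v) (h.fiber_le v) (Y := Q + L) fun z => ?_).trans hload
    exact (sum_cost_restrict (o ω) _).trans_le (hlocload ω z)
  · intro ω v
    refine (Finset.sum_le_sum fun τ _ => hval τ ω).trans ?_
    exact sum_pairs_left_le (fun τ => cost (restrict (o ω) (fun i => loc ω i = τ.2) τ.1))
      (fun i => own i = v) _ (h.owner_load ω v) (sum_cost_restrict_place_le (o ω) (loc ω))
  · have hω₁ := hκ₂ _ _ _ (hκ₃ _ _ _ (hκ₄ _ _ _ (hκ₅ _ _ _ hω)))
    have e₁ := hβ i (hκ₁ _ _ _ hω₁)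
    have e₂ := ho i (hκ₁ _ _ _ hω₁)
    have e₃ := hknowloc i hω₁
    simp only at e₁ e₂ e₃ ⊢
    have hre : ∀ ω, refineBucket cost m t E Q (o ω) (β ω) i
        = β ω i * m + child (o ω) (treeNet cost m E (o ω) (loc ω) t (β ω i)) i := by
      intro ω; rw [hloc]; rfl
    rw [hre, hre, e₁]
    congr 1
    by_cases hi : o ω' i = none
    · rw [child_eq_zero (hnone ω' _) hi, child_eq_zero (hnone ω _) (e₂.trans hi)]
    · have hi' : o ω i ≠ none := by rwa [e₂]
      have hz := hplt ω' i hi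
      have := h₅ (i, ⟨loc ω' i, hz.trans_le hM⟩) hω
      simp only [val, hz, and_true] at this
      rw [if_pos (restrict_ne_none (U := fun j => loc ω j = loc ω' i) |>.2 ⟨e₃, hi'⟩),
        if_pos (restrict_ne_none (U := fun j => loc ω' j = loc ω' i) |>.2 ⟨rfl, hi⟩),
        hplace ω' i hi] at this
      exact Option.some.inj this

end Tree

end CongestedClique

/-! ### Sorting into buckets of linear load. -/

namespace CongestedClique

section Sorted

variable {n b c : ℕ} {In Ω I : Type} [Fintype I] [LinearOrder I]
  {hn : 0 < n} {own : I → Fin n} {o : Ω → I → Option (Obj c n)} {a F G N m L : ℕ}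

/-- `loadFactor H F₀ l * n` bounds the load of the places at level `l`. -/
def loadFactor (H F₀ : ℕ) : ℕ → ℕ
  | 0 => F₀
  | l + 1 => 3 ^ (H + 1) * (loadFactor H F₀ l + 2 * F₀)

theorem loadFactor_mono (H F₀ : ℕ) : Monotone (loadFactor H F₀) := by
  refine monotone_nat_of_le_succ fun l => ?_
  rw [loadFactor]
  calc loadFactor H F₀ l ≤ 1 * (loadFactor H F₀ l + 2 * F₀) := by omega
    _ ≤ _ := Nat.mul_le_mul_right _ (Nat.one_le_pow _ _ (by norm_num))

/-- The number of rounds of the refinement steps of the first `l` levels. -/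
def sortRounds (a c F H : ℕ) : ℕ → ℕ
  | 0 => 0
  | l + 1 => sortRounds a c F H l + levelRounds a c F (H - l)

/-- The items are sorted into buckets of load `O(n)` after as many refinement steps as the trees have
levels. -/
theorem exists_within_buckets [LinearOrder (Obj c n)] (hb : 1 ≤ b)
    (h : Sortable hn own o a F G N m L) (X : Ω → Fin n → In) (F₀ H : ℕ) (hF₀ : 0 < F₀)
    (hN : N = m ^ H) (hnN : n ≤ N) (hL : m * m * L ≤ F₀ * n)
    (hload : ∀ ω v, ∑ i ∈ sel Finset.univ fun i => own i = v, cost (o ω i) ≤ F₀ * n)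
    (hF : G * (loadFactor H F₀ H + F₀) ≤ F) (l : ℕ) (hl : l ≤ H) :
    ∃ β : Ω → I → ℕ, (∀ ω i, β ω i < m ^ l) ∧
      (∀ ω p, ∑ i ∈ sel Finset.univ fun i => β ω i = p, cost (o ω i)
        ≤ loadFactor H F₀ l * n * m ^ (H - l)) ∧
      (∀ ω i j, β ω i < β ω j → sortKey (o ω) i < sortKey (o ω) j) ∧
      ∀ κ : Fin n → Ω → Ω → Prop, (∀ i, Knows κ (own i) fun ω => o ω i) →
        Within b X (sortRounds a c F H l) κ
          (fun κ' => ∀ i, Knows κ' (own i) fun ω => β ω i) := by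
  have hm := h.arity_pos
  induction l with
  | zero =>
    refine ⟨fun _ _ => 0, by simp, fun ω p => ?_, by simp, fun κ _ =>
      Within.zero fun _ _ _ _ => rfl⟩
    calc _ ≤ ∑ i, cost (o ω i) := Finset.sum_le_sum_of_subset (Finset.subset_univ _)
      _ = ∑ v, ∑ i ∈ sel Finset.univ fun i => own i = v, cost (o ω i) := by
          rw [← Finset.sum_fiberwise_of_maps_to (t := Finset.univ) (g := own) (by simp)]
          simp only [filter_eq_sel]
      _ ≤ ∑ v : Fin n, F₀ * n := Finset.sum_le_sum fun v _ => hload ω v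
      _ = F₀ * n * n := by simp; ring
      _ ≤ _ := by
          rw [loadFactor, Nat.sub_zero, ← hN]
          exact Nat.mul_le_mul_left _ hnN
  | succ l ih =>
    obtain ⟨β, hlt, hsum, hsort, hknow⟩ := ih (by omega)
    obtain ⟨Q, hQ⟩ : ∃ Q, Q = loadFactor H F₀ l * n := ⟨_, rfl⟩
    -- The quotient makes the load Q + L of a leaf smaller than m * (E + 1); the summand L ensures L
    -- ≤ E.
    obtain ⟨E, hE⟩ : ∃ E, E = (Q + L) / m + L := ⟨_, rfl⟩
    obtain ⟨t, ht⟩ : ∃ t, H - l = t + 1 := ⟨H - l - 1, by omega⟩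
    have ht' : H - (l + 1) = t := by omega
    have hLE : L ≤ E := hE ▸ Nat.le_add_left _ _
    have hQpos : 0 < Q := by
      have := loadFactor_mono H F₀ (Nat.zero_le l)
      rw [loadFactor] at this
      rw [hQ]
      exact Nat.mul_pos (by omega) hn
    have hQE : Q + L < m * (E + 1) := by
      have h₁ := Nat.lt_mul_div_succ (Q + L) hm
      rw [hE]
      nlinarith [Nat.zero_le (m * L)]
    have hmL : L + m * L ≤ 2 * F₀ * n := by
      have h₁ : m * L ≤ m * m * L := Nat.mul_le_mul_right _ (Nat.le_mul_of_pos_left _ hm)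
      have h₂ : L ≤ m * L := Nat.le_mul_of_pos_left _ hm
      nlinarith
    have hmE : m * E ≤ (loadFactor H F₀ l + 2 * F₀) * n := by
      have h₁ := Nat.mul_div_le (Q + L) m
      rw [hE, mul_add]
      calc _ ≤ Q + L + m * L := by omega
        _ ≤ Q + 2 * F₀ * n := by omega
        _ = _ := by rw [hQ]; ring
    have hbkt : ∀ ω p, ∑ i ∈ sel Finset.univ fun i => β ω i = p, cost (o ω i)
        ≤ Q * m ^ (t + 1) := by
      intro ω p
      have := hsum ω p
      rwa [ht, ← hQ] at this
    have hcost : ∀ x : Option (Obj c n), x ≠ none → 1 ≤ cost x := fun x hx => one_le_cost hx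
    have hLn : L ≤ F₀ * n := by
      have : L ≤ m * m * L := Nat.le_mul_of_pos_left _ (Nat.mul_pos hm hm)
      omega
    have hloadQ : G * (Q + L) ≤ F * n := by
      have h₁ := loadFactor_mono H F₀ (by omega : l ≤ H)
      calc _ ≤ G * (loadFactor H F₀ H * n + F₀ * n) := by
            rw [hQ]; gcongr
        _ = G * (loadFactor H F₀ H + F₀) * n := by ring
        _ ≤ _ := Nat.mul_le_mul_right _ hF
    refine ⟨fun ω => refineBucket cost m (t + 1) E Q (o ω) (β ω), ?_, ?_, ?_, ?_⟩
    · intro ω i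
      rw [pow_succ]
      exact refineBucket_lt hm hcost (h.cost_le ω) hLE hQpos hQE (hbkt ω) (hlt ω i)
    · intro ω p
      refine (sum_refineBucket_le hm rfl hcost (h.cost_le ω) hLE hQpos hQE (hbkt ω) p).trans ?_
      rw [ht', loadFactor]
      -- One factor m of the error combines with E, as m * E is O(n). So the load per remaining leaf
      -- grows only by a constant factor.
      calc 3 * ((3 * m) ^ (t + 1) * E) = 3 ^ (t + 2) * (m * E) * m ^ t := by
            rw [mul_pow, pow_succ m t, pow_succ 3 (t + 1)]; ring
        _ ≤ 3 ^ (H + 1) * ((loadFactor H F₀ l + 2 * F₀) * n) * m ^ t := by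
            have h₁ : 3 ^ (t + 2) ≤ 3 ^ (H + 1) :=
              Nat.pow_le_pow_right (by norm_num) (by omega)
            exact Nat.mul_le_mul_right _ (Nat.mul_le_mul h₁ hmE)
        _ = _ := by ring
    · intro ω i j hij
      exact sortKey_lt_of_refineBucket_lt hm hcost (h.cost_le ω) hLE hQpos hQE (hbkt ω)
        (hsort ω i j) hij
    · intro κ ho
      rw [sortRounds, ht]
      refine (hknow κ ho).bind fun κ₁ hκ₁ h₁ => ?_
      refine within_refineBucket hb h X κ₁ (fun i => (ho i).mono hκ₁) β h₁ (m ^ l) (t + 1) E Q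
        ?_ hlt hLE hQpos hQE hloadQ hbkt
      rw [← pow_add, hN]
      exact (congrArg _ (by omega)).le

end Sorted

/-! ### Computing ranks from sorted buckets. -/

section Ranks

theorem sum_fiber_le {T : Type} [Fintype T] {N G Y : ℕ} (x : T → ℕ) (g : T → Fin N)
    (P : Fin N → Prop) (hP : (sel Finset.univ P).card ≤ G)
    (hx : ∀ z, ∑ τ ∈ sel Finset.univ (fun τ => g τ = z), x τ ≤ Y) :
    ∑ τ ∈ sel Finset.univ fun τ => P (g τ), x τ ≤ G * Y := by
  rw [← Finset.sum_fiberwise_of_maps_to (t := sel Finset.univ P) (g := g)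
    (by intro τ hτ; simpa using (mem_sel.1 hτ).2)]
  calc _ ≤ ∑ z ∈ sel Finset.univ P, Y := Finset.sum_le_sum fun z _ => by
        refine le_trans (Finset.sum_le_sum_of_subset fun τ hτ => ?_) (hx z)
        rw [Finset.mem_filter] at hτ
        exact mem_sel.2 ⟨Finset.mem_univ _, hτ.2⟩
    _ = (sel Finset.univ P).card * Y := by simp
    _ ≤ _ := Nat.mul_le_mul_right _ hP

theorem sum_le_of_unique {T : Type} {s : Finset T} {x : T → ℕ} {L : ℕ} (hL : ∀ τ, x τ ≤ L)
    (hu : ∀ τ ∈ s, ∀ τ' ∈ s, x τ ≠ 0 → x τ' ≠ 0 → τ = τ') : ∑ τ ∈ s, x τ ≤ L := by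
  classical
  rw [← Finset.sum_filter_ne_zero]
  have h : (s.filter fun τ => x τ ≠ 0).card ≤ 1 := by
    rw [Finset.card_le_one]
    intro τ hτ τ' hτ'
    rw [Finset.mem_filter] at hτ hτ'
    exact hu τ hτ.1 τ' hτ'.1 hτ.2 hτ'.2
  calc _ ≤ ∑ τ ∈ s.filter fun τ => x τ ≠ 0, L := Finset.sum_le_sum fun τ _ => hL τ
    _ = (s.filter fun τ => x τ ≠ 0).card * L := by simp
    _ ≤ 1 * L := Nat.mul_le_mul_right _ h
    _ = L := one_mul L

variable {n b c : ℕ} {In Ω I : Type} [Fintype I] [LinearOrder I]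
  {hn : 0 < n} {own : I → Fin n} {o : Ω → I → Option (Obj c n)} {a F G N m L : ℕ}

/-- Every place `p` broadcasts a number to all nodes. -/
theorem within_broadcast (hb : 1 ≤ b) (h : Sortable hn own o a F G N m L) (X : Ω → Fin n → In)
    (κ : Fin n → Ω → Ω → Prop) (x : Ω → ℕ → ℕ) (hx : ∀ ω, ∀ p < N, x ω p ≤ F * n)
    (hknow : ∀ p < N, Knows κ (host hn p) fun ω => x ω p) :
    Within b X (routeRounds (2 * a + 1 + (F + 2)) F) κ
      (fun κ' => ∀ v, ∀ p < N, Knows κ' v fun ω => x ω p) := by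
  refine (within_route_numbers hb hn X κ (2 * a + 1) (F + 2) F (T := Fin n × Fin N)
    h.card_node_tags_le (fun τ => host hn τ.2) (fun τ => τ.1) (fun τ ω => some (x ω τ.2)) ?_ ?_
    (fun ω v => (h.node_tags_load _ v).2) (fun ω v => (h.node_tags_load _ v).1)).mono
    fun κ' _ h₁ v p hp ω ω' hω => Option.some.inj (h₁ (v, ⟨p, hp⟩) hω)
  · exact fun τ => (hknow τ.2 τ.2.2).congr fun ω ω' h => by rw [h]
  · rintro τ ω y ⟨⟩
    exact h.le_lt (hx ω τ.2 τ.2.2)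

theorem Sortable.sum_cost_le (h : Sortable hn own o a F G N m L) (ω : Ω) :
    ∑ i, cost (o ω i) ≤ n * (F * n) := by
  rw [← Finset.sum_fiberwise_of_maps_to (t := Finset.univ) (g := own) (by simp)]
  simp only [filter_eq_sel]
  refine (Finset.sum_le_sum fun v _ => h.owner_load ω v).trans ?_
  simp

variable [LinearOrder (Obj c n)]

omit [Fintype I] in
-- The right side mentions only the contents of bucket p and which buckets are nonempty, all of
-- which the host of p will know.
theorem isLink_iff {o : I → Option (Obj c n)} {β : I → ℕ} (hlt : ∀ i, β i < N) {i : I} {p p' : ℕ} :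
    (β i = p ∧ IsLink o β i p') ↔ restrict o (β · = p) i ≠ none ∧
      (∀ k, restrict o (β · = p) k ≠ none → sortKey (restrict o (β · = p)) k
        ≤ sortKey (restrict o (β · = p)) i) ∧ p < p' ∧ p' < N ∧ (∃ k, o k ≠ none ∧ β k = p') ∧
      ∀ q < N, (∃ k, o k ≠ none ∧ β k = q) → q ≤ p ∨ p' ≤ q := by
  have hk : ∀ k, β k = p → sortKey (restrict o (β · = p)) k = sortKey o k := fun k hk => by
    rw [sortKey, restrict_of_pos (U := (β · = p)) hk, sortKey]
  constructor
  · rintro ⟨rfl, h₁, h₂, h₃, h₄, h₅⟩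
    refine ⟨restrict_ne_none.2 ⟨rfl, h₁⟩, fun k hk' => ?_, h₃, ?_, h₄, ?_⟩
    · obtain ⟨e, hk''⟩ := restrict_ne_none.1 hk'
      rw [hk k e, hk i rfl]
      exact h₂ k hk'' e
    · obtain ⟨k, _, rfl⟩ := h₄
      exact hlt k
    · rintro q _ ⟨k, hk', rfl⟩
      exact h₅ k hk'
  · rintro ⟨h₁, h₂, h₃, _, h₄, h₅⟩
    obtain ⟨e, h₁⟩ := restrict_ne_none.1 h₁
    refine ⟨e, h₁, fun k hk' ek => ?_, by rwa [e], h₄, fun k hk' => ?_⟩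
    · have := h₂ k (restrict_ne_none.2 ⟨ek.trans e, hk'⟩)
      rwa [hk k (ek.trans e), hk i e] at this
    · rw [e]
      exact h₅ _ (hlt k) ⟨k, hk', rfl⟩

theorem restrict_ne_none_of_eq {J O : Type} {o : J → Option O} {U : J → Prop} {i : J}
    (hi : o i ≠ none) (hU : U i) : restrict o U i ≠ none :=
  restrict_ne_none.2 ⟨hU, hi⟩

/-- The right side depends only on the contents of bucket p and on the link that enters it. -/
theorem isFirst_and_iff {o : I → Option (Obj c n)} {β : I → ℕ}
    (hs : ∀ i j, β i < β j → sortKey o i < sortKey o j) {i : I} {p : ℕ} :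
    (IsFirst o i ∧ β i = p) ↔ restrict o (β · = p) i ≠ none ∧
      (∀ j, restrict o (β · = p) j = restrict o (β · = p) i → i ≤ j) ∧
      ∀ j, restrict o (fun j => IsLink o β j p) j ≠ restrict o (β · = p) i := by
  have hs' : ∀ i j, o i ≠ none → o j ≠ none → β i < β j → sortKey o i < sortKey o j :=
    fun i j _ _ => hs i j
  have key : ∀ i, restrict o (β · = p) i ≠ none → (IsFirst o i ↔
      (∀ j, restrict o (β · = p) j = restrict o (β · = p) i → i ≤ j) ∧
      ∀ j, restrict o (fun j => IsLink o β j p) j ≠ restrict o (β · = p) i) := by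
    intro i hi
    obtain ⟨e, hi'⟩ := restrict_ne_none.1 hi
    rw [restrict_of_pos (U := (β · = p)) e, isFirst_iff hs' hi', e]
    refine and_congr ⟨fun h j hj => ?_, fun h j ej hj => ?_⟩ ⟨fun h j hj => ?_, fun h j hl hj => ?_⟩
    · obtain ⟨ej, _⟩ := restrict_ne_none.1 (by rw [hj]; exact hi')
      rw [restrict_of_pos (U := (β · = p)) ej] at hj
      exact h j ej hj
    · exact h j (by rw [restrict_of_pos (U := (β · = p)) ej, hj])
    · obtain ⟨ej, _⟩ := restrict_ne_none.1 (by rw [hj]; exact hi')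
      rw [restrict_of_pos (U := fun j => IsLink o β j p) ej] at hj
      exact h j ej hj
    · exact h j (by rw [restrict_of_pos (U := fun j => IsLink o β j p) hl, hj])
  constructor
  · rintro ⟨h₁, h₂⟩
    have := restrict_ne_none_of_eq (U := (β · = p)) h₁.1 h₂
    exact ⟨this, (key i this).1 h₁⟩
  · rintro ⟨h₁, h₂⟩
    exact ⟨(key i h₁).2 h₂, (restrict_ne_none.1 h₁).1⟩

/-- The number of rounds in which ranks are computed from sorted buckets. -/
def rankRounds (a c F : ℕ) : ℕ :=
  objectRounds (2 * a + 1) c F + (routeRounds (2 * a + 1 + (F + 2)) F +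
    (objectRounds (3 * a) c F + (routeRounds (2 * a + 1 + (F + 2)) F +
      routeRounds (2 * a + 1 + (F + 2)) F)))

omit [LinearOrder I] [LinearOrder (Obj c n)] in
theorem card_sel_le_sum_cost (o : I → Option (Obj c n)) (P : I → Prop) (hP : ∀ i, P i → o i ≠ none) :
    (sel Finset.univ P).card ≤ ∑ i ∈ sel Finset.univ P, cost (o i) := by
  rw [Finset.card_eq_sum_ones]
  exact Finset.sum_le_sum fun i hi => one_le_cost (hP i (mem_sel.1 hi).2)

/-- From sorted buckets of load `O(n)`, the owners of the items learn the ranks of these. -/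
theorem within_ranks (hb : 1 ≤ b) (h : Sortable hn own o a F G N m L) (X : Ω → Fin n → In)
    (κ : Fin n → Ω → Ω → Prop) (ho : ∀ i, Knows κ (own i) fun ω => o ω i) (β : Ω → I → ℕ)
    (hβ : ∀ i, Knows κ (own i) fun ω => β ω i) (hlt : ∀ ω i, β ω i < N)
    (hs : ∀ ω i j, β ω i < β ω j → sortKey (o ω) i < sortKey (o ω) j) (Y : ℕ)
    (hY : Y ≤ F * n) (hGY : G * Y ≤ F * n)
    (hload : ∀ ω p, ∑ i ∈ sel Finset.univ fun i => β ω i = p, cost (o ω i) ≤ Y) :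
    Within b X (rankRounds a c F) κ (fun κ' => ∀ i, Knows κ' (own i) fun ω =>
      (o ω i).map fun B => Set.ncard {A : Obj c n | (∃ j, o ω j = some A) ∧ A < B}) := by
  classical
  have hF1 : 1 ≤ F * n := h.arity_pos.trans_le h.arity_le
  have hload' : ∀ ω z, ∑ i ∈ sel Finset.univ fun i => β ω i = z ∧ o ω i ≠ none, cost (o ω i)
      ≤ Y := by
    intro ω z
    refine le_trans (Finset.sum_le_sum_of_subset fun i hi => ?_) (hload ω z)
    rw [mem_sel] at hi ⊢
    exact ⟨hi.1, hi.2.1⟩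
  refine (within_deliver hb h X κ ho β hβ Y hGY hload').bind fun κ₁ hκ₁ h₁ => ?_
  -- One bit per bucket tells every node which buckets are nonempty, so a host can find the next
  -- nonempty bucket.
  refine (within_broadcast hb h X κ₁
    (fun ω p => if ∃ k, o ω k ≠ none ∧ β ω k = p then 1 else 0) ?_ ?_).bind fun κ₂ hκ₂ h₂ => ?_
  · intro ω p _
    split_ifs <;> omega
  · intro p hp ω ω' hω
    have e := h₁ p hp hω
    have e' : ∀ ω, (∃ k, o ω k ≠ none ∧ β ω k = p) ↔
        ∃ k, restrict (o ω) (β ω · = p) k ≠ none := by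
      intro ω
      simp only [restrict_ne_none, and_comm]
    simp only at e
    simp only [e', e]
  have hne : ∀ v, ∀ p < N, Knows κ₂ v fun ω => (∃ k, o ω k ≠ none ∧ β ω k = p) := by
    intro v p hp
    refine (h₂ v p hp).congr fun ω ω' h => propext ?_
    by_cases h₃ : ∃ k, o ω k ≠ none ∧ β ω k = p <;>
      by_cases h₄ : ∃ k, o ω' k ≠ none ∧ β ω' k = p
    · exact iff_of_true h₃ h₄
    · rw [if_pos h₃, if_neg h₄] at h
      exact absurd h one_ne_zero
    · rw [if_neg h₃, if_pos h₄] at h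
      exact absurd h zero_ne_one
    · exact iff_of_false h₃ h₄
  -- The tag of a link names the item, the receiving bucket and also the sending bucket, so that
  -- both end points are determined by the tag.
  let lk : (I × Fin N) × Fin N → Ω → Option (Obj c n) := fun τ ω =>
    restrict (o ω) (fun i => β ω i = τ.2 ∧ IsLink (o ω) (β ω) i τ.1.2) τ.1.1
  have hlk : ∀ τ ω, cost (lk τ ω) ≠ 0 → β ω τ.1.1 = τ.2 ∧ IsLink (o ω) (β ω) τ.1.1 τ.1.2 := by
    intro τ ω hτ
    by_contra hcon
    refine hτ ?_
    simp only [lk]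
    rw [restrict_of_neg (U := fun i => β ω i = τ.2 ∧ IsLink (o ω) (β ω) i τ.1.2) hcon]
    rfl
  have hlkL : ∀ τ ω, cost (lk τ ω) ≤ L := by
    intro τ ω
    by_cases hc : β ω τ.1.1 = τ.2 ∧ IsLink (o ω) (β ω) τ.1.1 τ.1.2
    · simp only [lk]
      rw [restrict_of_pos (U := fun i => β ω i = τ.2 ∧ IsLink (o ω) (β ω) i τ.1.2) hc]
      exact h.cost_le ω _
    · by_contra hcon
      exact hc (hlk τ ω (by omega))
  have hGL : G * L ≤ F * n := by
    refine le_trans ?_ h.tree_load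
    have := h.arity_pos
    rw [mul_assoc]
    refine Nat.mul_le_mul_left _ ?_
    rw [← mul_assoc]
    exact Nat.le_mul_of_pos_left _ (Nat.mul_pos this this)
  refine (within_route_objects hb hn X κ₂ (3 * a) F (T := (I × Fin N) × Fin N) ?_
    (fun τ => host hn τ.2) (fun τ => host hn τ.1.2) lk ?_ ?_ ?_).bind fun κ₃ hκ₃ h₃ => ?_
  · rw [Fintype.card_prod, Fintype.card_prod, Fintype.card_fin, mul_comm 3 a, pow_mul, pow_succ,
      pow_two]
    exact Nat.mul_le_mul (Nat.mul_le_mul h.card_le h.places_card) h.places_card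
  · rintro ⟨⟨i, p'⟩, p⟩ ω ω' hω
    have e₁ := h₁ p p.2 (hκ₂ _ _ _ hω)
    have e₂ : ∀ q < N, _ := fun q hq => hne (host hn p) q hq hω
    have e₃ : ∀ q < N, ((∃ k, o ω k ≠ none ∧ β ω k = q) ↔ ∃ k, o ω' k ≠ none ∧ β ω' k = q) :=
      fun q hq => iff_of_eq (e₂ q hq)
    simp only at e₁
    have e₄ : (β ω i = p ∧ IsLink (o ω) (β ω) i p') ↔ (β ω' i = p ∧ IsLink (o ω') (β ω') i p') := by
      rw [isLink_iff (hlt ω), isLink_iff (hlt ω'), e₁]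
      refine and_congr_right fun _ => and_congr_right fun _ => and_congr_right fun _ =>
        and_congr_right fun hp' => and_congr (e₃ _ hp') ?_
      exact forall₂_congr fun q hq => by rw [e₃ q hq]
    simp only [lk, restrict]
    by_cases hc : β ω' i = p ∧ IsLink (o ω') (β ω') i p'
    · rw [if_pos hc, if_pos (e₄.2 hc)]
      have := congrFun e₁ i
      rwa [restrict_of_pos (U := (β ω · = p)) (e₄.2 hc).1,
        restrict_of_pos (U := (β ω' · = p)) hc.1] at this
    · rw [if_neg hc, if_neg (fun hc' => hc (e₄.1 hc'))]
  · intro ω v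
    rw [filter_eq_sel]
    refine (sum_fiber_le (fun τ => cost (lk τ ω)) (fun τ => τ.2) (fun z => host hn z = v)
      (h.fiber_le v) (Y := L) fun z => ?_).trans hGL
    refine sum_le_of_unique (fun τ => hlkL τ ω) fun τ hτ τ' hτ' hx hx' => ?_
    obtain ⟨⟨i, p'⟩, p⟩ := τ
    obtain ⟨⟨i', q'⟩, q⟩ := τ'
    have e₁ := hlk _ ω hx
    have e₂ := hlk _ ω hx'
    have e₃ : p = q := (mem_sel.1 hτ).2.trans (mem_sel.1 hτ').2.symm
    subst e₃
    obtain ⟨e₄, e₅⟩ := e₁.2.right_unique e₂.2 (e₁.1.trans e₂.1.symm)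
    simp only at e₄ e₅
    rw [e₄, Fin.ext e₅]
  · intro ω v
    rw [filter_eq_sel]
    refine (sum_fiber_le (fun τ => cost (lk τ ω)) (fun τ => τ.1.2) (fun z => host hn z = v)
      (h.fiber_le v) (Y := L) fun z => ?_).trans hGL
    refine sum_le_of_unique (fun τ => hlkL τ ω) fun τ hτ τ' hτ' hx hx' => ?_
    obtain ⟨⟨i, p'⟩, p⟩ := τ
    obtain ⟨⟨i', q'⟩, q⟩ := τ'
    have e₁ := hlk _ ω hx
    have e₂ := hlk _ ω hx'
    have e₃ : p' = q' := (mem_sel.1 hτ).2.trans (mem_sel.1 hτ').2.symm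
    subst e₃
    have e₄ : i = i' := e₁.2.left_unique e₂.2
    subst e₄
    have e₅ : p = q := Fin.ext (e₁.1.symm.trans e₂.1)
    rw [e₅]
  have hlink : ∀ p < N, Knows κ₃ (host hn p) fun ω =>
      restrict (o ω) fun j => IsLink (o ω) (β ω) j p := by
    intro p hp ω ω' hω
    funext i
    apply Option.ext
    intro A
    have e₁ : ∀ ω, restrict (o ω) (fun j => IsLink (o ω) (β ω) j p) i = some A ↔
        ∃ q : Fin N, lk ((i, ⟨p, hp⟩), q) ω = some A := by
      intro ω
      simp only [lk, restrict_eq_some]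
      exact ⟨fun ⟨hl, hA⟩ => ⟨⟨β ω i, hlt ω i⟩, ⟨rfl, hl⟩, hA⟩, fun ⟨q, ⟨_, hl⟩, hA⟩ => ⟨hl, hA⟩⟩
    rw [e₁, e₁]
    exact exists_congr fun q => by
      have := h₃ ((i, ⟨p, hp⟩), q) hω
      rw [this]
  have hfirst : ∀ p < N, Knows κ₃ (host hn p) fun ω i => (IsFirst (o ω) i ∧ β ω i = p) := by
    intro p hp ω ω' hω
    funext i
    have e₁ := h₁ p hp (hκ₂ _ _ _ (hκ₃ _ _ _ hω))
    have e₂ := hlink p hp hω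
    simp only at e₁ e₂
    change (IsFirst (o ω) i ∧ β ω i = p) = (IsFirst (o ω') i ∧ β ω' i = p)
    rw [isFirst_and_iff (hs ω), isFirst_and_iff (hs ω'), e₁, e₂]
  have hcount : ∀ ω p, (sel Finset.univ fun j => IsFirst (o ω) j ∧ β ω j = p).card ≤ Y := by
    intro ω p
    refine (card_sel_le_sum_cost (o ω) _ fun i hi => hi.1.1).trans
      (le_trans (Finset.sum_le_sum_of_subset fun i hi => ?_) (hload ω p))
    rw [mem_sel] at hi ⊢
    exact ⟨hi.1, hi.2.2⟩
  refine (within_broadcast hb h X κ₃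
    (fun ω p => (sel Finset.univ fun j => IsFirst (o ω) j ∧ β ω j = p).card)
    (fun ω p _ => (hcount ω p).trans hY) ?_).bind fun κ₄ hκ₄ h₄ => ?_
  · exact fun p hp => (hfirst p hp).congr fun ω ω' h => by rw [h]
  -- The count includes the first occurrence of the object itself; subtracting 1 leaves the rank.
  let val : I × Fin N → Ω → Option ℕ := fun τ ω =>
    if restrict (o ω) (fun i => β ω i = τ.2) τ.1 ≠ none then
      some ((sel Finset.univ fun j => IsFirst (o ω) j ∧
        sortKey (o ω) j ≤ sortKey (o ω) τ.1).card - 1) else none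
  have hval : ∀ τ ω, numCost (val τ ω) ≤ cost (restrict (o ω) (fun i => β ω i = τ.2) τ.1) := by
    intro τ ω
    by_cases hc : restrict (o ω) (fun i => β ω i = τ.2) τ.1 ≠ none
    · simp only [val, if_pos hc]
      exact one_le_cost hc
    · simp only [val, if_neg hc]
      exact Nat.zero_le _
  refine (within_route_numbers hb hn X κ₄ (2 * a + 1) (F + 2) F (T := I × Fin N)
    h.card_tags_le (fun τ => host hn τ.2) (fun τ => own τ.1) val ?_ ?_ ?_ ?_).mono
    fun κ₅ hκ₅ h₅ i ω ω' hω => ?_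
  · rintro ⟨i, z⟩ ω ω' hω
    have hω₃ := hκ₄ _ _ _ hω
    have e₁ := h₁ z z.2 (hκ₂ _ _ _ (hκ₃ _ _ _ hω₃))
    have e₂ := hfirst z z.2 hω₃
    simp only at e₁ e₂
    simp only [val]
    rw [e₁]
    by_cases hne' : restrict (o ω') (fun i => β ω' i = z) i ≠ none
    · rw [if_pos hne', if_pos hne']
      have hne : restrict (o ω) (fun i => β ω i = z) i ≠ none := by rw [e₁]; exact hne'
      obtain ⟨hz, hi⟩ := restrict_ne_none.1 hne
      obtain ⟨hz', hi'⟩ := restrict_ne_none.1 hne'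
      rw [card_isFirst_le (fun i j _ _ => hs ω i j) hi, card_isFirst_le (fun i j _ _ => hs ω' i j) hi',
        hz, hz']
      congr 3
      · refine Finset.sum_congr rfl fun p hp => ?_
        exact h₄ (host hn z) p ((Finset.mem_range.1 hp).trans z.2) hω
      · congr 1
        ext j
        simp only [mem_sel, Finset.mem_univ, true_and, ← and_assoc]
        have e₃ : (IsFirst (o ω) j ∧ β ω j = z) ↔ (IsFirst (o ω') j ∧ β ω' j = z) :=
          iff_of_eq (congrFun e₂ j)
        rw [e₃]
        refine and_congr_right fun hj' => ?_
        have hk : ∀ ω k, β ω k = z → sortKey (restrict (o ω) (β ω · = z)) k = sortKey (o ω) k :=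
          fun ω k hk => by rw [sortKey, restrict_of_pos (U := (β ω · = z)) hk, sortKey]
        rw [← hk ω j (e₃.2 hj').2, ← hk ω i hz, ← hk ω' j hj'.2, ← hk ω' i hz', e₁]
    · rw [if_neg hne', if_neg hne']
  · intro τ ω x hx
    simp only [val] at hx
    split_ifs at hx with hc
    · obtain rfl := Option.some.inj hx
      refine lt_of_le_of_lt ?_ h.mul_lt
      refine (Nat.sub_le _ _).trans ?_
      refine (card_sel_le_sum_cost (o ω) _ fun i hi => hi.1.1).trans ?_
      exact (Finset.sum_le_sum_of_subset (Finset.subset_univ _)).trans (h.sum_cost_le ω)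
    · simp at hx
  · intro ω v
    refine (Finset.sum_le_sum fun τ _ => hval τ ω).trans ?_
    refine (sum_pairs_le (fun τ : I × Fin N => cost (restrict (o ω) (fun i => β ω i = τ.2) τ.1))
      (fun z => host hn z = v) (h.fiber_le v) (Y := Y) fun z => ?_).trans hGY
    exact (sum_cost_restrict (o ω) _).trans_le (hload' ω z)
  · intro ω v
    refine (Finset.sum_le_sum fun τ _ => hval τ ω).trans ?_
    exact sum_pairs_left_le (fun τ => cost (restrict (o ω) (fun i => β ω i = τ.2) τ.1))
      (fun i => own i = v) _ (h.owner_load ω v) (sum_cost_restrict_place_le (o ω) (β ω))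
  · have hω₀ := hκ₁ _ _ _ (hκ₂ _ _ _ (hκ₃ _ _ _ (hκ₄ _ _ _ (hκ₅ _ _ _ hω))))
    have e₁ := hβ i hω₀
    have e₂ := ho i hω₀
    simp only at e₁ e₂ ⊢
    rcases hi' : o ω' i with _ | B
    · rw [e₂, hi']; rfl
    · have hi : o ω i = some B := e₂.trans hi'
      have := h₅ (i, ⟨β ω' i, hlt ω' i⟩) hω
      simp only [val] at this
      rw [if_pos (restrict_ne_none (U := fun j => β ω j = β ω' i) |>.2 ⟨e₁, by simp [hi]⟩),
        if_pos (restrict_ne_none (U := fun j => β ω' j = β ω' i) |>.2 ⟨rfl, by simp [hi']⟩),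
        ← ncard_lt_add_one hi, ← ncard_lt_add_one hi', Nat.add_sub_cancel, Nat.add_sub_cancel] at this
      rw [hi]
      exact this

end Ranks

end CongestedClique

/-! ### From inputs to items, and the choice of parameters. -/

namespace CongestedClique

section Lists

variable {n c : ℕ}

/-- Empty objects have size 0, so bounds on sizes do not bound the number of objects. Without
repetitions there is at most one empty object; for this reason items are distinct objects of a node.
-/
theorem length_le_sum_size_add_one {l : List (Obj c n)} (hl : l.Nodup) :
    l.length ≤ (l.map Obj.size).sum + 1 := by
  classical
  have key : ∀ l : List (Obj c n), l.length ≤ (l.map Obj.size).sum + l.count ⟨[]⟩ := by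
    intro l
    induction l with
    | nil => simp
    | cons B l ih =>
      rw [List.length_cons, List.map_cons, List.sum_cons]
      by_cases hB : B = ⟨[]⟩
      · rw [hB, List.count_cons_self]
        omega
      · have : 0 < B.size := List.length_pos_iff.2 fun h => hB (Obj.ext h)
        rw [List.count_cons_of_ne hB]
        omega
  exact (key l).trans (Nat.add_le_add_left (List.nodup_iff_count_le_one.1 hl _) _)

theorem sum_cost_getElem?_le (l : List (Obj c n)) (J : ℕ) :
    ∑ k ∈ Finset.range J, cost l[k]? ≤ (l.map Obj.size).sum + l.length := by
  induction l generalizing J with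
  | nil => simp [cost]
  | cons B l ih =>
    cases J with
    | zero => simp
    | succ J =>
      rw [Finset.sum_range_succ']
      have := ih J
      have hB : cost (some B) = B.size + 1 := rfl
      simp only [List.getElem?_cons_succ, List.getElem?_cons_zero, hB, List.map_cons,
        List.sum_cons, List.length_cons]
      omega

theorem sum_size_dedup_le [DecidableEq (Obj c n)] (l : List (Obj c n)) :
    (l.dedup.map Obj.size).sum ≤ (l.map Obj.size).sum :=
  ((List.dedup_sublist l).map _).sum_le_sum fun _ _ => Nat.zero_le _

end Lists

section Arity

/-- The smallest arity for which a tree of depth `H` has at least `n` leaves. -/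
theorem exists_arity {n H : ℕ} (hn : 0 < n) (hH : 0 < H) :
    ∃ m, 0 < m ∧ n ≤ m ^ H ∧ m ^ H ≤ 2 ^ H * n := by
  classical
  have ex : ∃ m, n ≤ m ^ H := ⟨n, Nat.le_self_pow hH.ne' n⟩
  refine ⟨Nat.find ex, Nat.pos_of_ne_zero fun h => ?_, Nat.find_spec ex, ?_⟩
  · have := Nat.find_spec ex
    rw [h, zero_pow hH.ne'] at this
    omega
  · rcases Nat.lt_or_ge (Nat.find ex) 2 with h | h
    · calc Nat.find ex ^ H ≤ 1 ^ H := Nat.pow_le_pow_left (by omega) H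
        _ ≤ 2 ^ H * n := by rw [one_pow]; exact Nat.mul_pos (by positivity) hn
    · have h' := Nat.find_min ex (m := Nat.find ex - 1) (by omega)
      -- Minimality gives (m - 1) ^ H < n, and m ≤ 2 * (m - 1) as m ≥ 2.
      calc Nat.find ex ^ H ≤ (2 * (Nat.find ex - 1)) ^ H := Nat.pow_le_pow_left (by omega) H
        _ = 2 ^ H * (Nat.find ex - 1) ^ H := mul_pow _ _ _
        _ ≤ 2 ^ H * n := Nat.mul_le_mul_left _ (by omega)

/-- Here m² ≤ 4 * n ^ (2 / H). The exponent 2 / H is at most ε, which compensates n ^ (1 - ε), and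
at most 1, which takes care of the extra packet per object. -/
theorem arity_sq_mul_le {n H m L K : ℕ} {ε C : ℝ} (hn : 0 < n) (hH : 2 ≤ H) (hε : 2 / ε ≤ H)
    (hε0 : 0 < ε) (hm : m ^ H ≤ 2 ^ H * n) (hL : (L : ℝ) ≤ C * (n : ℝ) ^ (1 - ε) + 1)
    (hC : 0 ≤ C) (hK : 4 * (C + 1) ≤ K) : m * m * L ≤ K * n := by
  have hn1 : (1 : ℝ) ≤ n := by exact_mod_cast hn
  have hn0 : (0 : ℝ) < n := by linarith
  have hH0 : (0 : ℝ) < H := by positivity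
  have hHne : H ≠ 0 := by omega
  have hm1 : (m : ℝ) ≤ 2 * (n : ℝ) ^ ((H : ℝ)⁻¹) := by
    refine le_of_pow_le_pow_left₀ hHne (by positivity) ?_
    rw [mul_pow, Real.rpow_inv_natCast_pow hn0.le hHne]
    exact_mod_cast hm
  have hmm : (m : ℝ) * m ≤ 4 * (n : ℝ) ^ (2 / (H : ℝ)) := by
    calc (m : ℝ) * m ≤ (2 * (n : ℝ) ^ ((H : ℝ)⁻¹)) * (2 * (n : ℝ) ^ ((H : ℝ)⁻¹)) := by gcongr
      _ = 4 * ((n : ℝ) ^ ((H : ℝ)⁻¹) * (n : ℝ) ^ ((H : ℝ)⁻¹)) := by ring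
      _ = _ := by rw [← Real.rpow_add hn0]; congr 2; ring
  have h1 : (n : ℝ) ^ (2 / (H : ℝ)) ≤ n := by
    calc (n : ℝ) ^ (2 / (H : ℝ)) ≤ (n : ℝ) ^ (1 : ℝ) :=
          Real.rpow_le_rpow_of_exponent_le hn1 (by
            rw [div_le_one hH0]; exact_mod_cast hH)
      _ = n := Real.rpow_one _
  have h2 : (n : ℝ) ^ (2 / (H : ℝ)) * (n : ℝ) ^ (1 - ε) ≤ n := by
    calc (n : ℝ) ^ (2 / (H : ℝ)) * (n : ℝ) ^ (1 - ε) = (n : ℝ) ^ (2 / (H : ℝ) + (1 - ε)) :=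
          (Real.rpow_add hn0 _ _).symm
      _ ≤ (n : ℝ) ^ (1 : ℝ) := Real.rpow_le_rpow_of_exponent_le hn1 (by
            have : 2 / (H : ℝ) ≤ ε := by
              rw [div_le_iff₀ hH0]
              rw [div_le_iff₀ hε0] at hε
              linarith
            linarith)
      _ = n := Real.rpow_one _
  have : ((m * m * L : ℕ) : ℝ) ≤ ((K * n : ℕ) : ℝ) := by
    push_cast
    calc (m : ℝ) * m * L ≤ (4 * (n : ℝ) ^ (2 / (H : ℝ))) * (C * (n : ℝ) ^ (1 - ε) + 1) := by gcongr
      _ = 4 * (C * ((n : ℝ) ^ (2 / (H : ℝ)) * (n : ℝ) ^ (1 - ε)) + (n : ℝ) ^ (2 / (H : ℝ))) := by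
          ring
      _ ≤ 4 * (C * n + n) := by gcongr
      _ = 4 * (C + 1) * n := by ring
      _ ≤ K * n := by gcongr
  exact_mod_cast this

theorem card_host_le {n N : ℕ} (hn : 0 < n) (v : Fin n) :
    (sel Finset.univ fun z : Fin N => host hn z = v).card ≤ N / n + 1 := by
  refine le_trans ?_ (card_range_filter_mod_le N n v)
  rw [← Finset.card_map Fin.valEmbedding]
  refine Finset.card_le_card fun z hz => ?_
  obtain ⟨z, hz', rfl⟩ := Finset.mem_map.1 hz
  have h := (mem_sel.1 hz').2
  rw [Finset.mem_filter]
  exact ⟨Finset.mem_range.2 z.2, congrArg Fin.val h⟩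

end Arity

section Items

variable {n c J : ℕ}

/-- The owner of the item `(v, k)` is the node `v`. -/
def itemOwner (i : Fin n ×ₗ Fin J) : Fin n := (ofLex i).1

/-- The item `(v, k)` is the `k`-th distinct object of the node `v`, if there is one. -/
noncomputable def itemObj (x : Fin n → List (Obj c n)) (i : Fin n ×ₗ Fin J) : Option (Obj c n) :=
  letI := Classical.decEq (Obj c n)
  (x (ofLex i).1).dedup[((ofLex i).2 : ℕ)]?

theorem itemOwner_mono : Monotone (itemOwner (n := n) (J := J)) := by
  intro i j hij
  rcases Prod.Lex.le_iff.1 hij with h | h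
  · exact h.le
  · exact h.1.le

theorem mem_of_itemObj {x : Fin n → List (Obj c n)} {i : Fin n ×ₗ Fin J} {B : Obj c n}
    (h : itemObj x i = some B) : B ∈ x (itemOwner i) := by
  let := Classical.decEq (Obj c n)
  exact List.mem_dedup.1 (List.mem_of_getElem? h)

theorem exists_itemObj {x : Fin n → List (Obj c n)} {v : Fin n} {B : Obj c n} (h : B ∈ x v)
    (hJ : ((x v).map Obj.size).sum + 1 ≤ J) :
    ∃ i : Fin n ×ₗ Fin J, itemOwner i = v ∧ itemObj x i = some B := by
  let := Classical.decEq (Obj c n)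
  obtain ⟨k, hk⟩ := List.mem_iff_getElem?.1 (List.mem_dedup.2 h)
  obtain ⟨hk', -⟩ := List.getElem?_eq_some_iff.1 hk
  have h1 := length_le_sum_size_add_one (List.nodup_dedup (x v))
  have h2 := sum_size_dedup_le (x v)
  exact ⟨toLex (v, ⟨k, by omega⟩), rfl, hk⟩

theorem sum_cost_itemObj_le (x : Fin n → List (Obj c n)) (v : Fin n) :
    ∑ i ∈ sel Finset.univ fun i : Fin n ×ₗ Fin J => itemOwner i = v, cost (itemObj x i) ≤
      2 * ((x v).map Obj.size).sum + 1 := by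
  let := Classical.decEq (Obj c n)
  have h1 := length_le_sum_size_add_one (List.nodup_dedup (x v))
  have h2 := sum_size_dedup_le (x v)
  have h3 := sum_cost_getElem?_le (x v).dedup J
  have : ∑ i ∈ sel Finset.univ fun i : Fin n ×ₗ Fin J => itemOwner i = v, cost (itemObj x i) =
      ∑ k ∈ Finset.range J, cost (x v).dedup[k]? := by
    rw [Finset.sum_range]
    refine Finset.sum_nbij' (fun i => (ofLex i).2) (fun k => toLex (v, k)) (by simp) (by simp [itemOwner])
      ?_ (by simp) ?_
    · intro i hi
      have := (mem_sel.1 hi).2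
      subst this
      rfl
    · intro i hi
      have := (mem_sel.1 hi).2
      subst this
      rfl
  omega

theorem knows_itemObj {Ω : Type} {X : Ω → Fin n → List (Obj c n)} {κ : Fin n → Ω → Ω → Prop}
    (h : ∀ v, Knows κ v fun ω => X ω v) (i : Fin n ×ₗ Fin J) :
    Knows κ (itemOwner i) fun ω => itemObj (X ω) i :=
  (h _).congr fun ω ω' e => by
    have e' : X ω (ofLex i).1 = X ω' (ofLex i).1 := e
    unfold itemObj
    rw [e']

theorem rank_eq_ncard_items (ord : LinearOrder (Obj c n)) (x : Fin n → List (Obj c n))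
    (hJ : ∀ v, ((x v).map Obj.size).sum + 1 ≤ J) (B : Obj c n) :
    rank ord x B =
      Set.ncard {A : Obj c n | (∃ i : Fin n ×ₗ Fin J, itemObj x i = some A) ∧ A < B} := by
  unfold rank
  congr 1
  ext A
  refine and_congr_left fun _ => ⟨fun ⟨v, hv⟩ => ?_, fun ⟨i, hi⟩ => ⟨_, mem_of_itemObj hi⟩⟩
  obtain ⟨i, -, hi⟩ := exists_itemObj hv (hJ v)
  exact ⟨i, hi⟩

theorem knows_map_rank (ord : LinearOrder (Obj c n)) {Ω : Type} {X : Ω → Fin n → List (Obj c n)}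
    {κ : Fin n → Ω → Ω → Prop} (hJ : ∀ ω v, ((X ω v).map Obj.size).sum + 1 ≤ J)
    (hX : ∀ v, Knows κ v fun ω => X ω v)
    (hr : ∀ i : Fin n ×ₗ Fin J, Knows κ (itemOwner i) fun ω => (itemObj (X ω) i).map fun B =>
      Set.ncard {A : Obj c n | (∃ j : Fin n ×ₗ Fin J, itemObj (X ω) j = some A) ∧ A < B})
    (v : Fin n) : Knows κ v fun ω => (X ω v).map (rank ord (X ω)) := by
  intro ω ω' hω
  have e : X ω v = X ω' v := hX v hω
  simp only [← e]
  refine List.map_congr_left fun B hB => ?_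
  obtain ⟨i, rfl, hi⟩ := exists_itemObj hB (hJ ω v)
  have hi' : itemObj (X ω') i = some B := by rw [← hi]; exact (knows_itemObj hX i hω).symm
  have := hr i hω
  simp only [hi, hi', Option.map_some, Option.some.injEq] at this
  rw [rank_eq_ncard_items ord _ (hJ ω), rank_eq_ncard_items ord _ (hJ ω'), this]

end Items

theorem exists_algorithm (ε C D : ℝ) (hε : 0 < ε) {b c : ℕ} (hb : 1 ≤ b) :
    ∃ R : ℕ, ∀ (n : ℕ) (ord : LinearOrder (Obj c n)),
      ∃ P : Algorithm n (Word b n) (List (Obj c n)) (List ℕ), SortsWithin ε C D ord P R := by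
  -- The depth exceeds 2 / ε and is at least 2, as the bound on m² * L requires.
  obtain ⟨H, hH⟩ : ∃ H : ℕ, H = ⌈2 / ε⌉₊ + 2 := ⟨_, rfl⟩
  obtain ⟨d, hd⟩ : ∃ d : ℕ, D ≤ d := exists_nat_ge D
  obtain ⟨C₀, hC₀⟩ : ∃ C₀ : ℕ, C ≤ C₀ := exists_nat_ge C
  -- The first summand bounds m² * L, the second the cost of the distinct objects of a node, both
  -- divided by n.
  obtain ⟨F₀, hF₀⟩ : ∃ F₀, F₀ = 4 * (C₀ + 1) + (2 * d + 1) := ⟨_, rfl⟩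
  -- The at most 2 ^ H * n places leave at most this many to each host.
  obtain ⟨G, hG⟩ : ∃ G, G = 2 ^ H + 1 := ⟨_, rfl⟩
  obtain ⟨F, hF⟩ : ∃ F, F = G * (loadFactor H F₀ H + F₀) + G := ⟨_, rfl⟩
  obtain ⟨a, ha⟩ : ∃ a, a = 2 ^ H + (d + 3) := ⟨_, rfl⟩
  have hF₀F : G * F₀ ≤ F := by rw [hF, mul_add]; omega
  have hYF : G * loadFactor H F₀ H ≤ F := by rw [hF, mul_add]; omega
  have hG1 : 1 ≤ G := hG ▸ Nat.le_add_left 1 _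
  have hGF : G ≤ F := by omega
  refine ⟨0 + (sortRounds a c F H H + rankRounds a c F), fun n ord => ?_⟩
  rcases Nat.eq_zero_or_pos n with rfl | hn
  · exact ⟨⟨Unit, fun _ _ => (), fun _ _ _ => default, fun _ _ _ => (), fun _ _ => []⟩,
      fun x _ v => v.elim0⟩
  obtain ⟨m, hm, hnm, hmn⟩ := exists_arity (H := H) hn (by omega)
  have hLC : (⌊(C₀ : ℝ) * (n : ℝ) ^ (1 - ε)⌋₊ + 1 : ℕ) ≤ (C₀ : ℝ) * (n : ℝ) ^ (1 - ε) + 1 := by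
    push_cast
    gcongr
    exact Nat.floor_le (by positivity)
  set L : ℕ := ⌊(C₀ : ℝ) * (n : ℝ) ^ (1 - ε)⌋₊ + 1 with hL
  have hmL : m * m * L ≤ F₀ * n :=
    arity_sq_mul_le hn (by omega)
      ((Nat.le_ceil _).trans (by rw [hH]; push_cast; linarith)) hε hmn hLC
      (Nat.cast_nonneg _) (by rw [hF₀]; push_cast; linarith [(Nat.cast_nonneg d : (0 : ℝ) ≤ d)])
  -- Knowledge is relative to admissible inputs only, so all load bounds hold for every input
  -- considered.
  let X : {x : Fin n → List (Obj c n) // Admissible ε C D x} → Fin n → List (Obj c n) :=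
    Subtype.val
  have hsize : ∀ ω v, ((X ω v).map Obj.size).sum ≤ d * n := fun ω v => by
    have := ω.2.2 v
    have h' : D * (n : ℝ) ≤ d * n := by gcongr
    exact_mod_cast this.trans h'
  have hJ : ∀ ω v, ((X ω v).map Obj.size).sum + 1 ≤ (d + 1) * n := fun ω v => by
    have := hsize ω v
    rw [add_mul]
    omega
  have hload : ∀ ω v, ∑ i ∈ sel Finset.univ fun i : Fin n ×ₗ Fin ((d + 1) * n) => itemOwner i = v,
      cost (itemObj (X ω) i) ≤ F₀ * n := fun ω v => by
    have h1 := hsize ω v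
    have h2 := sum_cost_itemObj_le (J := (d + 1) * n) (X ω) v
    calc _ ≤ 2 * (d * n) + n := by omega
      _ = (2 * d + 1) * n := by ring
      _ ≤ F₀ * n := Nat.mul_le_mul_right _ (by omega)
  have hGF₀ : F₀ ≤ F := (Nat.le_mul_of_pos_left F₀ hG1).trans hF₀F
  have hmH : m ≤ m ^ H := Nat.le_self_pow (by omega) m
  have hsort : Sortable hn (itemOwner (n := n) (J := (d + 1) * n)) (fun ω => itemObj (X ω))
      a F G (m ^ H) m L :=
    { card_le := by
        rw [Fintype.card_lex, Fintype.card_prod, Fintype.card_fin, Fintype.card_fin]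
        calc n * ((d + 1) * n) ≤ (n + 1) * ((n + 1) ^ (d + 1) * (n + 1)) := by
              gcongr
              · omega
              · exact le_succ_pow hn _
              · omega
          _ = (n + 1) ^ (d + 3) := by ring
          _ ≤ (n + 1) ^ a := Nat.pow_le_pow_right (by omega) (by omega)
      own_mono := itemOwner_mono
      arity_pos := hm
      arity_le := (hmH.trans hmn).trans (Nat.mul_le_mul_right _ (by omega))
      cost_le := fun ω i => by
        cases h : itemObj (X ω) i with
        | none => simp [cost]
        | some B =>
          have h1 := ω.2.1 _ _ (mem_of_itemObj h)
          have h2 : C * (n : ℝ) ^ (1 - ε) ≤ C₀ * (n : ℝ) ^ (1 - ε) := by gcongr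
          exact Nat.succ_le_succ (Nat.le_floor (h1.trans h2))
      owner_load := fun ω v => (hload ω v).trans (Nat.mul_le_mul_right _ hGF₀)
      places_le := hmn.trans (Nat.mul_le_mul_right _ (by omega))
      places_card := by
        calc m ^ H ≤ 2 ^ H * n := hmn
          _ ≤ (n + 1) ^ (2 ^ H) * (n + 1) := Nat.mul_le_mul (le_succ_pow hn _) n.le_succ
          _ = (n + 1) ^ (2 ^ H + 1) := (pow_succ _ _).symm
          _ ≤ (n + 1) ^ a := Nat.pow_le_pow_right (by omega) (by omega)
      fiber_le := fun v => by
        refine (card_host_le hn v).trans ?_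
        rw [hG]
        exact Nat.succ_le_succ (Nat.div_le_of_le_mul (by rwa [mul_comm]))
      fiber_bound := hGF
      tree_load := by
        calc G * m * (m * L) = G * (m * m * L) := by ring
          _ ≤ G * (F₀ * n) := Nat.mul_le_mul_left _ hmL
          _ = G * F₀ * n := (mul_assoc _ _ _).symm
          _ ≤ F * n := Nat.mul_le_mul_right _ hF₀F }
  let := ord
  obtain ⟨β, hβlt, hβload, hβs, hβ⟩ := exists_within_buckets hb hsort X F₀ H (by omega) rfl hnm hmL
    hload (by omega) H le_rfl
  have hX₀ : ∀ v, Knows (fun v ω ω' => X ω v = X ω' v) v fun ω => X ω v := fun v _ _ h => h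
  have hrank := (hβ _ (knows_itemObj hX₀)).bind fun κ hκ hκβ =>
    (within_ranks hb hsort X κ (fun i => (knows_itemObj hX₀ i).mono hκ) β hκβ hβlt hβs
      (loadFactor H F₀ H * n)
      (Nat.mul_le_mul_right _ ((Nat.le_mul_of_pos_left _ hG1).trans hYF))
      (by rw [← mul_assoc]; exact Nat.mul_le_mul_right _ hYF)
      (fun ω p => by simpa using hβload ω p)).mono fun κ' hκ' h =>
        knows_map_rank ord hJ (fun v => ((hX₀ v).mono hκ).mono hκ') h
  obtain ⟨κ, hA, -, hκ⟩ := hrank 0 (attains_zero b X)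
  obtain ⟨P, hP⟩ := hA.exists_output _ hκ
  exact ⟨P, fun x hx v => hP ⟨x, hx⟩ v⟩

end CongestedClique

theorem theorem4 (ε : ℝ) (hε : 0 < ε) (C D : ℝ) (b c : ℕ) (hb : 1 ≤ b) :
    ∃ (R : ℕ) (P : (n : ℕ) → LinearOrder (CongestedClique.Obj c n) →
        CongestedClique.Algorithm n (CongestedClique.Word b n)
          (List (CongestedClique.Obj c n)) (List ℕ)),
      ∀ (n : ℕ) (ord : LinearOrder (CongestedClique.Obj c n)),
        CongestedClique.SortsWithin ε C D ord (P n ord) R := by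
  obtain ⟨R, h⟩ := CongestedClique.exists_algorithm ε C D hε (c := c) hb
  choose P hP using h
  exact ⟨R, P, hP⟩
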